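/- **Setting.** Let $n$ agents be the vertices of a connected undirected graph, and let $W=[w_{ij}]\in\mathbb{R}^{n\times n}$ be nonnegative and symmetric with $W\mathbf 1=\mathbf 1$, where for $i\ne j$ one has $w_{ij}>0$ exactly when $i,j$ are linked. Put $\lambda:=\|W-\mathbf 1\mathbf 1^{\mathrm T}/n\|_2$. For each $i$ let $\mathcal Y_i\subset\mathbb{R}^{m_i}$ be nonempty, convex and compact with diameter at most $D$, at least one $\mathcal Y_i$ having more than one point, and let $f_i:\mathbb{R}^d\times\mathcal Y_i\to\mathbb{R}$ be differentiable with gradient $\nabla f_i=(\nabla_xf_i,\nabla_yf_i)$, such that for some $L$ and $\mu>0$, for all $x,x'\in\mathbb{R}^d$ and $y,y'\in\mathcal Y_i$, $$\|\nabla f_i(x,y)-\nabla f_i(x',y')\|\le L(\|x-x'\|+\|y-y'\|),$$ $$f_i(x,y)\le f_i(x,y')+\langle\nabla_yf_i(x,y'),y-y'\rangle-\tfrac{\mu}{2}\|y-y'\|^2 .$$ Let $\kappa:=L/\mu$, let $\Phi(x):=\frac1n\sum_{i=1}^n\max_{y\in\mathcal Y_i}f_i(x,y)$, and suppose $\Phi(x)\ge\Phi^*>-\infty$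 for all $x\in\mathbb{R}^d$. Let all samples $\xi_{i,j}^t$ ($t\ge0$, $1\le i\le n$, $1\le j\le b$, with batch size $b\ge1$) be independent, and let the stochastic gradients $h_i=(h_{x,i},h_{y,i})$ satisfy, for all $(x,y)\in\mathbb{R}^d\times\mathcal Y_i$, $$\mathbb{E}\,h_i(x,y,\xi_{i,j}^t)=\nabla f_i(x,y),\qquad \mathbb{E}\|h_i(x,y,\xi_{i,j}^t)-\nabla f_i(x,y)\|^2\le\sigma^2 .$$ **Algorithm (DSGTA).** From deterministic $x_i^0\in\mathbb{R}^d$, $y_i^0\in\mathcal Y_i$ and with $\underline h_{\bullet,i}^t:=\frac1b\sum_{j=1}^bh_{\bullet,i}(x_i^t,y_i^t,\xi_{i,j}^t)$ for $\bullet\in\{x,y\}$, set $g_i^0=\underline h_{x,i}^0$ and, for $t\ge0$, $$x_i^{t+1}=\sum_{j}w_{ij}(x_j^t-\eta_xg_j^t),\quad y_i^{t+1}=\mathrm{Proj}_{\mathcal Y_i}\big(y_i^t+\eta_y\underline h_{y,i}^t\big),\quad g_i^{t+1}=\sum_jw_{ij}\big(g_j^t+\underline h_{x,j}^{t+1}-\underline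 h_{x,j}^t\big).$$ Write $\bar x^t:=\frac1n\sum_ix_i^t$ and $\Delta_\Phi:=\Phi(\bar x^0)-\Phi^*$. **Theorem.** Suppose $$0<\eta_y\le\frac{\sqrt{1-\lambda^2}}{9(L+\mu)},\qquad 0<\eta_x\le\min\Big\{\frac{(1-\lambda^2)^2}{120\sqrt3\,\kappa L},\ \frac{\eta_y}{8\sqrt6\,\kappa^2},\ \frac{(\eta_y\mu)^{1/4}(1-\lambda^2)}{50\kappa L}\Big\}$$ (the first condition forces $\lambda<1$). Then $\Phi$ is differentiable, each $\mathbb{E}\|\nabla\Phi(\bar x^t)\|^2$ is finite, and for every $T\ge1$ $$\begin{aligned}\frac1T\sum_{t=0}^{T-1}\mathbb{E}\|\nabla\Phi(\bar x^t)\|^2\le{}&\frac{2\Delta_\Phi}{\eta_xT}+\frac{600\kappa^2L^2\sum_{i=1}^n\|x_i^0-\bar x^0\|^2}{n(1-\lambda^2)T}+\frac{16D^2L^2}{\eta_y\mu T}+\frac{4800\eta_x^2\kappa^2L^2\sigma^2}{b(1-\lambda^2)^3T}+\frac{2\eta_xL\kappa\sigma^2}{nb}\\&+\frac{4800\eta_x^2\kappa^2L^2\sum_{i=1}^n\|\nabla_xf_i(x_i^0,y_i^0)\|^2}{n(1-\lambda^2)^3T}+\frac{48\eta_y\kappa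 L\sigma^2}{b}\\&+\Big[\frac1{n\eta_y^2\mu^2}+\frac{225}{(1-\lambda^2)^3}+\frac{54\eta_x^2\kappa^2L^2}{n(1-\lambda^2)\eta_y\mu}\Big]\frac{64\eta_x^2\kappa^2L^2\sigma^2}{b}.\end{aligned}$$ -/

import Mathlib

open MeasureTheory ProbabilityTheory

/-- The joint variable space `ℝ^d × ℝ^m` with the Euclidean norm; `p.fst` is the `x`-part and
`p.snd` the `y`-part. -/
abbrev JointSpace (d m : ℕ) : Type :=
  WithLp 2 (EuclideanSpace ℝ (Fin d) × EuclideanSpace ℝ (Fin m))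

/-- The pair `(x, y)` as a point of the joint variable space. -/
def joint {d m : ℕ} (x : EuclideanSpace ℝ (Fin d)) (y : EuclideanSpace ℝ (Fin m)) :
    JointSpace d m :=
  WithLp.toLp 2 (x, y)

/-- The average `(1/n) ∑ᵢ vᵢ` of the agents' vectors. -/
noncomputable def agentAvg {n d : ℕ} (v : Fin n → EuclideanSpace ℝ (Fin d)) :
    EuclideanSpace ℝ (Fin d) :=
  (1 / (n : ℝ)) • ∑ i, v i

/-- The assumption on the communication network: the undirected graph `G` is connected, distinct
agents are linked exactly when the corresponding weight is positive, and the mixing matrix `W` is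
nonnegative, symmetric and stochastic. -/
structure NetworkAssumption {n : ℕ} (G : SimpleGraph (Fin n)) (W : Matrix (Fin n) (Fin n) ℝ) :
    Prop where
  connected : G.Connected
  adj_iff : ∀ i j, i ≠ j → (G.Adj i j ↔ 0 < W i j)
  nonneg : ∀ i j, 0 ≤ W i j
  symm : W.transpose = W
  row_sum : ∀ i, ∑ j, W i j = 1

/-- The spectral norm `‖W - 𝟏𝟏ᵀ/n‖₂`. -/
noncomputable def mixingNorm {n : ℕ} (W : Matrix (Fin n) (Fin n) ℝ) : ℝ :=
  ‖Matrix.toEuclideanCLM (n := Fin n) (𝕜 := ℝ) (W - Matrix.of fun _ _ => 1 / (n : ℝ))‖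

/-- The local objective `f` (only its values on `ℝ^d × Y` matter) is differentiable on `ℝ^d × Y`
with gradient `f'`, `L`-smooth there, and `μ`-strongly concave in `y ∈ Y`. -/
structure SmoothStronglyConcave {d m : ℕ} (L μ : ℝ) (Y : Set (EuclideanSpace ℝ (Fin m)))
    (f : JointSpace d m → ℝ) (f' : JointSpace d m → JointSpace d m) : Prop where
  hasGradient : ∀ p : JointSpace d m, p.snd ∈ Y → HasGradientWithinAt f (f' p) {q | q.snd ∈ Y} p
  smooth : ∀ p q : JointSpace d m, p.snd ∈ Y → q.snd ∈ Y →
    ‖f' p - f' q‖ ≤ L * (‖p.fst - q.fst‖ + ‖p.snd - q.snd‖)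
  strongly_concave : ∀ (x : EuclideanSpace ℝ (Fin d)), ∀ y ∈ Y, ∀ y' ∈ Y,
    f (joint x y) ≤ f (joint x y') + inner ℝ (f' (joint x y')).snd (y - y') - μ / 2 * ‖y - y'‖ ^ 2

/-- The assumption on a constraint set: nonempty, convex, compact, of diameter at most `D`. -/
structure ConstraintAssumption {m : ℕ} (D : ℝ) (Y : Set (EuclideanSpace ℝ (Fin m))) : Prop where
  nonempty : Y.Nonempty
  convex : Convex ℝ Y
  compact : IsCompact Y
  diam_le : Metric.diam Y ≤ D

/-- `Φ(x) = (1/n) ∑ᵢ max_{y ∈ Yᵢ} fᵢ(x, y)`. -/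
noncomputable def primal {n d : ℕ} {m : Fin n → ℕ} (Y : ∀ i, Set (EuclideanSpace ℝ (Fin (m i))))
    (f : ∀ i, JointSpace d (m i) → ℝ) (x : EuclideanSpace ℝ (Fin d)) : ℝ :=
  (1 / (n : ℝ)) * ∑ i, sSup ((fun y => f i (joint x y)) '' Y i)

/-- The assumption on the stochastic gradient oracles. All samples `ξ t i j` (iteration `t`,
agent `i`, position `j` in the batch) are mutually independent; at every point of `ℝ^d × Yᵢ` the
estimate `hᵢ(x, y, ξ)` has mean `∇fᵢ(x, y)` and variance at most `σ²`. -/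
structure OracleAssumption {n d b : ℕ} {m : Fin n → ℕ} {Ω : Type*} [MeasurableSpace Ω]
    {Ξ : Fin n → Type*} [∀ i, MeasurableSpace (Ξ i)] (P : Measure Ω) (σ : ℝ)
    (Y : ∀ i, Set (EuclideanSpace ℝ (Fin (m i))))
    (f' : ∀ i, JointSpace d (m i) → JointSpace d (m i))
    (h : ∀ i, JointSpace d (m i) → Ξ i → JointSpace d (m i))
    (ξ : ℕ → ∀ i : Fin n, Fin b → Ω → Ξ i) : Prop where
  measurable_oracle : ∀ i, Measurable fun q : JointSpace d (m i) × Ξ i => h i q.1 q.2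
  measurable_sample : ∀ t i j, Measurable (ξ t i j)
  indep : iIndepFun (fun (k : ℕ × Fin n × Fin b) ω => ξ k.1 k.2.1 k.2.2 ω) P
  integrable : ∀ t i j, ∀ p : JointSpace d (m i), p.snd ∈ Y i →
    Integrable (fun ω => h i p (ξ t i j ω)) P
  unbiased : ∀ t i j, ∀ p : JointSpace d (m i), p.snd ∈ Y i →
    ∫ ω, h i p (ξ t i j ω) ∂P = f' i p
  integrable_sq : ∀ t i j, ∀ p : JointSpace d (m i), p.snd ∈ Y i →
    Integrable (fun ω => ‖h i p (ξ t i j ω) - f' i p‖ ^ 2) P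
  variance_le : ∀ t i j, ∀ p : JointSpace d (m i), p.snd ∈ Y i →
    ∫ ω, ‖h i p (ξ t i j ω) - f' i p‖ ^ 2 ∂P ≤ σ ^ 2

/-- The mini-batch stochastic gradient `(1/b) ∑ⱼ h(x, y, ξⱼ)`. -/
noncomputable def miniBatch {d m b : ℕ} {X : Type*} (h : JointSpace d m → X → JointSpace d m)
    (p : JointSpace d m) (s : Fin b → X) : JointSpace d m :=
  (1 / (b : ℝ)) • ∑ j, h p (s j)

/-- The Euclidean projection of `u` onto `Y`: the point of `Y` nearest to `u` (it exists and is
unique for nonempty closed convex `Y`). -/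
noncomputable def proj {m : ℕ} (Y : Set (EuclideanSpace ℝ (Fin m)))
    (u : EuclideanSpace ℝ (Fin m)) : EuclideanSpace ℝ (Fin m) :=
  Classical.epsilon fun v => v ∈ Y ∧ ∀ w ∈ Y, ‖u - v‖ ≤ ‖u - w‖

/-- The iterates of all agents at one iteration. -/
structure AgentState (n d : ℕ) (m : Fin n → ℕ) where
  x : Fin n → EuclideanSpace ℝ (Fin d)
  y : ∀ i, EuclideanSpace ℝ (Fin (m i))
  g : Fin n → EuclideanSpace ℝ (Fin d)

/-- The point `(xᵢ, yᵢ)` of agent `i`. -/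
def AgentState.point {n d : ℕ} {m : Fin n → ℕ} (S : AgentState n d m) (i : Fin n) :
    JointSpace d (m i) :=
  joint (S.x i) (S.y i)

/-- One iteration of DSGTA; `s` is the batch of samples drawn at the current iterate and `s'` the
batch drawn at the next one. -/
noncomputable def dsgtaStep {n d b : ℕ} {m : Fin n → ℕ} {Ξ : Fin n → Type*}
    (W : Matrix (Fin n) (Fin n) ℝ) (ηx ηy : ℝ) (Y : ∀ i, Set (EuclideanSpace ℝ (Fin (m i))))
    (h : ∀ i, JointSpace d (m i) → Ξ i → JointSpace d (m i))
    (s s' : ∀ i, Fin b → Ξ i) (S : AgentState n d m) : AgentState n d m :=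
  let x' : Fin n → EuclideanSpace ℝ (Fin d) := fun i => ∑ j, W i j • (S.x j - ηx • S.g j)
  let y' : ∀ i, EuclideanSpace ℝ (Fin (m i)) := fun i =>
    proj (Y i) (S.y i + ηy • (miniBatch (h i) (S.point i) (s i)).snd)
  { x := x'
    y := y'
    g := fun i => ∑ j, W i j • (S.g j + (miniBatch (h j) (joint (x' j) (y' j)) (s' j)).fst
      - (miniBatch (h j) (S.point j) (s j)).fst) }

/-- The DSGTA iterates along one realization `s` of the samples (`s t i j` is sample `j` of agent
`i` at iteration `t`), started at `(x0, y0)`. -/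
noncomputable def dsgta {n d b : ℕ} {m : Fin n → ℕ} {Ξ : Fin n → Type*}
    (W : Matrix (Fin n) (Fin n) ℝ) (ηx ηy : ℝ) (Y : ∀ i, Set (EuclideanSpace ℝ (Fin (m i))))
    (h : ∀ i, JointSpace d (m i) → Ξ i → JointSpace d (m i))
    (x0 : Fin n → EuclideanSpace ℝ (Fin d)) (y0 : ∀ i, EuclideanSpace ℝ (Fin (m i)))
    (s : ℕ → ∀ i, Fin b → Ξ i) : ℕ → AgentState n d m
  | 0 =>
    { x := x0
      y := y0
      g := fun i => (miniBatch (h i) (joint (x0 i) (y0 i)) (s 0 i)).fst }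
  | t + 1 => dsgtaStep W ηx ηy Y h (s t) (s (t + 1)) (dsgta W ηx ηy Y h x0 y0 s t)

/-! Strong concavity makes each maximizer $y_i^*(x)$ unique and $\kappa$-Lipschitz in $x$, so by
Danskin's argument $\Phi$ is differentiable with
$\nabla\Phi(x)=\frac1n\sum_i\nabla_xf_i(x,y_i^*(x))$ and a quadratic Taylor remainder
(`abs_primal_sub_le`). Since $W$ preserves averages, $\bar x$ moves exactly by $-\eta_x\bar g$,
where $\bar g$ is the average of the local stochastic gradients. The method is thus inexact gradient
descent on $\Phi$. The direction is spoiled by the disagreement of the $x_i$, by the distance of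
$y_i$ from $y_i^*(\bar x)$, and by noise; the disagreement of the trackers $g_i$ in turn feeds that
of the $x_i$.

Each of these errors contracts up to contributions of the others: the two disagreements by the
spectral gap $\rho=1-\lambda^2$ (`meanSq_deviation_mix_add_le`, `meanSq_deviation_tracker_le`), and
the response error by projected ascent on a strongly concave function
(`norm_ascent_sub_bestResponse_sq_le`). A weighted sum of $\Phi(\bar x)$ and the three squared
errors is a Lyapunov function. Its weights let the contraction of each error pay for what that error
injects elsewhere, and what remains is a decrease by $\|\nabla\Phi(\bar x)\|^2$ (`lyapunov_descent`,
`lyapunov_step`). This part holds for every realization of the samples.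

Terms linear in the noise are never estimated. They are kept as inner products with vectors that
depend on earlier samples only, so their expectations vanish (`integral_inner_eq_zero_of_indep`).
For this reason the tracker enters the Lyapunov function as $r=g-e$, with $e$ the current $x$-noise:
then $r'=W(r+\Delta)+(W-I)e'$, with $\Delta$ the increment of the exact gradients, and the old noise
cancels. Quadratic noise terms cost $\sigma^2/b$, or $\sigma^2/(nb)$ after averaging over the
agents, by orthogonality of the individual samples. Taking expectations and telescoping gives the
bound (`integral_lyapunov_step`, `average_bound_le`). -/

set_option linter.unusedSectionVars false

/-! ### The joint space of $x$- and $y$-variables. -/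

section JointSpace

variable {d m : ℕ}

@[simp] lemma joint_fst (x : EuclideanSpace ℝ (Fin d)) (y : EuclideanSpace ℝ (Fin m)) :
    (joint x y).fst = x := rfl

@[simp] lemma joint_snd (x : EuclideanSpace ℝ (Fin d)) (y : EuclideanSpace ℝ (Fin m)) :
    (joint x y).snd = y := rfl

lemma joint_sub (x x' : EuclideanSpace ℝ (Fin d)) (y y' : EuclideanSpace ℝ (Fin m)) :
    joint x y - joint x' y' = joint (x - x') (y - y') := rfl

lemma inner_joint (p : JointSpace d m) (x : EuclideanSpace ℝ (Fin d))
    (y : EuclideanSpace ℝ (Fin m)) :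
    inner ℝ p (joint x y) = inner ℝ p.fst x + inner ℝ p.snd y := by
  simp [WithLp.prod_inner_apply, joint]

lemma norm_joint_zero_right (x : EuclideanSpace ℝ (Fin d)) :
    ‖joint x (0 : EuclideanSpace ℝ (Fin m))‖ = ‖x‖ := WithLp.norm_toLp_fst 2 _ _ x

lemma norm_joint_zero_left (y : EuclideanSpace ℝ (Fin m)) :
    ‖joint (0 : EuclideanSpace ℝ (Fin d)) y‖ = ‖y‖ := WithLp.norm_toLp_snd 2 _ _ y

lemma norm_fst_le_norm (p : JointSpace d m) : ‖p.fst‖ ≤ ‖p‖ := WithLp.norm_fst_le _ p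

lemma norm_snd_le_norm (p : JointSpace d m) : ‖p.snd‖ ≤ ‖p‖ := WithLp.norm_snd_le _ p

lemma continuous_joint :
    Continuous fun q : EuclideanSpace ℝ (Fin d) × EuclideanSpace ℝ (Fin m) => joint q.1 q.2 :=
  WithLp.prod_continuous_toLp 2 _ _

end JointSpace

/-! ### Euclidean projection onto a compact convex set. -/

section Projection

variable {m : ℕ} {Y : Set (EuclideanSpace ℝ (Fin m))}

lemma proj_spec (hne : Y.Nonempty) (hc : IsCompact Y) (u : EuclideanSpace ℝ (Fin m)) :
    proj Y u ∈ Y ∧ ∀ w ∈ Y, ‖u - proj Y u‖ ≤ ‖u - w‖ := by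
  have h : ∃ v, v ∈ Y ∧ ∀ w ∈ Y, ‖u - v‖ ≤ ‖u - w‖ := by
    obtain ⟨v, hv, hmin⟩ := hc.exists_isMinOn hne
      (f := fun v => ‖u - v‖) (by fun_prop)
    exact ⟨v, hv, fun w hw => hmin hw⟩
  exact Classical.epsilon_spec h

lemma inner_sub_proj_le_zero (hne : Y.Nonempty) (hc : IsCompact Y) (hconv : Convex ℝ Y)
    (u w : EuclideanSpace ℝ (Fin m)) (hw : w ∈ Y) :
    inner ℝ (u - proj Y u) (w - proj Y u) ≤ 0 := by
  obtain ⟨hp, hmin⟩ := proj_spec hne hc u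
  have : Nonempty Y := hne.to_subtype
  refine (norm_eq_iInf_iff_real_inner_le_zero hconv hp).1 ?_ w hw
  refine le_antisymm (le_ciInf fun w => hmin w w.2) ?_
  exact ciInf_le (f := fun w : Y => ‖u - w‖) ⟨0, by rintro _ ⟨w, rfl⟩; positivity⟩ ⟨_, hp⟩

/-- Adding the variational inequalities of the two projections gives firm nonexpansiveness. It
serves to transfer measurability and square integrability through the projection step. -/
lemma norm_proj_sub_proj_le (hne : Y.Nonempty) (hc : IsCompact Y) (hconv : Convex ℝ Y)
    (u v : EuclideanSpace ℝ (Fin m)) : ‖proj Y u - proj Y v‖ ≤ ‖u - v‖ := by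
  have h1 := inner_sub_proj_le_zero hne hc hconv u _ (proj_spec hne hc v).1
  have h2 := inner_sub_proj_le_zero hne hc hconv v _ (proj_spec hne hc u).1
  set a := proj Y u
  set c := proj Y v
  have h3 : ‖a - c‖ ^ 2 ≤ inner ℝ (u - v) (a - c) := by
    have e1 : inner ℝ (u - a) (c - a) + inner ℝ (v - c) (a - c)
        = ‖a - c‖ ^ 2 - inner ℝ (u - v) (a - c) := by
      rw [← real_inner_self_eq_norm_sq]
      simp only [inner_sub_left, inner_sub_right]
      rw [real_inner_comm a c]
      ring
    linarith
  have h4 := real_inner_le_norm (u - v) (a - c)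
  by_contra hcon
  push Not at hcon
  nlinarith [norm_nonneg (u - v), norm_nonneg (a - c)]

end Projection

/-! ### Consequences of smoothness and strong concavity. -/

namespace SmoothStronglyConcave

variable {d m : ℕ} {L μ : ℝ} {Y : Set (EuclideanSpace ℝ (Fin m))}
  {f : JointSpace d m → ℝ} {f' : JointSpace d m → JointSpace d m}

/-- Mean value inequality on the segment from `p` to `q`, which stays in $\mathbb R^d\times Y$ by
convexity. Bounding the gradient variation by its value at the far end loses the usual factor $1/2$;
the step sizes leave room for this. -/
lemma abs_sub_sub_inner_le (hf : SmoothStronglyConcave L μ Y f f') (hY : Convex ℝ Y)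
    (hL : 0 ≤ L) {p q : JointSpace d m} (hp : p.snd ∈ Y) (hq : q.snd ∈ Y) :
    |f q - f p - inner ℝ (f' p) (q - p)| ≤
      L * (‖q.fst - p.fst‖ + ‖q.snd - p.snd‖) * ‖q - p‖ := by
  have hseg : ∀ z ∈ segment ℝ p q, z.snd ∈ Y ∧ ‖z.fst - p.fst‖ ≤ ‖q.fst - p.fst‖ ∧
      ‖z.snd - p.snd‖ ≤ ‖q.snd - p.snd‖ := by
    intro z hz
    rw [segment_eq_image'] at hz
    obtain ⟨θ, ⟨h0, h1⟩, rfl⟩ := hz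
    refine ⟨?_, ?_, ?_⟩
    · have := hY.add_smul_sub_mem hp hq ⟨h0, h1⟩
      simpa using this
    · simpa [norm_smul, abs_of_nonneg h0] using mul_le_of_le_one_left (norm_nonneg _) h1
    · simpa [norm_smul, abs_of_nonneg h0] using mul_le_of_le_one_left (norm_nonneg _) h1
  have h := Convex.norm_image_sub_le_of_norm_hasFDerivWithin_le' (𝕜 := ℝ)
    (f := f) (f' := fun z => InnerProductSpace.toDual ℝ _ (f' z))
    (φ := InnerProductSpace.toDual ℝ _ (f' p))
    (C := L * (‖q.fst - p.fst‖ + ‖q.snd - p.snd‖)) (s := segment ℝ p q) (x := p) (y := q)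
    (fun z hz => ((hf.hasGradient z (hseg z hz).1).hasFDerivWithinAt).mono
      fun w hw => (hseg w hw).1)
    (fun z hz => by
      obtain ⟨hzY, h1, h2⟩ := hseg z hz
      rw [← map_sub, LinearIsometryEquiv.norm_map]
      refine (hf.smooth z p hzY hp).trans ?_
      gcongr)
    (convex_segment p q) (left_mem_segment ℝ p q) (right_mem_segment ℝ p q)
  simpa [Real.norm_eq_abs] using h

lemma abs_sub_sub_inner_fst_le (hf : SmoothStronglyConcave L μ Y f f') (hY : Convex ℝ Y)
    (hL : 0 ≤ L) {x x' : EuclideanSpace ℝ (Fin d)} {y : EuclideanSpace ℝ (Fin m)} (hy : y ∈ Y) :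
    |f (joint x' y) - f (joint x y) - inner ℝ (f' (joint x y)).fst (x' - x)| ≤
      L * ‖x' - x‖ ^ 2 := by
  have h := hf.abs_sub_sub_inner_le hY hL (p := joint x y) (q := joint x' y) hy hy
  rw [joint_sub, inner_joint] at h
  simp only [joint_fst, joint_snd, sub_self, norm_zero, add_zero, inner_zero_right,
    norm_joint_zero_right] at h
  linarith [h, sq (‖x' - x‖)]

lemma abs_sub_sub_inner_snd_le (hf : SmoothStronglyConcave L μ Y f f') (hY : Convex ℝ Y)
    (hL : 0 ≤ L) {x : EuclideanSpace ℝ (Fin d)} {y y' : EuclideanSpace ℝ (Fin m)} (hy : y ∈ Y)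
    (hy' : y' ∈ Y) :
    |f (joint x y') - f (joint x y) - inner ℝ (f' (joint x y)).snd (y' - y)| ≤
      L * ‖y' - y‖ ^ 2 := by
  have h := hf.abs_sub_sub_inner_le hY hL (p := joint x y) (q := joint x y') hy hy'
  rw [joint_sub, inner_joint] at h
  simp only [joint_fst, joint_snd, sub_self, norm_zero, zero_add, inner_zero_right,
    norm_joint_zero_left] at h
  linarith [h, sq (‖y' - y‖)]

/-- Add the strong concavity inequality to its copy with `y` and `y'` exchanged; the function values
cancel. -/
lemma monotone_grad (hf : SmoothStronglyConcave L μ Y f f') (x : EuclideanSpace ℝ (Fin d))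
    {y y' : EuclideanSpace ℝ (Fin m)} (hy : y ∈ Y) (hy' : y' ∈ Y) :
    μ * ‖y - y'‖ ^ 2 ≤
      inner ℝ ((f' (joint x y')).snd - (f' (joint x y)).snd) (y - y') := by
  have h1 := hf.strongly_concave x y hy y' hy'
  have h2 := hf.strongly_concave x y' hy' y hy
  rw [norm_sub_rev y' y, ← neg_sub y y', inner_neg_right] at h2
  rw [inner_sub_left]
  linarith

lemma norm_grad_snd_sub_le (hf : SmoothStronglyConcave L μ Y f f')
    {x x' : EuclideanSpace ℝ (Fin d)} {y y' : EuclideanSpace ℝ (Fin m)} (hy : y ∈ Y)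
    (hy' : y' ∈ Y) :
    ‖(f' (joint x y)).snd - (f' (joint x' y')).snd‖ ≤ L * (‖x - x'‖ + ‖y - y'‖) :=
  (norm_snd_le_norm (f' (joint x y) - f' (joint x' y'))).trans
    (hf.smooth (joint x y) (joint x' y') hy hy')

lemma norm_grad_fst_sub_le (hf : SmoothStronglyConcave L μ Y f f')
    {x x' : EuclideanSpace ℝ (Fin d)} {y y' : EuclideanSpace ℝ (Fin m)} (hy : y ∈ Y)
    (hy' : y' ∈ Y) :
    ‖(f' (joint x y)).fst - (f' (joint x' y')).fst‖ ≤ L * (‖x - x'‖ + ‖y - y'‖) :=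
  (norm_fst_le_norm (f' (joint x y) - f' (joint x' y'))).trans
    (hf.smooth (joint x y) (joint x' y') hy hy')

/-- Compares strong monotonicity with the Lipschitz bound at two distinct points. This is the source
of $\kappa\ge1$; on a singleton, strong concavity would put no restriction on $\mu$. -/
lemma le_of_nontrivial (hf : SmoothStronglyConcave L μ Y f f') (hY : Y.Nontrivial) : μ ≤ L := by
  obtain ⟨y, hy, y', hy', hne⟩ := hY
  have h1 := hf.monotone_grad 0 hy hy'
  have h2 := real_inner_le_norm ((f' (joint 0 y')).snd - (f' (joint 0 y)).snd) (y - y')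
  have h3 := hf.norm_grad_snd_sub_le (x := 0) (x' := 0) hy' hy
  rw [sub_self, norm_zero, zero_add, norm_sub_rev y' y] at h3
  have h4 : 0 < ‖y - y'‖ := norm_pos_iff.2 (sub_ne_zero.2 hne)
  have h5 : μ * ‖y - y'‖ ^ 2 ≤ L * ‖y - y'‖ ^ 2 := by nlinarith
  exact le_of_mul_le_mul_right h5 (by positivity)

lemma continuous_left (hf : SmoothStronglyConcave L μ Y f f') (x : EuclideanSpace ℝ (Fin d)) :
    ContinuousOn (fun y => f (joint x y)) Y := by
  have h : ContinuousOn f {q | q.snd ∈ Y} := fun p hp => (hf.hasGradient p hp).continuousWithinAt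
  have hj : Continuous fun y : EuclideanSpace ℝ (Fin m) => joint x y :=
    continuous_joint.comp (Continuous.prodMk_right x)
  exact ContinuousOn.comp (g := f) (f := fun y => joint x y) h hj.continuousOn fun y hy => hy

end SmoothStronglyConcave

/-! ### Best responses and their dependence on $x$. -/

/-- A maximizer of `f (x, ·)` over `Y`. -/
noncomputable def bestResponse {d m : ℕ} (Y : Set (EuclideanSpace ℝ (Fin m)))
    (f : JointSpace d m → ℝ) (x : EuclideanSpace ℝ (Fin d)) : EuclideanSpace ℝ (Fin m) :=
  Classical.epsilon fun y => y ∈ Y ∧ ∀ w ∈ Y, f (joint x w) ≤ f (joint x y)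

namespace SmoothStronglyConcave

variable {d m : ℕ} {L μ D : ℝ} {Y : Set (EuclideanSpace ℝ (Fin m))}
  {f : JointSpace d m → ℝ} {f' : JointSpace d m → JointSpace d m}

lemma bestResponse_spec (hf : SmoothStronglyConcave L μ Y f f') (hY : ConstraintAssumption D Y)
    (x : EuclideanSpace ℝ (Fin d)) :
    bestResponse Y f x ∈ Y ∧ ∀ w ∈ Y, f (joint x w) ≤ f (joint x (bestResponse Y f x)) := by
  have h : ∃ y, y ∈ Y ∧ ∀ w ∈ Y, f (joint x w) ≤ f (joint x y) := by
    obtain ⟨v, hv, hmax⟩ := hY.compact.exists_isMaxOn hY.nonempty (hf.continuous_left x)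
    exact ⟨v, hv, fun w hw => hmax hw⟩
  exact Classical.epsilon_spec h

lemma bestResponse_mem (hf : SmoothStronglyConcave L μ Y f f') (hY : ConstraintAssumption D Y)
    (x : EuclideanSpace ℝ (Fin d)) : bestResponse Y f x ∈ Y := (hf.bestResponse_spec hY x).1

lemma sSup_image_eq (hf : SmoothStronglyConcave L μ Y f f') (hY : ConstraintAssumption D Y)
    (x : EuclideanSpace ℝ (Fin d)) :
    sSup ((fun y => f (joint x y)) '' Y) = f (joint x (bestResponse Y f x)) := by
  obtain ⟨h1, h2⟩ := hf.bestResponse_spec hY x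
  refine IsGreatest.csSup_eq ⟨⟨_, h1, rfl⟩, ?_⟩
  rintro _ ⟨w, hw, rfl⟩
  exact h2 w hw

/-- First-order optimality at a maximizer that may lie on the boundary of `Y`. The gradient exists
only within $\mathbb R^d\times Y$, so the maximum is tested along the segment towards `w`. -/
lemma inner_grad_bestResponse_le (hf : SmoothStronglyConcave L μ Y f f')
    (hY : ConstraintAssumption D Y) (x : EuclideanSpace ℝ (Fin d))
    {w : EuclideanSpace ℝ (Fin m)} (hw : w ∈ Y) :
    inner ℝ (f' (joint x (bestResponse Y f x))).snd (w - bestResponse Y f x) ≤ 0 := by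
  obtain ⟨h1, h2⟩ := hf.bestResponse_spec hY x
  set y := bestResponse Y f x
  let s : Set (JointSpace d m) := segment ℝ (joint x y) (joint x w)
  have hs : ∀ z ∈ s, z.snd ∈ Y ∧ z = joint x z.snd := by
    intro z hz
    rw [show s = _ from segment_eq_image' ℝ (joint x y) (joint x w)] at hz
    obtain ⟨θ, hθ, rfl⟩ := hz
    refine ⟨hY.convex.add_smul_sub_mem h1 hw hθ, ?_⟩
    rw [joint_sub, sub_self]
    refine WithLp.ofLp_injective 2 (Prod.ext ?_ rfl)
    simp [joint]
  have hmax : IsLocalMaxOn f s (joint x y) := by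
    refine (show IsMaxOn f s (joint x y) from fun z hz => ?_).localize
    obtain ⟨hz1, hz2⟩ := hs z hz
    simp only [Set.mem_ofPred_eq]
    rw [hz2]
    exact h2 _ hz1
  have h := hmax.hasFDerivWithinAt_nonpos
    (((hf.hasGradient (joint x y) h1).hasFDerivWithinAt).mono fun w hw => (hs w hw).1)
    (sub_mem_posTangentConeAt_of_segment_subset (Set.Subset.refl s))
  rw [joint_sub, InnerProductSpace.toDual_apply_apply, inner_joint] at h
  simpa using h

/-- Strong monotonicity at `x'` combined with both optimality conditions leaves
$\mu\|y-y'\|^2\le\langle\nabla_yf(x,y)-\nabla_yf(x',y),y-y'\rangle$, and the gradient difference is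
at most $L\|x-x'\|$. -/
lemma norm_bestResponse_sub_le (hf : SmoothStronglyConcave L μ Y f f')
    (hY : ConstraintAssumption D Y) (hμ : 0 < μ) (hL : 0 ≤ L) (x x' : EuclideanSpace ℝ (Fin d)) :
    ‖bestResponse Y f x - bestResponse Y f x'‖ ≤ L / μ * ‖x - x'‖ := by
  have m1 := hf.bestResponse_mem hY x
  have m2 := hf.bestResponse_mem hY x'
  have o1 := hf.inner_grad_bestResponse_le hY x m2
  have o2 := hf.inner_grad_bestResponse_le hY x' m1
  set y := bestResponse Y f x
  set y' := bestResponse Y f x'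
  have h1 := hf.monotone_grad x' m1 m2
  have h2 := real_inner_le_norm ((f' (joint x y)).snd - (f' (joint x' y)).snd) (y - y')
  have h3 := hf.norm_grad_snd_sub_le (x := x) (x' := x') m1 m1
  rw [sub_self, norm_zero, add_zero] at h3
  rw [← neg_sub y y', inner_neg_right] at o1
  rw [inner_sub_left] at h1 h2
  have h4 : μ * ‖y - y'‖ ^ 2 ≤ L * ‖x - x'‖ * ‖y - y'‖ :=
    le_trans (by linarith) (mul_le_mul_of_nonneg_right h3 (norm_nonneg _))
  rcases (norm_nonneg (y - y')).eq_or_lt with h0 | h0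
  · rw [← h0]; positivity
  · rw [div_mul_eq_mul_div, le_div_iff₀ hμ]
    have : (μ * ‖y - y'‖) * ‖y - y'‖ ≤ (L * ‖x - x'‖) * ‖y - y'‖ := by linarith [h4, sq ‖y - y'‖]
    linarith [le_of_mul_le_mul_right this h0]

/-- Danskin's sandwich: replacing $y'$ by $y$ at $x'$ bounds the increment from below, replacing $y$
by $y'$ at $x$ bounds it from above. The upper bound carries the gradient at $(x,y')$, and moving it
to $(x,y)$ costs the Lipschitz constant $L/\mu$ of the maximizer. -/
lemma abs_value_sub_le (hf : SmoothStronglyConcave L μ Y f f')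
    (hY : ConstraintAssumption D Y) (hμ : 0 < μ) (hL : 0 ≤ L) (x x' : EuclideanSpace ℝ (Fin d)) :
    |f (joint x' (bestResponse Y f x')) - f (joint x (bestResponse Y f x)) -
      inner ℝ (f' (joint x (bestResponse Y f x))).fst (x' - x)| ≤
      (L + L * (L / μ)) * ‖x' - x‖ ^ 2 := by
  obtain ⟨m1, b1⟩ := hf.bestResponse_spec hY x
  obtain ⟨m2, b2⟩ := hf.bestResponse_spec hY x'
  have hlip := hf.norm_bestResponse_sub_le hY hμ hL x' x
  set y := bestResponse Y f x
  set y' := bestResponse Y f x'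
  have h1 := abs_le.1 (hf.abs_sub_sub_inner_fst_le hY.convex hL (x := x) (x' := x') m1)
  have h2 := abs_le.1 (hf.abs_sub_sub_inner_fst_le hY.convex hL (x := x) (x' := x') m2)
  have h3 := hf.norm_grad_fst_sub_le (x := x) (x' := x) m2 m1
  rw [sub_self, norm_zero, zero_add] at h3
  have h4 := real_inner_le_norm ((f' (joint x y')).fst - (f' (joint x y)).fst) (x' - x)
  have h5 : ‖(f' (joint x y')).fst - (f' (joint x y)).fst‖ * ‖x' - x‖ ≤
      L * (L / μ) * ‖x' - x‖ ^ 2 := by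
    calc _ ≤ (L * (L / μ * ‖x' - x‖)) * ‖x' - x‖ := by gcongr; exact h3.trans (by gcongr)
      _ = _ := by ring
  rw [inner_sub_left] at h4
  have b1' := b1 y' m2
  have b2' := b2 y m1
  have : 0 ≤ L * (L / μ) * ‖x' - x‖ ^ 2 := by positivity
  rw [abs_le]
  constructor <;> linarith

end SmoothStronglyConcave

/-! ### Differentiability of the primal function. -/

/-- The gradient of the primal function, by Danskin's theorem. -/
noncomputable def primalGrad {n d : ℕ} {m : Fin n → ℕ}
    (Y : ∀ i, Set (EuclideanSpace ℝ (Fin (m i)))) (f : ∀ i, JointSpace d (m i) → ℝ)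
    (f' : ∀ i, JointSpace d (m i) → JointSpace d (m i)) (x : EuclideanSpace ℝ (Fin d)) :
    EuclideanSpace ℝ (Fin d) :=
  agentAvg fun i => (f' i (joint x (bestResponse (Y i) (f i) x))).fst

section Primal

variable {n d : ℕ} {m : Fin n → ℕ} {L μ D : ℝ} {Y : ∀ i, Set (EuclideanSpace ℝ (Fin (m i)))}
  {f : ∀ i, JointSpace d (m i) → ℝ} {f' : ∀ i, JointSpace d (m i) → JointSpace d (m i)}

lemma abs_primal_sub_le (hn : 0 < n) (hf : ∀ i, SmoothStronglyConcave L μ (Y i) (f i) (f' i))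
    (hY : ∀ i, ConstraintAssumption D (Y i)) (hμ : 0 < μ) (hL : 0 ≤ L)
    (x x' : EuclideanSpace ℝ (Fin d)) :
    |primal Y f x' - primal Y f x - inner ℝ (primalGrad Y f f' x) (x' - x)| ≤
      (L + L * (L / μ)) * ‖x' - x‖ ^ 2 := by
  have hn' : (0 : ℝ) < n := by exact_mod_cast hn
  have e : primal Y f x' - primal Y f x - inner ℝ (primalGrad Y f f' x) (x' - x) =
      (1 / (n : ℝ)) * ∑ i, (f i (joint x' (bestResponse (Y i) (f i) x'))
        - f i (joint x (bestResponse (Y i) (f i) x)) -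
        inner ℝ (f' i (joint x (bestResponse (Y i) (f i) x))).fst (x' - x)) := by
    simp only [primal, primalGrad, agentAvg, (hf _).sSup_image_eq (hY _), inner_smul_left,
      sum_inner, Finset.sum_sub_distrib]
    simp
    ring
  rw [e, abs_mul, abs_of_pos (by positivity : (0 : ℝ) < 1 / n), one_div, inv_mul_le_iff₀ hn']
  refine (Finset.abs_sum_le_sum_abs _ _).trans ?_
  refine (Finset.sum_le_sum fun i _ => (hf i).abs_value_sub_le (hY i) hμ hL x x').trans ?_
  simp

lemma hasGradientAt_primal (hn : 0 < n)
    (hf : ∀ i, SmoothStronglyConcave L μ (Y i) (f i) (f' i))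
    (hY : ∀ i, ConstraintAssumption D (Y i)) (hμ : 0 < μ) (hL : 0 ≤ L)
    (x : EuclideanSpace ℝ (Fin d)) :
    HasGradientAt (primal Y f) (primalGrad Y f f' x) x := by
  rw [hasGradientAt_iff_isLittleO]
  refine Asymptotics.IsBigO.trans_isLittleO (g := fun x' => ‖x' - x‖ ^ 2) ?_ ?_
  · refine Asymptotics.IsBigO.of_bound (L + L * (L / μ)) (Filter.Eventually.of_forall fun x' => ?_)
    simpa using abs_primal_sub_le hn hf hY hμ hL x x'
  · have h : Filter.Tendsto (fun x' => x' - x) (nhds x) (nhds 0) :=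
      Continuous.tendsto' (by fun_prop) _ _ (sub_self x)
    have := (Asymptotics.isLittleO_norm_pow_id (E' := EuclideanSpace ℝ (Fin d)) one_lt_two)
    exact this.comp_tendsto h

/-- Needed for measurability and square integrability of $\nabla\Phi(\bar x^t)$; the descent itself
rests on `abs_primal_sub_le`. -/
lemma norm_primalGrad_sub_le (hn : 0 < n)
    (hf : ∀ i, SmoothStronglyConcave L μ (Y i) (f i) (f' i))
    (hY : ∀ i, ConstraintAssumption D (Y i)) (hμ : 0 < μ) (hL : 0 ≤ L)
    (x x' : EuclideanSpace ℝ (Fin d)) :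
    ‖primalGrad Y f f' x - primalGrad Y f f' x'‖ ≤ (L + L * (L / μ)) * ‖x - x'‖ := by
  have hn' : (0 : ℝ) < n := by exact_mod_cast hn
  rw [primalGrad, primalGrad, agentAvg, agentAvg, ← smul_sub, ← Finset.sum_sub_distrib, norm_smul,
    Real.norm_eq_abs, abs_of_pos (by positivity : (0 : ℝ) < 1 / n), one_div, inv_mul_le_iff₀ hn']
  refine (norm_sum_le _ _).trans ?_
  refine (Finset.sum_le_sum fun i _ => ((hf i).norm_grad_fst_sub_le
    ((hf i).bestResponse_mem (hY i) x) ((hf i).bestResponse_mem (hY i) x')).trans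
      (mul_le_mul_of_nonneg_left (add_le_add_right
        ((hf i).norm_bestResponse_sub_le (hY i) hμ hL x x') _) hL)).trans ?_
  rw [Finset.sum_const, Finset.card_univ, Fintype.card_fin, nsmul_eq_mul]
  apply le_of_eq
  ring

end Primal

/-! ### Averages, deviations and mean squares over the agents. -/

/-- The average of the squared norms of the agents' vectors. -/
noncomputable def meanSq {n : ℕ} {E : Fin n → Type*} [∀ i, NormedAddCommGroup (E i)]
    (v : ∀ i, E i) : ℝ :=
  (1 / (n : ℝ)) * ∑ i, ‖v i‖ ^ 2

/-- The deviations of the agents' vectors from their average. -/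
noncomputable def deviation {n d : ℕ} (v : Fin n → EuclideanSpace ℝ (Fin d)) :
    Fin n → EuclideanSpace ℝ (Fin d) :=
  fun i => v i - agentAvg v

/-- One round of averaging with the neighbours. -/
noncomputable def mix {n d : ℕ} (W : Matrix (Fin n) (Fin n) ℝ)
    (v : Fin n → EuclideanSpace ℝ (Fin d)) : Fin n → EuclideanSpace ℝ (Fin d) :=
  fun i => ∑ j, W i j • v j

/-- The average of the inner products of two families of agents' vectors. -/
noncomputable def meanInner {n : ℕ} {E : Fin n → Type*} [∀ i, NormedAddCommGroup (E i)]
    [∀ i, InnerProductSpace ℝ (E i)] (u v : ∀ i, E i) : ℝ :=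
  (1 / (n : ℝ)) * ∑ i, inner ℝ (u i) (v i)

section MeanSq

variable {n : ℕ} {E : Fin n → Type*} [∀ i, NormedAddCommGroup (E i)]

lemma meanSq_nonneg (v : ∀ i, E i) : 0 ≤ meanSq v := by unfold meanSq; positivity

lemma meanSq_le_of_le {u : ∀ i, E i} {F : Fin n → Type*} [∀ i, NormedAddCommGroup (F i)]
    {v : ∀ i, F i} (h : ∀ i, ‖u i‖ ^ 2 ≤ ‖v i‖ ^ 2) : meanSq u ≤ meanSq v := by
  unfold meanSq
  exact mul_le_mul_of_nonneg_left (Finset.sum_le_sum fun i _ => h i) (by positivity)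

lemma norm_sub_sq_le {F : Type*} [SeminormedAddCommGroup F] (u v : F) :
    ‖u - v‖ ^ 2 ≤ 2 * ‖u‖ ^ 2 + 2 * ‖v‖ ^ 2 := by
  have h := norm_sub_le u v
  nlinarith [norm_nonneg (u - v), sq_nonneg (‖u‖ - ‖v‖), norm_nonneg u, norm_nonneg v]

lemma norm_add_sq_le {F : Type*} [SeminormedAddCommGroup F] (u v : F) :
    ‖u + v‖ ^ 2 ≤ 2 * ‖u‖ ^ 2 + 2 * ‖v‖ ^ 2 := by
  simpa using norm_sub_sq_le u (-v)

lemma meanSq_sub_le (u v : ∀ i, E i) : meanSq (u - v) ≤ 2 * meanSq u + 2 * meanSq v := by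
  unfold meanSq
  rw [mul_left_comm, mul_left_comm 2, ← mul_add]
  gcongr
  rw [Finset.mul_sum, Finset.mul_sum, ← Finset.sum_add_distrib]
  exact Finset.sum_le_sum fun i _ => norm_sub_sq_le _ _

lemma meanSq_add_le (u v : ∀ i, E i) : meanSq (u + v) ≤ 2 * meanSq u + 2 * meanSq v := by
  have h := meanSq_sub_le u (-v)
  have e : meanSq (-v) = meanSq v := by simp [meanSq]
  rwa [sub_neg_eq_add, e] at h

lemma meanSq_smul [∀ i, NormedSpace ℝ (E i)] (c : ℝ) (v : ∀ i, E i) :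
    meanSq (c • v) = c ^ 2 * meanSq v := by
  simp only [meanSq, Pi.smul_apply, norm_smul, mul_pow, Real.norm_eq_abs, sq_abs,
    ← Finset.mul_sum]
  ring

variable [∀ i, InnerProductSpace ℝ (E i)]

lemma meanSq_add (u v : ∀ i, E i) :
    meanSq (u + v) = meanSq u + 2 * meanInner u v + meanSq v := by
  simp only [meanSq, meanInner, Pi.add_apply, norm_add_sq_real, Finset.sum_add_distrib,
    ← Finset.mul_sum]
  ring

lemma two_mul_meanInner_le {c : ℝ} (hc : 0 < c) (u v : ∀ i, E i) :
    2 * meanInner u v ≤ c * meanSq u + 1 / c * meanSq v := by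
  unfold meanSq meanInner
  rw [mul_left_comm, mul_left_comm c, mul_left_comm (1 / c), ← mul_add]
  gcongr
  rw [Finset.mul_sum, Finset.mul_sum, Finset.mul_sum, ← Finset.sum_add_distrib]
  refine Finset.sum_le_sum fun i _ => ?_
  have h1 := real_inner_le_norm (u i) (v i)
  have h2 : 0 ≤ c * (‖u i‖ - 1 / c * ‖v i‖) ^ 2 := by positivity
  have h3 : c * (‖u i‖ - 1 / c * ‖v i‖) ^ 2 =
      c * ‖u i‖ ^ 2 + 1 / c * ‖v i‖ ^ 2 - 2 * (‖u i‖ * ‖v i‖) := by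
    field_simp
    ring
  linarith

lemma meanSq_add_le_of_pos {c : ℝ} (hc : 0 < c) (u v : ∀ i, E i) :
    meanSq (u + v) ≤ (1 + c) * meanSq u + (1 + 1 / c) * meanSq v := by
  have := two_mul_meanInner_le hc u v
  rw [meanSq_add]
  linarith

end MeanSq

section Average

variable {n d : ℕ}

lemma agentAvg_add (u v : Fin n → EuclideanSpace ℝ (Fin d)) :
    agentAvg (u + v) = agentAvg u + agentAvg v := by
  simp [agentAvg, Finset.sum_add_distrib, smul_add]

lemma agentAvg_sub (u v : Fin n → EuclideanSpace ℝ (Fin d)) :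
    agentAvg (u - v) = agentAvg u - agentAvg v := by
  simp [agentAvg, Finset.sum_sub_distrib, smul_sub]

lemma agentAvg_smul (c : ℝ) (v : Fin n → EuclideanSpace ℝ (Fin d)) :
    agentAvg (c • v) = c • agentAvg v := by
  simp only [agentAvg, Pi.smul_apply, ← Finset.smul_sum, smul_comm c]

lemma agentAvg_const (hn : 0 < n) (c : EuclideanSpace ℝ (Fin d)) :
    agentAvg (fun _ : Fin n => c) = c := by
  have : (n : ℝ) ≠ 0 := by positivity
  rw [agentAvg, Finset.sum_const, Finset.card_univ, Fintype.card_fin, ← Nat.cast_smul_eq_nsmul ℝ,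
    smul_smul, one_div, inv_mul_cancel₀ this, one_smul]

lemma agentAvg_deviation (hn : 0 < n) (v : Fin n → EuclideanSpace ℝ (Fin d)) :
    agentAvg (deviation v) = 0 := by
  have : deviation v = v - fun _ => agentAvg v := rfl
  rw [this, agentAvg_sub, agentAvg_const hn, sub_self]

lemma deviation_add (u v : Fin n → EuclideanSpace ℝ (Fin d)) :
    deviation (u + v) = deviation u + deviation v := by
  ext1 i
  simp only [deviation, agentAvg_add, Pi.add_apply]
  abel

lemma deviation_sub (u v : Fin n → EuclideanSpace ℝ (Fin d)) :
    deviation (u - v) = deviation u - deviation v := by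
  ext1 i
  simp only [deviation, agentAvg_sub, Pi.sub_apply]
  abel

lemma deviation_smul (c : ℝ) (v : Fin n → EuclideanSpace ℝ (Fin d)) :
    deviation (c • v) = c • deviation v := by
  ext1 i
  simp only [deviation, agentAvg_smul, Pi.smul_apply, smul_sub]

lemma meanSq_eq_deviation_add (hn : 0 < n) (v : Fin n → EuclideanSpace ℝ (Fin d)) :
    meanSq v = meanSq (deviation v) + ‖agentAvg v‖ ^ 2 := by
  have hn' : (n : ℝ) ≠ 0 := by positivity
  have e : v = deviation v + fun _ => agentAvg v := by ext1 i; simp [deviation]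
  have e1 : meanInner (deviation v) (fun _ => agentAvg v) = 0 := by
    have : ∀ a, ∑ i, inner ℝ (deviation v i) a = n * inner ℝ (agentAvg (deviation v)) a := by
      intro a
      rw [agentAvg, inner_smul_left, sum_inner]
      simp
      field_simp
    rw [meanInner, this, agentAvg_deviation hn, inner_zero_left, mul_zero, mul_zero]
  have e2 : meanSq (fun _ : Fin n => agentAvg v) = ‖agentAvg v‖ ^ 2 := by
    simp [meanSq]
    field_simp
  conv_lhs => rw [e]
  rw [meanSq_add, e1, e2]
  ring

lemma meanSq_deviation_le (hn : 0 < n) (v : Fin n → EuclideanSpace ℝ (Fin d)) :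
    meanSq (deviation v) ≤ meanSq v := by
  rw [meanSq_eq_deviation_add hn v]
  linarith [sq_nonneg ‖agentAvg v‖]

lemma norm_agentAvg_sq_le (hn : 0 < n) (v : Fin n → EuclideanSpace ℝ (Fin d)) :
    ‖agentAvg v‖ ^ 2 ≤ meanSq v := by
  rw [meanSq_eq_deviation_add hn v]
  linarith [meanSq_nonneg (deviation v)]

end Average

/-! ### The mixing matrix and its contraction of disagreement. -/

section Mix

variable {n d : ℕ} {W : Matrix (Fin n) (Fin n) ℝ} {G : SimpleGraph (Fin n)}

lemma mix_add (u v : Fin n → EuclideanSpace ℝ (Fin d)) :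
    mix W (u + v) = mix W u + mix W v := by
  ext1 i
  simp [mix, Finset.sum_add_distrib, smul_add]

lemma mix_sub (u v : Fin n → EuclideanSpace ℝ (Fin d)) :
    mix W (u - v) = mix W u - mix W v := by
  ext1 i
  simp [mix, Finset.sum_sub_distrib, smul_sub]

lemma NetworkAssumption.apply_comm (hW : NetworkAssumption G W) (i j : Fin n) :
    W i j = W j i := by
  conv_lhs => rw [← hW.symm]
  rfl

lemma NetworkAssumption.col_sum (hW : NetworkAssumption G W) (j : Fin n) : ∑ i, W i j = 1 := by
  simp_rw [fun i => hW.apply_comm i j]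
  exact hW.row_sum j

lemma NetworkAssumption.pos (hW : NetworkAssumption G W) : 0 < n := by
  obtain ⟨i⟩ := hW.connected.nonempty
  exact i.pos

lemma agentAvg_mix (hW : NetworkAssumption G W) (v : Fin n → EuclideanSpace ℝ (Fin d)) :
    agentAvg (mix W v) = agentAvg v := by
  simp only [agentAvg, mix]
  rw [Finset.sum_comm]
  simp_rw [← Finset.sum_smul, hW.col_sum, one_smul]

lemma mix_const (hW : NetworkAssumption G W) (c : EuclideanSpace ℝ (Fin d)) :
    mix W (fun _ => c) = fun _ => c := by
  ext1 i
  simp only [mix, ← Finset.sum_smul, hW.row_sum, one_smul]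

lemma deviation_mix (hW : NetworkAssumption G W) (v : Fin n → EuclideanSpace ℝ (Fin d)) :
    deviation (mix W v) = mix W (deviation v) := by
  have e : deviation v = v - fun _ => agentAvg v := rfl
  rw [e, mix_sub, mix_const hW]
  ext1 i
  simp [deviation, agentAvg_mix hW]

/-- Jensen's inequality in each row, then the columns of $W$ sum to one. -/
lemma meanSq_mix_le (hW : NetworkAssumption G W) (v : Fin n → EuclideanSpace ℝ (Fin d)) :
    meanSq (mix W v) ≤ meanSq v := by
  unfold meanSq
  gcongr 1
  have h : ∀ i, ‖mix W v i‖ ^ 2 ≤ ∑ j, W i j * ‖v j‖ ^ 2 := by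
    intro i
    have h1 : ‖mix W v i‖ ≤ ∑ j, W i j * ‖v j‖ := by
      refine (norm_sum_le _ _).trans (Finset.sum_le_sum fun j _ => ?_)
      rw [norm_smul, Real.norm_eq_abs, abs_of_nonneg (hW.nonneg i j)]
    calc ‖mix W v i‖ ^ 2 ≤ (∑ j, W i j * ‖v j‖) ^ 2 := by gcongr
      _ ≤ ∑ j, W i j * ‖v j‖ ^ 2 :=
        by
        simpa using (convexOn_pow 2).map_sum_le (t := Finset.univ) (w := fun j => W i j)
          (p := fun j => ‖v j‖) (fun j _ => hW.nonneg i j) (hW.row_sum i) (fun j _ => norm_nonneg _)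
  refine (Finset.sum_le_sum fun i _ => h i).trans ?_
  rw [Finset.sum_comm]
  simp_rw [← Finset.sum_mul, hW.col_sum, one_mul]
  exact le_rfl

/-- Deviations sum to zero, so $\mathbf 1\mathbf 1^{\mathrm T}/n$ annihilates them and $W$ acts as
$W-\mathbf 1\mathbf 1^{\mathrm T}/n$. The spectral norm lives on $\mathbb R^n$, hence the argument
runs coordinate by coordinate in $\mathbb R^d$. -/
lemma meanSq_mix_deviation_le (hW : NetworkAssumption G W)
    (v : Fin n → EuclideanSpace ℝ (Fin d)) :
    meanSq (mix W (deviation v)) ≤ mixingNorm W ^ 2 * meanSq (deviation v) := by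
  set u := deviation v with hu
  have hsum : ∀ k, ∑ i, u i k = 0 := by
    intro k
    have hn' : (n : ℝ) ≠ 0 := by have := hW.pos; positivity
    have h := congrArg (fun z : EuclideanSpace ℝ (Fin d) => z k) (agentAvg_deviation hW.pos v)
    simpa [agentAvg, hn', hu] using h
  have hk : ∀ k, ∑ i, (mix W u i k) ^ 2 ≤ mixingNorm W ^ 2 * ∑ i, (u i k) ^ 2 := by
    intro k
    let z : EuclideanSpace ℝ (Fin n) := WithLp.toLp 2 fun i => u i k
    have h := (Matrix.toEuclideanCLM (n := Fin n) (𝕜 := ℝ)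
      (W - Matrix.of fun _ _ => 1 / (n : ℝ))).le_opNorm z
    have h2 := pow_le_pow_left₀ (norm_nonneg _) h 2
    rw [mul_pow, EuclideanSpace.norm_sq_eq, EuclideanSpace.norm_sq_eq] at h2
    simp only [Real.norm_eq_abs, sq_abs] at h2
    have e : ∀ i, (Matrix.toEuclideanCLM (n := Fin n) (𝕜 := ℝ)
        (W - Matrix.of fun _ _ => 1 / (n : ℝ)) z) i = mix W u i k := by
      intro i
      rw [Matrix.ofLp_toEuclideanCLM]
      simp [Matrix.mulVec, dotProduct, mix, z, sub_mul, Finset.sum_sub_distrib, ← Finset.mul_sum,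
        hsum k]
    simp_rw [e] at h2
    exact h2
  unfold meanSq
  rw [mul_left_comm]
  gcongr 1
  simp_rw [EuclideanSpace.norm_sq_eq, Real.norm_eq_abs, sq_abs]
  rw [Finset.sum_comm, Finset.sum_comm (f := fun i k => (u i k) ^ 2), Finset.mul_sum]
  exact Finset.sum_le_sum fun k _ => hk k

end Mix

section Contraction

variable {n d : ℕ} {W : Matrix (Fin n) (Fin n) ℝ} {G : SimpleGraph (Fin n)} {ρ : ℝ}

/-- Young's inequality with weight $\rho/2$ spends half of the spectral gap:
$(1-\rho)(1+\rho/2)\le1-\rho/2$. -/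
lemma meanSq_deviation_mix_add_le (hW : NetworkAssumption G W) (hρ : ρ = 1 - mixingNorm W ^ 2)
    (hρ0 : 0 < ρ) (u v : Fin n → EuclideanSpace ℝ (Fin d)) :
    meanSq (deviation (mix W (u + v))) ≤
      (1 - ρ / 2) * meanSq (deviation u) + 2 / ρ * meanSq (deviation v) := by
  rw [deviation_mix hW]
  have h1 := meanSq_mix_deviation_le hW (u + v)
  have h2 := meanSq_add_le_of_pos (half_pos hρ0) (deviation u) (deviation v)
  rw [← deviation_add] at h2
  have hl : mixingNorm W ^ 2 = 1 - ρ := by rw [hρ]; ring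
  have hl0 : 0 ≤ 1 - ρ := hl ▸ sq_nonneg _
  rw [hl] at h1
  have hU := meanSq_nonneg (deviation u)
  have hV := meanSq_nonneg (deviation v)
  have c1 : (1 - ρ) * (1 + ρ / 2) ≤ 1 - ρ / 2 := by nlinarith
  have c2 : (1 - ρ) * (1 + 1 / (ρ / 2)) ≤ 2 / ρ := by
    have : (1 - ρ) * (1 + 1 / (ρ / 2)) = 2 / ρ - (1 + ρ) := by field_simp; ring
    linarith
  calc _ ≤ (1 - ρ) * ((1 + ρ / 2) * meanSq (deviation u) +
        (1 + 1 / (ρ / 2)) * meanSq (deviation v)) := h1.trans (by gcongr)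
    _ = (1 - ρ) * (1 + ρ / 2) * meanSq (deviation u) +
        (1 - ρ) * (1 + 1 / (ρ / 2)) * meanSq (deviation v) := by ring
    _ ≤ _ := by gcongr

lemma meanSq_deviation_mix_sub_smul_le (hW : NetworkAssumption G W)
    (hρ : ρ = 1 - mixingNorm W ^ 2) (hρ0 : 0 < ρ) (η : ℝ)
    (x g : Fin n → EuclideanSpace ℝ (Fin d)) :
    meanSq (deviation (mix W (x - η • g))) ≤
      (1 - ρ / 2) * meanSq (deviation x) + 2 / ρ * (η ^ 2 * meanSq (deviation g)) := by
  have h := meanSq_deviation_mix_add_le hW hρ hρ0 x ((-η) • g)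
  rwa [deviation_smul, meanSq_smul, neg_sq, neg_smul, ← sub_eq_add_neg] at h

lemma meanInner_mix (hW : NetworkAssumption G W) (u v : Fin n → EuclideanSpace ℝ (Fin d)) :
    meanInner u (mix W v) = meanInner (mix W u) v := by
  simp only [meanInner, mix, inner_sum, sum_inner, inner_smul_left, inner_smul_right]
  rw [Finset.sum_comm]
  simp [fun i j => hW.apply_comm i j]

lemma meanInner_sub_right (u v w : Fin n → EuclideanSpace ℝ (Fin d)) :
    meanInner u (v - w) = meanInner u v - meanInner u w := by
  simp [meanInner, inner_sub_right, Finset.sum_sub_distrib, mul_sub]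

lemma meanInner_sub_left (u v w : Fin n → EuclideanSpace ℝ (Fin d)) :
    meanInner (u - v) w = meanInner u w - meanInner v w := by
  simp [meanInner, inner_sub_left, Finset.sum_sub_distrib, mul_sub]

lemma meanInner_const_left (c : EuclideanSpace ℝ (Fin d))
    (v : Fin n → EuclideanSpace ℝ (Fin d)) :
    meanInner (fun _ => c) v = inner ℝ c (agentAvg v) := by
  simp [meanInner, agentAvg, inner_smul_right, inner_sum]

lemma meanInner_deviation_deviation (hn : 0 < n) (u v : Fin n → EuclideanSpace ℝ (Fin d)) :
    meanInner (deviation u) (deviation v) = meanInner (deviation u) v := by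
  have e : deviation v = v - fun _ => agentAvg v := rfl
  have h : meanInner (deviation u) (fun _ => agentAvg v) = 0 := by
    have := meanInner_const_left (agentAvg v) (deviation u)
    rw [agentAvg_deviation hn, inner_zero_right] at this
    rw [← this]
    simp only [meanInner, real_inner_comm]
  rw [e, meanInner_sub_right, h, sub_zero]

/-- The new noise `e` enters through $(W-I)e$. Its cross term is kept exact, with $W-I$ moved to the
other factor by symmetry, because it averages to zero; Young's inequality here would cost an extra
factor of order $1/\rho$ in the noise. -/
lemma meanSq_deviation_tracker_le (hW : NetworkAssumption G W) (hρ : ρ = 1 - mixingNorm W ^ 2)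
    (hρ0 : 0 < ρ) (r D e : Fin n → EuclideanSpace ℝ (Fin d)) :
    meanSq (deviation (mix W (r + D) + (mix W e - e))) ≤
      (1 - ρ / 2) * meanSq (deviation r) + 2 / ρ * meanSq D +
      2 * meanInner (mix W (deviation (mix W (r + D))) - deviation (mix W (r + D))) e +
      4 * meanSq e := by
  rw [deviation_add, meanSq_add, meanInner_deviation_deviation hW.pos, meanInner_sub_right,
    meanInner_mix hW, ← meanInner_sub_left]
  have h1 := meanSq_deviation_mix_add_le hW hρ hρ0 r D
  have h2 : meanSq (deviation (mix W e - e)) ≤ 4 * meanSq e := by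
    have := meanSq_deviation_le hW.pos (mix W e - e)
    have := meanSq_sub_le (mix W e) e
    have := meanSq_mix_le hW e
    linarith
  have h3 : 2 / ρ * meanSq (deviation D) ≤ 2 / ρ * meanSq D := by
    gcongr
    exact meanSq_deviation_le hW.pos D
  linarith

/-- Orthogonality of deviations and averages keeps coefficient one on the movement of the average,
which is known exactly. -/
lemma meanSq_sub_le_deviation (hn : 0 < n) (x x' : Fin n → EuclideanSpace ℝ (Fin d)) :
    meanSq (x' - x) ≤ 2 * meanSq (deviation x') + 2 * meanSq (deviation x) +
      ‖agentAvg x' - agentAvg x‖ ^ 2 := by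
  rw [meanSq_eq_deviation_add hn, agentAvg_sub, deviation_sub]
  linarith [meanSq_sub_le (deviation x') (deviation x)]

end Contraction

/-! ### Contraction of the ascent step towards the best response. -/

namespace SmoothStronglyConcave

variable {d m : ℕ} {L μ D η : ℝ} {Y : Set (EuclideanSpace ℝ (Fin m))}
  {f : JointSpace d m → ℝ} {f' : JointSpace d m → JointSpace d m}

/-- One projected stochastic gradient ascent step contracts the distance to the maximizer of
`f (z, ·)`, up to the noise `e` and the inexactness of the `x`-argument. -/
lemma norm_ascent_sub_bestResponse_sq_le (hf : SmoothStronglyConcave L μ Y f f')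
    (hY : ConstraintAssumption D Y) (hμ : 0 < μ) (hL : 0 ≤ L) (hη : 0 < η)
    (hη' : 9 * (η * (L + μ)) ≤ 1) (x z : EuclideanSpace ℝ (Fin d))
    {y : EuclideanSpace ℝ (Fin m)} (hy : y ∈ Y) (e : EuclideanSpace ℝ (Fin m)) :
    (1 + η * μ / 2) *
        ‖proj Y (y + η • ((f' (joint x y)).snd + e)) - bestResponse Y f z‖ ^ 2 ≤
      (1 - η * μ) * ‖y - bestResponse Y f z‖ ^ 2 + 2 * (η * (L ^ 2 / μ)) * ‖x - z‖ ^ 2 +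
      9 / 7 * η ^ 2 * ‖e‖ ^ 2 + 2 * η * inner ℝ e (y - bestResponse Y f z) := by
  set u := y + η • ((f' (joint x y)).snd + e) with hu
  have hp := (proj_spec hY.nonempty hY.compact u).1
  have hs := hf.bestResponse_mem hY z
  have hvar := inner_sub_proj_le_zero hY.nonempty hY.compact hY.convex u _ hs
  set y' := proj Y u
  have hopt := hf.inner_grad_bestResponse_le hY z hp
  set s := bestResponse Y f z
  have ha := (abs_le.1 (hf.abs_sub_sub_inner_snd_le hY.convex hL (x := z) hy hp)).1
  have hb := hf.strongly_concave z s hs y hy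
  have hc := hf.strongly_concave z y' hp s hs
  have hbias := hf.norm_grad_snd_sub_le (x := x) (x' := z) hy hy
  rw [sub_self, norm_zero, add_zero] at hbias
  set q := (f' (joint z y)).snd
  set β := (f' (joint x y)).snd - q with hβ
  have e0 : u - y' = (y - y') + η • (q + β + e) := by rw [hu, hβ]; simp; abel
  rw [e0] at hvar
  have e1 : s - y' = (y - y') - (y - s) := by abel
  have e2 : y' - y = -(y - y') := by abel
  have e3 : s - y = -(y - s) := by abel
  have e4 : y' - s = (y - s) - (y - y') := by abel
  -- `β` is the bias from using the agent's own `x` instead of `z`. It consumes half of the term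
  -- $\eta\mu\|y'-s\|^2$; the other half is the factor $1+\eta\mu/2$ in the conclusion.
  have hβ1 : 2 * η * inner ℝ β (y' - s) ≤
      η * μ / 2 * ‖y' - s‖ ^ 2 + 2 * (η * (L ^ 2 / μ)) * ‖x - z‖ ^ 2 := by
    have i1 := real_inner_le_norm β (y' - s)
    have i2 : ‖β‖ * ‖y' - s‖ ≤ L * ‖x - z‖ * ‖y' - s‖ := by gcongr
    have i3 : 0 ≤ η / (2 * μ) * (μ * ‖y' - s‖ - 2 * (L * ‖x - z‖)) ^ 2 := by positivity
    have i4 : η / (2 * μ) * (μ * ‖y' - s‖ - 2 * (L * ‖x - z‖)) ^ 2 =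
      η * μ / 2 * ‖y' - s‖ ^ 2 + 2 * (η * (L ^ 2 / μ)) * ‖x - z‖ ^ 2
        - 2 * η * (L * ‖x - z‖ * ‖y' - s‖) := by
      field_simp
      ring
    have i5 : 2 * η * inner ℝ β (y' - s) ≤ 2 * η * (L * ‖x - z‖ * ‖y' - s‖) := by
      gcongr; exact i1.trans i2
    linarith
  -- Only $\langle e,y'-y\rangle$ is estimated, since `y'` depends on the noise. The projection
  -- inequality offers one full $\|y'-y\|^2$: smoothness uses $2\eta L\le2/9$ of it, so $7/9$ is
  -- left here, which explains $9/7$.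
  have he1 : 2 * η * inner ℝ e (y' - y) ≤ 9 / 7 * η ^ 2 * ‖e‖ ^ 2 + 7 / 9 * ‖y' - y‖ ^ 2 := by
    have i1 := real_inner_le_norm e (y' - y)
    have i2 : 2 * η * inner ℝ e (y' - y) ≤ 2 * η * (‖e‖ * ‖y' - y‖) := by gcongr
    nlinarith [sq_nonneg (9 / 7 * (η * ‖e‖) - ‖y' - y‖)]
  have hLη : η * L ≤ 1 / 9 := by nlinarith
  have n1 : ‖y' - s‖ ^ 2 = ‖y - s‖ ^ 2 - 2 * inner ℝ (y - s) (y - y') + ‖y' - y‖ ^ 2 := by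
    rw [e4, norm_sub_sq_real, norm_sub_rev y' y]
  have n2 : inner ℝ (y - y') (y - y') = ‖y' - y‖ ^ 2 := by
    rw [real_inner_self_eq_norm_sq, norm_sub_rev]
  have n3 := norm_sub_rev s y
  have hLy : η * L * ‖y' - y‖ ^ 2 ≤ 1 / 9 * ‖y' - y‖ ^ 2 := by gcongr
  rw [n3] at hb
  rw [e1] at hvar
  rw [e3] at hb
  rw [e2] at ha he1
  rw [norm_neg] at ha he1
  have n4 : ‖y - y'‖ ^ 2 = ‖y' - y‖ ^ 2 := by rw [norm_sub_rev]
  rw [n4] at ha he1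
  -- Strong concavity is used twice, from `y` to `s` and from `s` to `y'`, the latter with
  -- optimality of `s`; smoothness links the values at `y` and `y'`.
  have hF : μ / 2 * ‖y' - s‖ ^ 2 + μ / 2 * ‖y - s‖ ^ 2 ≤
      inner ℝ q (y - y') - inner ℝ q (y - s) + L * ‖y' - y‖ ^ 2 := by
    simp only [inner_neg_right] at ha hb
    linarith
  have hF2 := mul_le_mul_of_nonneg_left hF (by positivity : 0 ≤ 2 * η)
  have hβ2 : inner ℝ β (y' - s) = inner ℝ β (y - s) - inner ℝ β (y - y') := by
    rw [e4, inner_sub_right]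
  have hvar2 : inner ℝ (y - y') (y - y') - inner ℝ (y - s) (y - y') +
      η * (inner ℝ q (y - y') - inner ℝ q (y - s) + (inner ℝ β (y - y') - inner ℝ β (y - s)) +
        (inner ℝ e (y - y') - inner ℝ e (y - s))) ≤ 0 := by
    refine le_of_eq_of_le ?_ hvar
    rw [inner_add_left, inner_smul_left, inner_sub_right (y - y') (y - y') (y - s),
      inner_sub_right (q + β + e), real_inner_comm (y - y') (y - s)]
    simp only [inner_add_left, RCLike.conj_to_real]
    ring
  rw [hβ2] at hβ1
  rw [inner_neg_right] at he1
  linarith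

/-- Moves the reference point when $\bar x$ changes. The Young weight $\eta\mu/2$ makes the leading
factor equal to the one on the left of `norm_ascent_sub_bestResponse_sq_le`, so the two combine
without loss. -/
lemma norm_sub_bestResponse_sq_le (hf : SmoothStronglyConcave L μ Y f f')
    (hY : ConstraintAssumption D Y) (hμ : 0 < μ) (hL : 0 ≤ L) (hη : 0 < η)
    (hη' : η * μ ≤ 1 / 2) (x z : EuclideanSpace ℝ (Fin d)) (y : EuclideanSpace ℝ (Fin m)) :
    ‖y - bestResponse Y f z‖ ^ 2 ≤ (1 + η * μ / 2) * ‖y - bestResponse Y f x‖ ^ 2 +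
      3 / (η * μ) * ((L / μ) ^ 2 * ‖z - x‖ ^ 2) := by
  have hlip := hf.norm_bestResponse_sub_le hY hμ hL z x
  set s := bestResponse Y f x
  set s' := bestResponse Y f z
  have h1 : ‖y - s'‖ ≤ ‖y - s‖ + L / μ * ‖z - x‖ := by
    have : y - s' = (y - s) - (s' - s) := by abel
    rw [this]
    exact (norm_sub_le _ _).trans (by gcongr)
  set a := ‖y - s‖
  set c := L / μ * ‖z - x‖
  have hc : (L / μ) ^ 2 * ‖z - x‖ ^ 2 = c ^ 2 := by ring
  have hημ : 0 < η * μ := by positivity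
  have hc2 : (1 + 2 / (η * μ)) * c ^ 2 ≤ 3 / (η * μ) * c ^ 2 := by
    gcongr
    rw [le_div_iff₀ hημ, add_mul, div_mul_cancel₀ _ hημ.ne']
    linarith
  have h2 : 0 ≤ η * μ / 2 * (a - 2 / (η * μ) * c) ^ 2 := by positivity
  have h3 : η * μ / 2 * (a - 2 / (η * μ) * c) ^ 2 =
      η * μ / 2 * a ^ 2 + 2 / (η * μ) * c ^ 2 - 2 * (a * c) := by
    field_simp
    ring
  rw [hc]
  calc ‖y - s'‖ ^ 2 ≤ (a + c) ^ 2 := by gcongr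
    _ ≤ _ := by nlinarith

end SmoothStronglyConcave

/-! ### Scalar algebra of the Lyapunov function. -/

section Lyapunov

variable {L μ κ ρ ηx ηy : ℝ}

/-- The polynomial consequences of the step size conditions that the convergence proof uses. -/
structure StepSizes (L μ κ ρ ηx ηy : ℝ) : Prop where
  mu_pos : 0 < μ
  one_le_kappa : 1 ≤ κ
  L_eq : L = κ * μ
  rho_pos : 0 < ρ
  rho_le_one : ρ ≤ 1
  etax_pos : 0 < ηx
  etay_pos : 0 < ηy
  etay_le : 9 * (ηy * (L + μ)) ≤ 1
  etax_le_rho : 200 * (ηx * κ * L) ≤ ρ ^ 2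
  etax_sq_le_rho : 43200 * (ηx * κ * L) ^ 2 ≤ ρ ^ 4
  etax_le_etay : 19 * (ηx * κ ^ 2) ≤ ηy
  etax_sq_le_etay : 384 * (ηx * κ ^ 2) ^ 2 ≤ ηy ^ 2

lemma StepSizes.L_pos (hs : StepSizes L μ κ ρ ηx ηy) : 0 < L := by
  rw [hs.L_eq]
  exact mul_pos (by linarith [hs.one_le_kappa]) hs.mu_pos

lemma StepSizes.kappa_eq (hs : StepSizes L μ κ ρ ηx ηy) : κ = L / μ := by
  rw [hs.L_eq, mul_div_cancel_right₀ _ hs.mu_pos.ne']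

/-- The weight of the consensus error of the `x`-variables in the Lyapunov function. -/
noncomputable def consensusWeight (L κ ρ : ℝ) : ℝ := 40 * (κ ^ 2 * L ^ 2) / ρ

/-- The weight of the gradient tracking error in the Lyapunov function. -/
noncomputable def trackingWeight (L κ ρ ηx : ℝ) : ℝ := 400 * (κ ^ 2 * L ^ 2 * ηx ^ 2) / ρ ^ 3

/-- The weight of the distance of the `y`-variables to the best responses in the Lyapunov
function. -/
noncomputable def responseWeight (L μ ηy : ℝ) : ℝ := 4 * L ^ 2 / (ηy * μ)

-- The linear bookkeeping behind the weights. `X`, `R`, `δ` are the squared errors of consensus,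
-- tracking and response; `V` and `B` the squared norms of the averaged exact gradient and averaged
-- noise; `S`, `S'` the mean squared noise now and next; `M₁`, `M₂`, `M₃` the terms linear in noise;
-- `N` is $\|\nabla\Phi(\bar x)\|^2$. Contraction provides $20\kappa^2L^2X$, $200zR$ and
-- $4L^2\delta$, where $z=\kappa^2L^2\eta_x^2/\rho^2$, and polarization of the descent term provides
-- $V$. The injected amounts are at most $11\kappa^2L^2X$, $162zR$, $(2+4/27)L^2\delta$ and $V$.
set_option maxHeartbeats 1000000 in
theorem lyapunov_descent (hs : StepSizes L μ κ ρ ηx ηy)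
    {N Φ Φ' X X' R R' δ δ' V B S S' M₁ M₂ M₃ Γ GB Δ dx dy Q : ℝ}
    (hX0 : 0 ≤ X) (hR0 : 0 ≤ R) (hδ0 : 0 ≤ δ) (hV0 : 0 ≤ V) (hB0 : 0 ≤ B) (hS0 : 0 ≤ S)
    (hX : X' ≤ (1 - ρ / 2) * X + 2 / ρ * (ηx ^ 2 * Γ))
    (hΓ : Γ ≤ 2 * R + 2 * S)
    (hG : GB ≤ 2 * V + 2 * B)
    (hdx : dx ≤ 2 * X' + 2 * X + ηx ^ 2 * GB)
    (hΔ : Δ ≤ 2 * L ^ 2 * (dx + dy))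
    (hR : R' ≤ (1 - ρ / 2) * R + 2 / ρ * Δ + 2 * M₃ + 4 * S')
    (hδ : δ' ≤ (1 - ηy * μ) * δ + 2 * (ηy * (L ^ 2 / μ)) * X + 9 / 7 * ηy ^ 2 * S + 2 * ηy * M₂ +
      3 / (ηy * μ) * ((L / μ) ^ 2 * (ηx ^ 2 * GB)))
    (hdy : dy ≤ 4 * δ + 4 * (ηy * (L ^ 2 / μ)) * X + 18 / 7 * ηy ^ 2 * S + 4 * ηy * M₂)
    (hΦ : Φ' ≤ Φ - ηx * (Q + M₁) + 2 * L * κ * (ηx ^ 2 * GB))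
    (hQ : -2 * Q ≤ -N - V + 2 * L ^ 2 * (X + δ)) :
    2 / ηx * Φ' + consensusWeight L κ ρ * X' + trackingWeight L κ ρ ηx * R' +
        responseWeight L μ ηy * δ' ≤
      2 / ηx * Φ + consensusWeight L κ ρ * X + trackingWeight L κ ρ ηx * R +
        responseWeight L μ ηy * δ - N +
      (162 * (κ ^ 2 * L ^ 2 * ηx ^ 2 / ρ ^ 3) + 6 * (ηy * κ * L)) * S +
      1600 * (κ ^ 2 * L ^ 2 * ηx ^ 2 / ρ ^ 3) * S' +
      (2 * (ηx * L * κ) + 24 * (L ^ 2 * κ ^ 2 * ηx ^ 2 / (ηy * μ) ^ 2) + ηy * κ * L) * B -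
      2 * M₁ + (8 * L ^ 2 / μ + 4 * ηy * (4 * L ^ 2 / ρ * trackingWeight L κ ρ ηx)) * M₂ +
      2 * trackingWeight L κ ρ ηx * M₃ := by
  have hL := hs.L_pos
  have hμ := hs.mu_pos
  have hκ1 := hs.one_le_kappa
  have hκ : 0 < κ := by linarith
  have hρ := hs.rho_pos
  have hηx := hs.etax_pos
  have hηy := hs.etay_pos
  set A := consensusWeight L κ ρ with hA
  set T := trackingWeight L κ ρ ηx with hT
  set C := responseWeight L μ ηy with hC
  have hA0 : 0 < A := by rw [hA, consensusWeight]; positivity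
  have hT0 : 0 < T := by rw [hT, trackingWeight]; positivity
  have hC0 : 0 < C := by rw [hC, responseWeight]; positivity
  set w := 4 * L ^ 2 / ρ * T with hw
  have hw0 : 0 < w := by positivity
  -- `w` is the weight with which movements of `x` and `y` return through the tracking error. This
  -- feedback loop must be weak; $1600/43200=1/27$ is what the first bound on $\eta_x$ gives.
  have hwL : w ≤ L ^ 2 / 27 := by
    have e : w = 1600 * (ηx * κ * L) ^ 2 / ρ ^ 4 * L ^ 2 := by
      rw [hw, hT, trackingWeight]; field_simp; ring
    have : 1600 * (ηx * κ * L) ^ 2 / ρ ^ 4 ≤ 1 / 27 := by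
      rw [div_le_div_iff₀ (by positivity) (by norm_num)]
      linarith [hs.etax_sq_le_rho]
    rw [e]
    nlinarith only [this, sq_nonneg L]
  set z := κ ^ 2 * L ^ 2 * ηx ^ 2 / ρ ^ 2 with hz
  have hz0 : 0 < z := by positivity
  have hz3 : κ ^ 2 * L ^ 2 * ηx ^ 2 / ρ ^ 3 = z / ρ := by rw [hz]; field_simp
  have hzz : z ≤ z / ρ := by
    rw [le_div_iff₀ hρ]
    exact mul_le_of_le_one_right hz0.le hs.rho_le_one
  have hκκ : κ ≤ κ ^ 2 := le_self_pow₀ hκ1 two_ne_zero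
  have hκ2 : 1 ≤ κ ^ 2 := by linarith
  have hLμ : L ^ 2 / μ = κ * L := by rw [hs.kappa_eq]; ring
  have hLη : ηy * L ≤ 1 / 9 := by nlinarith only [hs.etay_le, mul_pos hηy hμ]
  -- products of the individual estimates with the weights
  have pX := mul_le_mul_of_nonneg_left hX hA0.le
  have pR := mul_le_mul_of_nonneg_left hR hT0.le
  have pδ := mul_le_mul_of_nonneg_left hδ hC0.le
  have pΦ := mul_le_mul_of_nonneg_left hΦ (by positivity : 0 ≤ 2 / ηx)
  have pΔ : T * (2 / ρ * Δ) ≤ w * dx + w * dy := by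
    have := mul_le_mul_of_nonneg_left hΔ (by positivity : 0 ≤ T * (2 / ρ))
    have e : T * (2 / ρ) * (2 * L ^ 2 * (dx + dy)) = w * dx + w * dy := by
      rw [hw]; ring
    linarith only [this, e]
  have pdx : w * dx ≤ w * (4 * X + 4 / ρ * (ηx ^ 2 * Γ) + ηx ^ 2 * GB) := by
    refine mul_le_mul_of_nonneg_left ?_ hw0.le
    have e : 4 / ρ * (ηx ^ 2 * Γ) = 2 * (2 / ρ * (ηx ^ 2 * Γ)) := by ring
    rw [e]
    linarith only [hdx, hX, mul_nonneg hρ.le hX0]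
  have pdy := mul_le_mul_of_nonneg_left hdy hw0.le
  -- the coefficients
  have cAρ : A * (ρ / 2) = 20 * (κ ^ 2 * L ^ 2) := by
    rw [hA, consensusWeight]; field_simp; ring
  have cTρ : T * (ρ / 2) = 200 * z := by
    rw [hT, trackingWeight, hz]; field_simp; ring
  have cT : T = 400 * (z / ρ) := by rw [hT, trackingWeight, ← hz3]; ring
  have cCημ : C * (ηy * μ) = 4 * L ^ 2 := by
    rw [hC, responseWeight]; field_simp
  have cCη : C * ηy = 4 * L ^ 2 / μ := by
    rw [hC, responseWeight]; field_simp
  have cCX : C * (2 * (ηy * (L ^ 2 / μ))) = 8 * (κ ^ 2 * L ^ 2) := by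
    rw [hC, responseWeight, hLμ, hs.L_eq]; field_simp; ring
  have cCS : C * (9 / 7 * ηy ^ 2) = 36 / 7 * (ηy * κ * L) := by
    have : C * (9 / 7 * ηy ^ 2) = 36 / 7 * (ηy * (L ^ 2 / μ)) := by
      rw [hC, responseWeight]; field_simp; ring
    rw [this, hLμ]; ring
  set ζ := L ^ 2 * κ ^ 2 * ηx ^ 2 / (ηy * μ) ^ 2 with hζ
  have hζ0 : 0 < ζ := by positivity
  have cCG : C * (3 / (ηy * μ) * ((L / μ) ^ 2 * (ηx ^ 2 * GB))) = 12 * ζ * GB := by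
    rw [hC, responseWeight, hζ, ← hs.kappa_eq]; field_simp; ring
  have cΦG : 2 / ηx * (2 * L * κ * (ηx ^ 2 * GB)) = 4 * (ηx * L * κ) * GB := by
    field_simp; ring
  have cΦQ : 2 / ηx * (ηx * (Q + M₁)) = 2 * Q + 2 * M₁ := by field_simp
  -- the coefficient of `Γ`
  have hγ : A * (2 / ρ * ηx ^ 2) + w * (4 / ρ * ηx ^ 2) ≤ 81 * z := by
    have e1 : A * (2 / ρ * ηx ^ 2) = 80 * z := by
      rw [hA, consensusWeight, hz]; field_simp; ring
    have e2 : w * (4 / ρ * ηx ^ 2) ≤ z := by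
      calc w * (4 / ρ * ηx ^ 2) ≤ L ^ 2 / 27 * (4 / ρ * ηx ^ 2) := by gcongr
        _ = 4 / 27 * ρ / κ ^ 2 * z := by rw [hz]; field_simp
        _ ≤ 1 * z := by
          gcongr
          rw [div_le_one (by positivity)]
          linarith only [hs.rho_le_one, hκ2]
        _ = z := one_mul z
    linarith only [e1, e2]
  have hγ0 : 0 ≤ A * (2 / ρ * ηx ^ 2) + w * (4 / ρ * ηx ^ 2) := by positivity
  have pΓ : A * (2 / ρ * (ηx ^ 2 * Γ)) + w * (4 / ρ * (ηx ^ 2 * Γ)) ≤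
      162 * z * R + 162 * z * S := by
    calc _ = (A * (2 / ρ * ηx ^ 2) + w * (4 / ρ * ηx ^ 2)) * Γ := by ring
      _ ≤ (A * (2 / ρ * ηx ^ 2) + w * (4 / ρ * ηx ^ 2)) * (2 * R + 2 * S) := by gcongr
      _ ≤ 81 * z * (2 * R + 2 * S) := by gcongr
      _ = _ := by ring
  -- the coefficient of `GB`
  have hg0 : 0 ≤ 4 * (ηx * L * κ) + 12 * ζ + w * ηx ^ 2 := by positivity
  have pG : (4 * (ηx * L * κ) + 12 * ζ + w * ηx ^ 2) * GB ≤
      (4 * (ηx * L * κ) + 12 * ζ + w * ηx ^ 2) * (2 * V + 2 * B) := by gcongr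
  have hxκL : ηx * L * κ ≤ 1 / 200 := by
    have : ρ ^ 2 ≤ 1 := pow_le_one₀ hρ.le hs.rho_le_one
    linarith only [this, hs.etax_le_rho]
  have hxL : ηx * L ≤ ηx * L * κ := le_mul_of_one_le_right (by positivity) hκ1
  have hwx : w * ηx ^ 2 ≤ ηx * L / 27 := by
    calc w * ηx ^ 2 ≤ L ^ 2 / 27 * ηx ^ 2 := by gcongr
      _ = (ηx * L) * (ηx * L) / 27 := by ring
      _ ≤ (ηx * L) * 1 / 27 := by gcongr; linarith
      _ = _ := by ring
  have hζle : 384 * ζ ≤ 1 := by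
    have e : 384 * ζ = 384 * (ηx * κ ^ 2) ^ 2 / ηy ^ 2 := by
      rw [hζ, hs.L_eq]; field_simp
    rw [e, div_le_one (by positivity)]
    exact hs.etax_sq_le_etay
  -- The squared step of $\bar x$ is paid by the $-V$ from polarization: $8/200+24/384$ plus a
  -- negligible term is below one.
  have hgV : (4 * (ηx * L * κ) + 12 * ζ + w * ηx ^ 2) * (2 * V) ≤ V := by
    have : (4 * (ηx * L * κ) + 12 * ζ + w * ηx ^ 2) * 2 ≤ 1 := by linarith only [hwx, hζle, hxκL, hxL]
    nlinarith only [this, hV0]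
  -- Only $2\eta_xL\kappa$ of the coefficient $8\eta_xL\kappa$ of `B` is to remain visible; the rest
  -- is hidden in $\eta_y\kappa L$.
  have hxy : 19 * (ηx * L * κ) ≤ ηy * κ * L := by
    have h1 : ηx * L * κ ≤ (ηx * κ ^ 2) * (κ * L) := by
      have : ηx * L * κ * 1 ≤ ηx * L * κ * κ ^ 2 := by gcongr
      linarith only [this]
    have h2 : 19 * (ηx * κ ^ 2) * (κ * L) ≤ ηy * (κ * L) := by
      gcongr
      exact hs.etax_le_etay
    linarith only [h1, h2]
  have hgB : (4 * (ηx * L * κ) + 12 * ζ + w * ηx ^ 2) * (2 * B) ≤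
      (2 * (ηx * L * κ) + 24 * ζ + ηy * κ * L) * B := by
    have : (4 * (ηx * L * κ) + 12 * ζ + w * ηx ^ 2) * 2 ≤
      2 * (ηx * L * κ) + 24 * ζ + ηy * κ * L := by linarith only [hwx, hxL, hxy, mul_pos (mul_pos hηx hL) hκ]
    nlinarith only [this, hB0]
  -- the coefficient of `X`
  have hXc : w * (4 + 4 * (ηy * (L ^ 2 / μ))) ≤ κ ^ 2 * L ^ 2 := by
    have h1 : 4 + 4 * (ηy * (L ^ 2 / μ)) ≤ 5 * κ ^ 2 := by
      have : ηy * (L ^ 2 / μ) ≤ κ / 9 := by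
        rw [hLμ]
        nlinarith only [hLη, hκ]
      linarith only [this, hκκ, hκ2]
    calc w * (4 + 4 * (ηy * (L ^ 2 / μ))) ≤ L ^ 2 / 27 * (5 * κ ^ 2) := by gcongr
      _ ≤ κ ^ 2 * L ^ 2 := by nlinarith only [sq_nonneg (κ * L)]
  have hL2 : L ^ 2 ≤ κ ^ 2 * L ^ 2 := le_mul_of_one_le_left (by positivity) hκ2
  -- Budget in units of $\kappa^2L^2X$: 8 from the response error, at most 1 from tracking, at most
  -- 2 from the gradient bias, against 20 available.
  have qX : w * (4 * X) + w * (4 * (ηy * (L ^ 2 / μ)) * X) + C * (2 * (ηy * (L ^ 2 / μ)) * X) +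
      2 * L ^ 2 * X ≤ A * (ρ / 2) * X := by
    have e : C * (2 * (ηy * (L ^ 2 / μ)) * X) = 8 * (κ ^ 2 * L ^ 2) * X := by
      rw [← cCX]; ring
    rw [e, cAρ]
    have : w * (4 + 4 * (ηy * (L ^ 2 / μ))) * X ≤ κ ^ 2 * L ^ 2 * X := by gcongr
    have : L ^ 2 * X ≤ κ ^ 2 * L ^ 2 * X := by gcongr
    have : 0 ≤ κ ^ 2 * L ^ 2 * X := by positivity
    linarith only [‹w * (4 + 4 * (ηy * (L ^ 2 / μ))) * X ≤ _›, ‹L ^ 2 * X ≤ _›, this]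
  have qδ : w * (4 * δ) + 2 * L ^ 2 * δ ≤ C * (ηy * μ) * δ := by
    rw [cCημ]
    have : w * δ ≤ L ^ 2 / 27 * δ := by gcongr
    have : 0 ≤ L ^ 2 * δ := by positivity
    linarith only [‹w * δ ≤ _›, this]
  have qR : 162 * z * R ≤ T * (ρ / 2) * R := by
    rw [cTρ]
    gcongr
    norm_num
  have qS : 162 * z * S + C * (9 / 7 * ηy ^ 2 * S) + w * (18 / 7 * ηy ^ 2 * S) ≤
      (162 * (z / ρ) + 6 * (ηy * κ * L)) * S := by
    have e : C * (9 / 7 * ηy ^ 2 * S) = 36 / 7 * (ηy * κ * L) * S := by rw [← cCS]; ring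
    have h1 : w * (18 / 7 * ηy ^ 2) ≤ 6 / 7 * (ηy * κ * L) := by
      calc w * (18 / 7 * ηy ^ 2) ≤ L ^ 2 / 27 * (18 / 7 * ηy ^ 2) := by gcongr
        _ = (ηy * L) * (ηy * L) * (2 / 21) := by ring
        _ ≤ (1 / 9) * (ηy * L) * (2 / 21) := by gcongr
        _ ≤ 6 / 7 * (ηy * L) := by nlinarith only [mul_pos hηy hL]
        _ ≤ 6 / 7 * ((ηy * L) * κ) := by
          linarith only [le_mul_of_one_le_right (mul_pos hηy hL).le hκ1]
        _ = _ := by ring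
    rw [e]
    have h2 := mul_le_mul_of_nonneg_right h1 hS0
    have h3 := mul_le_mul_of_nonneg_right hzz hS0
    linarith only [h2, h3]
  have qM : C * (2 * ηy * M₂) + w * (4 * ηy * M₂) = (8 * L ^ 2 / μ + 4 * ηy * w) * M₂ := by
    have : C * (2 * ηy * M₂) = 2 * (C * ηy) * M₂ := by ring
    rw [this, cCη]
    ring
  have qS' : T * (4 * S') = 1600 * (z / ρ) * S' := by rw [cT]; ring
  rw [hz3]
  clear_value A T C w z ζ
  rw [mul_add, mul_sub] at pΦ
  simp only [mul_add] at pX pR pδ pdx pdy hQ pG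
  linarith only [pX, pR, pδ, pΦ, pΔ, pdx, pdy, pΓ, pG, hgV, hgB, qX, qδ, qR, qS, qM, qS', cCG, cΦG, cΦQ, hQ]

end Lyapunov

/-! ### One iteration along a fixed realization. -/

/-- The `x`-parts of the agents' exact local gradients. -/
noncomputable def gradX {n d : ℕ} {m : Fin n → ℕ}
    (f' : ∀ i, JointSpace d (m i) → JointSpace d (m i)) (x : Fin n → EuclideanSpace ℝ (Fin d))
    (y : ∀ i, EuclideanSpace ℝ (Fin (m i))) : Fin n → EuclideanSpace ℝ (Fin d) :=
  fun i => (f' i (joint (x i) (y i))).fst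

/-- The `x`-parts of a family of joint vectors. -/
noncomputable def fstPart {n d : ℕ} {m : Fin n → ℕ} (e : ∀ i, JointSpace d (m i)) :
    Fin n → EuclideanSpace ℝ (Fin d) :=
  fun i => (e i).fst

/-- The `y`-parts of a family of joint vectors. -/
noncomputable def sndPart {n d : ℕ} {m : Fin n → ℕ} (e : ∀ i, JointSpace d (m i)) :
    ∀ i, EuclideanSpace ℝ (Fin (m i)) :=
  fun i => (e i).snd

/-- The differences between the `y`-variables and the best responses to the average `x`. -/
noncomputable def responseGap {n d : ℕ} {m : Fin n → ℕ}
    (Y : ∀ i, Set (EuclideanSpace ℝ (Fin (m i)))) (f : ∀ i, JointSpace d (m i) → ℝ)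
    (z : EuclideanSpace ℝ (Fin d)) (y : ∀ i, EuclideanSpace ℝ (Fin (m i))) :
    ∀ i, EuclideanSpace ℝ (Fin (m i)) :=
  fun i => y i - bestResponse (Y i) (f i) z

/-- The Lyapunov function of the convergence proof; `r` is the gradient tracker without the
noise of the current batch. -/
noncomputable def lyapunov {n d : ℕ} {m : Fin n → ℕ}
    (Y : ∀ i, Set (EuclideanSpace ℝ (Fin (m i)))) (f : ∀ i, JointSpace d (m i) → ℝ)
    (L μ κ ρ ηx ηy : ℝ) (x : Fin n → EuclideanSpace ℝ (Fin d))
    (y : ∀ i, EuclideanSpace ℝ (Fin (m i))) (r : Fin n → EuclideanSpace ℝ (Fin d)) : ℝ :=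
  2 / ηx * primal Y f (agentAvg x) + consensusWeight L κ ρ * meanSq (deviation x) +
    trackingWeight L κ ρ ηx * meanSq (deviation r) +
    responseWeight L μ ηy * meanSq (responseGap Y f (agentAvg x) y)

/-- The iterates, written in terms of the exact gradients and the noise `e` of the batch at the
current iterate and `e'` of the batch at the next one. -/
structure DsgtaTransition {n d : ℕ} {m : Fin n → ℕ} (W : Matrix (Fin n) (Fin n) ℝ) (ηx ηy : ℝ)
    (Y : ∀ i, Set (EuclideanSpace ℝ (Fin (m i))))
    (f' : ∀ i, JointSpace d (m i) → JointSpace d (m i))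
    (x : Fin n → EuclideanSpace ℝ (Fin d)) (y : ∀ i, EuclideanSpace ℝ (Fin (m i)))
    (g : Fin n → EuclideanSpace ℝ (Fin d)) (e : ∀ i, JointSpace d (m i))
    (x' : Fin n → EuclideanSpace ℝ (Fin d)) (y' : ∀ i, EuclideanSpace ℝ (Fin (m i)))
    (g' : Fin n → EuclideanSpace ℝ (Fin d)) (e' : ∀ i, JointSpace d (m i)) : Prop where
  x_eq : x' = mix W (x - ηx • g)
  y_eq : ∀ i, y' i = proj (Y i) (y i + ηy • ((f' i (joint (x i) (y i))).snd + (e i).snd))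
  g_eq : g' = mix W (g + (gradX f' x' y' + fstPart e') - (gradX f' x y + fstPart e))
  avg_eq : agentAvg g = agentAvg (gradX f' x y + fstPart e)

section OneStep

variable {n d : ℕ} {m : Fin n → ℕ} {W : Matrix (Fin n) (Fin n) ℝ} {G : SimpleGraph (Fin n)}
  {L μ κ ρ D ηx ηy : ℝ} {Y : ∀ i, Set (EuclideanSpace ℝ (Fin (m i)))}
  {f : ∀ i, JointSpace d (m i) → ℝ} {f' : ∀ i, JointSpace d (m i) → JointSpace d (m i)}

lemma meanSq_fstPart_le (e : ∀ i, JointSpace d (m i)) : meanSq (fstPart e) ≤ meanSq e :=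
  meanSq_le_of_le fun i =>
    pow_le_pow_left₀ (norm_nonneg (e i).fst) (norm_fst_le_norm (e i)) 2

lemma meanSq_sndPart_le (e : ∀ i, JointSpace d (m i)) : meanSq (sndPart e) ≤ meanSq e :=
  meanSq_le_of_le fun i =>
    pow_le_pow_left₀ (norm_nonneg (e i).snd) (norm_snd_le_norm (e i)) 2

lemma meanSq_gradX_sub_le (hf : ∀ i, SmoothStronglyConcave L μ (Y i) (f i) (f' i))
    {x x' : Fin n → EuclideanSpace ℝ (Fin d)} {y y' : ∀ i, EuclideanSpace ℝ (Fin (m i))}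
    (hy : ∀ i, y i ∈ Y i) (hy' : ∀ i, y' i ∈ Y i) :
    meanSq (gradX f' x' y' - gradX f' x y) ≤
      2 * L ^ 2 * (meanSq (x' - x) + meanSq (y' - y)) := by
  have h : ∀ i, ‖(gradX f' x' y' - gradX f' x y) i‖ ^ 2 ≤
      2 * L ^ 2 * (‖(x' - x) i‖ ^ 2 + ‖(y' - y) i‖ ^ 2) := by
    intro i
    have h := (hf i).norm_grad_fst_sub_le (x := x' i) (x' := x i) (hy' i) (hy i)
    calc ‖gradX f' x' y' i - gradX f' x y i‖ ^ 2
        ≤ (L * (‖x' i - x i‖ + ‖y' i - y i‖)) ^ 2 := pow_le_pow_left₀ (norm_nonneg _) h 2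
      _ ≤ 2 * L ^ 2 * (‖x' i - x i‖ ^ 2 + ‖y' i - y i‖ ^ 2) := by
        nlinarith [mul_nonneg (sq_nonneg L) (sq_nonneg (‖x' i - x i‖ - ‖y' i - y i‖))]
  have h2 := mul_le_mul_of_nonneg_left (Finset.sum_le_sum fun i (_ : i ∈ Finset.univ) => h i)
    (by positivity : 0 ≤ 1 / (n : ℝ))
  simp only [← Finset.mul_sum, Finset.sum_add_distrib] at h2
  refine h2.trans_eq ?_
  unfold meanSq
  ring

/-- Both vectors are averages of local gradients, one taken at $(\bar x,y_i^*(\bar x))$ and the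
other at $(x_i,y_i)$, so smoothness applies agent by agent. -/
lemma norm_primalGrad_sub_agentAvg_gradX_sq_le (hn : 0 < n)
    (hf : ∀ i, SmoothStronglyConcave L μ (Y i) (f i) (f' i))
    (hY : ∀ i, ConstraintAssumption D (Y i))
    (x : Fin n → EuclideanSpace ℝ (Fin d)) {y : ∀ i, EuclideanSpace ℝ (Fin (m i))}
    (hy : ∀ i, y i ∈ Y i) :
    ‖primalGrad Y f f' (agentAvg x) - agentAvg (gradX f' x y)‖ ^ 2 ≤
      2 * L ^ 2 * (meanSq (deviation x) + meanSq (responseGap Y f (agentAvg x) y)) := by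
  have e : primalGrad Y f f' (agentAvg x) - agentAvg (gradX f' x y) =
      -agentAvg (gradX f' x y - gradX f' (fun _ => agentAvg x)
        (fun i => bestResponse (Y i) (f i) (agentAvg x))) := by
    rw [agentAvg_sub, neg_sub]
    rfl
  rw [e, norm_neg]
  exact (norm_agentAvg_sq_le hn _).trans (meanSq_gradX_sub_le hf
    (fun i => (hf i).bestResponse_mem (hY i) _) hy)

lemma ascent_le (hs : StepSizes L μ κ ρ ηx ηy)
    (hf : ∀ i, SmoothStronglyConcave L μ (Y i) (f i) (f' i))
    (hY : ∀ i, ConstraintAssumption D (Y i))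
    {x : Fin n → EuclideanSpace ℝ (Fin d)} {y y' : ∀ i, EuclideanSpace ℝ (Fin (m i))}
    {e : ∀ i, JointSpace d (m i)} (hy : ∀ i, y i ∈ Y i)
    (hy' : ∀ i, y' i = proj (Y i) (y i + ηy • ((f' i (joint (x i) (y i))).snd + (e i).snd))) :
    (1 + ηy * μ / 2) * meanSq (responseGap Y f (agentAvg x) y') ≤
      (1 - ηy * μ) * meanSq (responseGap Y f (agentAvg x) y) +
      2 * (ηy * (L ^ 2 / μ)) * meanSq (deviation x) + 9 / 7 * ηy ^ 2 * meanSq (sndPart e) +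
      2 * ηy * meanInner (sndPart e) (responseGap Y f (agentAvg x) y) := by
  have h := Finset.sum_le_sum fun i (_ : i ∈ Finset.univ) =>
    (hf i).norm_ascent_sub_bestResponse_sq_le (hY i) hs.mu_pos hs.L_pos.le hs.etay_pos hs.etay_le
      (x i) (agentAvg x) (hy i) (e i).snd
  simp only [← hy', Finset.sum_add_distrib, ← Finset.mul_sum] at h
  have h2 := mul_le_mul_of_nonneg_left h (by positivity : 0 ≤ 1 / (n : ℝ))
  simp only [meanSq, meanInner, responseGap, sndPart, deviation]
  refine le_of_eq_of_le (by ring) (h2.trans_eq (by ring))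

lemma meanSq_responseGap_le (hs : StepSizes L μ κ ρ ηx ηy) (hn : 0 < n)
    (hf : ∀ i, SmoothStronglyConcave L μ (Y i) (f i) (f' i))
    (hY : ∀ i, ConstraintAssumption D (Y i))
    (z z' : EuclideanSpace ℝ (Fin d)) (y : ∀ i, EuclideanSpace ℝ (Fin (m i))) :
    meanSq (responseGap Y f z' y) ≤ (1 + ηy * μ / 2) * meanSq (responseGap Y f z y) +
      3 / (ηy * μ) * ((L / μ) ^ 2 * ‖z' - z‖ ^ 2) := by
  have hn' : (n : ℝ) ≠ 0 := by positivity
  have hημ : ηy * μ ≤ 1 / 2 := by nlinarith [hs.etay_le, mul_pos hs.etay_pos hs.L_pos]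
  have h := Finset.sum_le_sum fun i (_ : i ∈ Finset.univ) =>
    (hf i).norm_sub_bestResponse_sq_le (hY i) hs.mu_pos hs.L_pos.le hs.etay_pos hημ z z' (y i)
  simp only [Finset.sum_add_distrib, ← Finset.mul_sum, Finset.sum_const, Finset.card_univ,
    Fintype.card_fin, nsmul_eq_mul] at h
  have h2 := mul_le_mul_of_nonneg_left h (by positivity : 0 ≤ 1 / (n : ℝ))
  simp only [meanSq, responseGap]
  refine h2.trans_eq ?_
  field_simp

/-- One iteration decreases the Lyapunov function by the squared norm of the primal gradient, up
to noise. -/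
theorem lyapunov_step (hs : StepSizes L μ κ ρ ηx ηy) (hW : NetworkAssumption G W)
    (hρ : ρ = 1 - mixingNorm W ^ 2)
    (hf : ∀ i, SmoothStronglyConcave L μ (Y i) (f i) (f' i))
    (hY : ∀ i, ConstraintAssumption D (Y i))
    {x x' g g' : Fin n → EuclideanSpace ℝ (Fin d)} {y y' : ∀ i, EuclideanSpace ℝ (Fin (m i))}
    {e e' : ∀ i, JointSpace d (m i)} (hy : ∀ i, y i ∈ Y i)
    (ht : DsgtaTransition W ηx ηy Y f' x y g e x' y' g' e') :
    lyapunov Y f L μ κ ρ ηx ηy x' y' (g' - fstPart e') ≤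
      lyapunov Y f L μ κ ρ ηx ηy x y (g - fstPart e) - ‖primalGrad Y f f' (agentAvg x)‖ ^ 2 +
      (162 * (κ ^ 2 * L ^ 2 * ηx ^ 2 / ρ ^ 3) + 6 * (ηy * κ * L)) * meanSq e +
      1600 * (κ ^ 2 * L ^ 2 * ηx ^ 2 / ρ ^ 3) * meanSq e' +
      (2 * (ηx * L * κ) + 24 * (L ^ 2 * κ ^ 2 * ηx ^ 2 / (ηy * μ) ^ 2) + ηy * κ * L) *
        ‖agentAvg (fstPart e)‖ ^ 2 -
      2 * meanInner (fun _ => primalGrad Y f f' (agentAvg x)) (fstPart e) +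
      (8 * L ^ 2 / μ + 4 * ηy * (4 * L ^ 2 / ρ * trackingWeight L κ ρ ηx)) *
        meanInner (sndPart e) (responseGap Y f (agentAvg x) y) +
      2 * trackingWeight L κ ρ ηx *
        meanInner (mix W (deviation (mix W (g - fstPart e + (gradX f' x' y' - gradX f' x y)))) -
          deviation (mix W (g - fstPart e + (gradX f' x' y' - gradX f' x y)))) (fstPart e') := by
  have hn := hW.pos
  have hμ := hs.mu_pos
  have hL := hs.L_pos
  have hρ0 := hs.rho_pos
  have hηy := hs.etay_pos
  have hημ : 0 < ηy * μ := by positivity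
  have hy' : ∀ i, y' i ∈ Y i := fun i => by
    rw [ht.y_eq]
    exact (proj_spec (hY i).nonempty (hY i).compact _).1
  have havg : agentAvg x' - agentAvg x = -(ηx • agentAvg g) := by
    rw [ht.x_eq, agentAvg_mix hW, agentAvg_sub, agentAvg_smul]
    abel
  have hnorm : ‖agentAvg x' - agentAvg x‖ ^ 2 = ηx ^ 2 * ‖agentAvg g‖ ^ 2 := by
    rw [havg, norm_neg, norm_smul, mul_pow, Real.norm_eq_abs, sq_abs]
  -- The old noise `e` appears in `g` and in the subtracted gradient and combines with `g` into the
  -- old noiseless tracker.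
  have hg' : g' - fstPart e' = mix W (g - fstPart e + (gradX f' x' y' - gradX f' x y)) +
      (mix W (fstPart e') - fstPart e') := by
    rw [ht.g_eq, ← add_sub_assoc, ← mix_add]
    congr 2
    abel
  have hasc := ascent_le hs hf hY hy ht.y_eq
  have hgap := meanSq_responseGap_le hs hn hf hY (agentAvg x) (agentAvg x') y'
  rw [hnorm] at hgap
  have hΦ := (abs_le.1 (abs_primal_sub_le hn hf hY hμ hL.le (agentAvg x) (agentAvg x'))).2
  have hsnd := meanSq_sndPart_le e
  have hsnd2 : 9 / 7 * ηy ^ 2 * meanSq (sndPart e) ≤ 9 / 7 * ηy ^ 2 * meanSq e := by gcongr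
  have hgap0 := meanSq_nonneg (responseGap Y f (agentAvg x) y)
  have hgap0' := meanSq_nonneg (responseGap Y f (agentAvg x) y')
  refine lyapunov_descent hs (V := ‖agentAvg (gradX f' x y)‖ ^ 2)
    (Γ := meanSq (deviation g)) (GB := ‖agentAvg g‖ ^ 2)
    (Δ := meanSq (gradX f' x' y' - gradX f' x y)) (dx := meanSq (x' - x))
    (dy := meanSq (y' - y))
    (Q := inner ℝ (primalGrad Y f f' (agentAvg x)) (agentAvg (gradX f' x y)))
    (meanSq_nonneg _) (meanSq_nonneg _) (meanSq_nonneg _) (sq_nonneg _) (sq_nonneg _)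
    (meanSq_nonneg _) ?_ ?_ ?_ ?_ (meanSq_gradX_sub_le hf hy hy') ?_ ?_ ?_ ?_ ?_
  · rw [ht.x_eq]
    exact meanSq_deviation_mix_sub_smul_le hW hρ hρ0 ηx x g
  · have e1 : deviation g = deviation (g - fstPart e) + deviation (fstPart e) := by
      rw [← deviation_add, sub_add_cancel]
    rw [e1]
    have := meanSq_add_le (deviation (g - fstPart e)) (deviation (fstPart e))
    have := meanSq_deviation_le hn (fstPart e)
    have := meanSq_fstPart_le e
    linarith
  · rw [ht.avg_eq, agentAvg_add]
    exact norm_add_sq_le _ _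
  · rw [← hnorm]
    exact meanSq_sub_le_deviation hn x x'
  · rw [hg']
    have := meanSq_deviation_tracker_le hW hρ hρ0 (g - fstPart e)
      (gradX f' x' y' - gradX f' x y) (fstPart e')
    have := meanSq_fstPart_le e'
    linarith
  -- The factor $1+\eta_y\mu/2$ from moving the reference point is exactly the one that `hasc`
  -- bounds.
  · linarith
  · have e1 : y' - y = responseGap Y f (agentAvg x) y' - responseGap Y f (agentAvg x) y := by
      ext1 i
      simp [responseGap]
    rw [e1]
    have h1 := meanSq_sub_le (responseGap Y f (agentAvg x) y') (responseGap Y f (agentAvg x) y)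
    have h2 : 0 ≤ ηy * μ * meanSq (responseGap Y f (agentAvg x) y) := by positivity
    have h3 : 0 ≤ ηy * μ * meanSq (responseGap Y f (agentAvg x) y') := by positivity
    linarith
  · rw [meanInner_const_left, ← inner_add_right, ← agentAvg_add, ← ht.avg_eq]
    have hκ := hs.kappa_eq
    have h1 : L + L * (L / μ) ≤ 2 * L * κ := by
      rw [← hκ]
      nlinarith [hs.one_le_kappa]
    have h2 := mul_le_mul_of_nonneg_right h1 (sq_nonneg ‖agentAvg x' - agentAvg x‖)
    rw [hnorm] at h2 hΦ
    rw [havg, inner_neg_right, inner_smul_right] at hΦ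
    linarith
  -- Polarization: keeping the square of the averaged gradient yields the `-V` that pays for the
  -- squared step.
  · have h1 := norm_primalGrad_sub_agentAvg_gradX_sq_le hn hf hY x hy
    rw [norm_sub_sq_real] at h1
    linarith

end OneStep

/-! ### Random fields evaluated at an independent point. -/

section IndependentNoise

lemma MeasureTheory.MemLp.integrable_real_inner {Ω E : Type*} [MeasurableSpace Ω] {P : Measure Ω}
    [NormedAddCommGroup E] [InnerProductSpace ℝ E] {u v : Ω → E} (hu : MemLp u 2 P)
    (hv : MemLp v 2 P) : Integrable (fun ω => inner ℝ (u ω) (v ω)) P := by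
  have h1 := (memLp_two_iff_integrable_sq_norm hu.1).1 hu
  have h2 := (memLp_two_iff_integrable_sq_norm hv.1).1 hv
  refine (h1.add h2).mono' (hu.1.inner hv.1) (Filter.Eventually.of_forall fun ω => ?_)
  have := abs_real_inner_le_norm (u ω) (v ω)
  simp only [Real.norm_eq_abs, Pi.add_apply]
  nlinarith [sq_nonneg (‖u ω‖ - ‖v ω‖), sq_nonneg (‖u ω‖), sq_nonneg (‖v ω‖)]

lemma MeasureTheory.MemLp.integrable_norm_sq {Ω E : Type*} [MeasurableSpace Ω] {P : Measure Ω}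
    [NormedAddCommGroup E] {u : Ω → E} (hu : MemLp u 2 P) :
    Integrable (fun ω => ‖u ω‖ ^ 2) P :=
  (memLp_two_iff_integrable_sq_norm hu.1).1 hu

variable {Ω β E : Type*} [NormedAddCommGroup E]
  [MeasurableSpace E] [BorelSpace E] [SecondCountableTopology E]
  [MeasurableSpace β] {m : MeasurableSpace Ω} [mΩ : MeasurableSpace Ω] {P : Measure Ω}
  [IsProbabilityMeasure P] {Z : Ω → β} {S : Set E} {F : E × β → E} {p : Ω → E} {s : ℝ}

lemma map_prodMk_of_indep {α : Type*} [MeasurableSpace α] (hm : m ≤ mΩ) (hZ : Measurable Z)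
    (hind : Indep m (MeasurableSpace.comap Z inferInstance) P) {A : Ω → α}
    (hA : Measurable[m] A) :
    P.map (fun ω => (A ω, Z ω)) = (P.map A).prod (P.map Z) := by
  have hi : IndepFun A Z P := (IndepFun_iff_Indep A Z P).2
    (indep_of_indep_of_le_left hind hA.comap_le)
  exact (indepFun_iff_map_prod_eq_prod_map_map (hA.mono hm le_rfl).aemeasurable
    hZ.aemeasurable).1 hi

/-- Evaluating a square-integrable random field at an independent point preserves the bound on
the second moment. -/
theorem memLp_two_of_indep (hm : m ≤ mΩ) (hZ : Measurable Z)
    (hind : Indep m (MeasurableSpace.comap Z inferInstance) P) (hF : Measurable F)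
    (hp : Measurable[m] p) (hpS : ∀ ω, p ω ∈ S)
    (hsq : ∀ q ∈ S, Integrable (fun ω => ‖F (q, Z ω)‖ ^ 2) P)
    (hle : ∀ q ∈ S, ∫ ω, ‖F (q, Z ω)‖ ^ 2 ∂P ≤ s) :
    MemLp (fun ω => F (p ω, Z ω)) 2 P ∧ ∫ ω, ‖F (p ω, Z ω)‖ ^ 2 ∂P ≤ s := by
  have hp' : Measurable p := hp.mono hm le_rfl
  have hmeas : Measurable fun ω => F (p ω, Z ω) := hF.comp (hp'.prodMk hZ)
  have hs0 : 0 ≤ s := by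
    obtain ⟨ω⟩ : Nonempty Ω := P.nonempty_of_neZero
    exact (integral_nonneg fun _ => by positivity).trans (hle _ (hpS ω))
  -- Integrability is not yet known, so Tonelli for the lower integral comes before any Bochner
  -- integral.
  have hl : ∫⁻ ω, ENNReal.ofReal (‖F (p ω, Z ω)‖ ^ 2) ∂P ≤ ENNReal.ofReal s := by
    have hφ : Measurable fun c : E × β => ENNReal.ofReal (‖F c‖ ^ 2) :=
      (hF.norm.pow_const 2).ennreal_ofReal
    have e1 : ∫⁻ ω, ENNReal.ofReal (‖F (p ω, Z ω)‖ ^ 2) ∂P =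
        ∫⁻ q, ∫⁻ z, ENNReal.ofReal (‖F (q, z)‖ ^ 2) ∂(P.map Z) ∂(P.map p) := by
      rw [← lintegral_prod _ hφ.aemeasurable, ← map_prodMk_of_indep hm hZ hind hp,
        lintegral_map hφ (hp'.prodMk hZ)]
    have e2 : ∫⁻ q, ∫⁻ z, ENNReal.ofReal (‖F (q, z)‖ ^ 2) ∂(P.map Z) ∂(P.map p) =
        ∫⁻ ω, ∫⁻ z, ENNReal.ofReal (‖F (p ω, z)‖ ^ 2) ∂(P.map Z) ∂P :=
      lintegral_map (Measurable.lintegral_prod_right' hφ) hp'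
    rw [e1, e2]
    calc _ ≤ ∫⁻ ω, ENNReal.ofReal s ∂P := by
          refine lintegral_mono fun ω => ?_
          have e3 : ∫⁻ z, ENNReal.ofReal (‖F (p ω, z)‖ ^ 2) ∂(P.map Z) =
              ∫⁻ ω', ENNReal.ofReal (‖F (p ω, Z ω')‖ ^ 2) ∂P :=
            lintegral_map (hφ.comp measurable_prodMk_left) hZ
          rw [e3, ← ofReal_integral_eq_lintegral_ofReal (hsq _ (hpS ω))
              (Filter.Eventually.of_forall fun _ => by positivity)]
          exact ENNReal.ofReal_le_ofReal (hle _ (hpS ω))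
      _ = ENNReal.ofReal s := by simp
  have hint : Integrable (fun ω => ‖F (p ω, Z ω)‖ ^ 2) P := by
    refine ⟨(hmeas.norm.pow_const 2).aestronglyMeasurable, ?_⟩
    rw [hasFiniteIntegral_iff_ofReal (Filter.Eventually.of_forall fun _ => by positivity)]
    exact hl.trans_lt ENNReal.ofReal_lt_top
  refine ⟨(memLp_two_iff_integrable_sq_norm hmeas.aestronglyMeasurable).2 hint, ?_⟩
  rw [← ENNReal.ofReal_le_ofReal_iff hs0, ofReal_integral_eq_lintegral_ofReal hint
    (Filter.Eventually.of_forall fun _ => by positivity)]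
  exact hl

/-- A centred random field, evaluated at an independent point, is orthogonal to the past. -/
theorem integral_inner_eq_zero_of_indep [InnerProductSpace ℝ E] [CompleteSpace E]
    (hm : m ≤ mΩ) (hZ : Measurable Z)
    (hind : Indep m (MeasurableSpace.comap Z inferInstance) P) (hF : Measurable F)
    (hp : Measurable[m] p) (hpS : ∀ ω, p ω ∈ S)
    (hint : ∀ q ∈ S, Integrable (fun ω => F (q, Z ω)) P)
    (hmean : ∀ q ∈ S, ∫ ω, F (q, Z ω) ∂P = 0)
    (hL2 : MemLp (fun ω => F (p ω, Z ω)) 2 P)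
    {A : Ω → E} (hA : Measurable[m] A) (hA2 : MemLp A 2 P) :
    ∫ ω, inner ℝ (A ω) (F (p ω, Z ω)) ∂P = 0 := by
  have hp' : Measurable p := hp.mono hm le_rfl
  have hA' : Measurable A := hA.mono hm le_rfl
  -- The test vector and the evaluation point must be frozen together: `Z` is independent of the
  -- pair, and Fubini integrates over `Z` first.
  have hAp : Measurable[m] fun ω => (A ω, p ω) := hA.prodMk hp
  have hmap := map_prodMk_of_indep hm hZ hind hAp
  let φ : (E × E) × β → ℝ := fun c => inner ℝ c.1.1 (F (c.1.2, c.2))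
  have hφ : Measurable φ := by
    have h1 : Measurable fun c : (E × E) × β => c.1.1 := measurable_fst.fst
    have h2 : Measurable fun c : (E × E) × β => F (c.1.2, c.2) :=
      hF.comp (measurable_fst.snd.prodMk measurable_snd)
    exact h1.inner h2
  have hT : Measurable fun ω => ((A ω, p ω), Z ω) := (hA'.prodMk hp').prodMk hZ
  have hI : Integrable φ ((P.map fun ω => (A ω, p ω)).prod (P.map Z)) := by
    rw [← hmap, integrable_map_measure hφ.aestronglyMeasurable hT.aemeasurable]
    exact hA2.integrable_real_inner hL2
  calc ∫ ω, inner ℝ (A ω) (F (p ω, Z ω)) ∂P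
      = ∫ c, φ c ∂(P.map fun ω => ((A ω, p ω), Z ω)) :=
        (integral_map hT.aemeasurable hφ.aestronglyMeasurable).symm
    _ = ∫ a, ∫ z, φ (a, z) ∂(P.map Z) ∂(P.map fun ω => (A ω, p ω)) := by
        rw [hmap, integral_prod _ hI]
    _ = ∫ ω, ∫ z, φ ((A ω, p ω), z) ∂(P.map Z) ∂P :=
        integral_map (hA'.prodMk hp').aemeasurable
          hφ.stronglyMeasurable.integral_prod_right.aestronglyMeasurable
    _ = ∫ ω, 0 ∂P := by
        refine integral_congr_ae (Filter.Eventually.of_forall fun ω => ?_)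
        have e : ∫ z, φ ((A ω, p ω), z) ∂(P.map Z) = ∫ ω', inner ℝ (A ω) (F (p ω, Z ω')) ∂P :=
          integral_map hZ.aemeasurable (hφ.comp measurable_prodMk_left).aestronglyMeasurable
        simp only [e]
        rw [integral_inner (hint _ (hpS ω)), hmean _ (hpS ω), inner_zero_right]
    _ = 0 := by simp

end IndependentNoise

/-! ### Square-integrable variables adapted to a σ-algebra. -/

/-- `u` is square integrable and measurable with respect to the sub-σ-algebra `m`. -/
structure SqIntegrableWrt {Ω E : Type*} [NormedAddCommGroup E] [MeasurableSpace E]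
    (m : MeasurableSpace Ω) [MeasurableSpace Ω] (P : Measure Ω) (u : Ω → E) : Prop where
  measurable : Measurable[m] u
  memLp : MemLp u 2 P

namespace SqIntegrableWrt

variable {Ω E E' : Type*} [NormedAddCommGroup E] [MeasurableSpace E] [BorelSpace E]
  [SecondCountableTopology E] [NormedAddCommGroup E'] [MeasurableSpace E'] [BorelSpace E']
  [SecondCountableTopology E'] {m m' : MeasurableSpace Ω} [mΩ : MeasurableSpace Ω]
  {P : Measure Ω} {u v : Ω → E}

lemma mono (hu : SqIntegrableWrt m P u) (h : m ≤ m') : SqIntegrableWrt m' P u :=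
  ⟨hu.measurable.mono h le_rfl, hu.memLp⟩

lemma add (hu : SqIntegrableWrt m P u) (hv : SqIntegrableWrt m P v) :
    SqIntegrableWrt m P fun ω => u ω + v ω :=
  ⟨hu.measurable.add hv.measurable, hu.memLp.add hv.memLp⟩

lemma sub (hu : SqIntegrableWrt m P u) (hv : SqIntegrableWrt m P v) :
    SqIntegrableWrt m P fun ω => u ω - v ω :=
  ⟨hu.measurable.sub hv.measurable, hu.memLp.sub hv.memLp⟩

lemma const_smul [NormedSpace ℝ E] (hu : SqIntegrableWrt m P u) (c : ℝ) :
    SqIntegrableWrt m P fun ω => c • u ω :=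
  ⟨hu.measurable.const_smul c, hu.memLp.const_smul c⟩

lemma sum {ι : Type*} {u : ι → Ω → E} (s : Finset ι) (hu : ∀ i, SqIntegrableWrt m P (u i)) :
    SqIntegrableWrt m P fun ω => ∑ i ∈ s, u i ω :=
  ⟨Finset.measurable_fun_sum s fun i _ => (hu i).measurable,
    memLp_finsetSum s fun i _ => (hu i).memLp⟩

lemma const [IsFiniteMeasure P] (c : E) : SqIntegrableWrt m P fun _ => c :=
  ⟨measurable_const, memLp_const c⟩

lemma comp_of_norm_le [IsFiniteMeasure P] (hm : m ≤ mΩ) (hu : SqIntegrableWrt m P u) {φ : E → E'}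
    (hφ : Measurable φ) {c C : ℝ} (h : ∀ x, ‖φ x‖ ≤ c + C * ‖x‖) :
    SqIntegrableWrt m P fun ω => φ (u ω) := by
  have hmeas : Measurable[m] fun ω => φ (u ω) := hφ.comp hu.measurable
  refine ⟨hmeas, ?_⟩
  refine ((memLp_const c).add (hu.memLp.norm.const_mul C)).mono
    (hmeas.mono hm le_rfl).aestronglyMeasurable (Filter.Eventually.of_forall fun ω => ?_)
  exact (h (u ω)).trans (le_abs_self _)

lemma comp_of_lipschitz [IsFiniteMeasure P] (hm : m ≤ mΩ) (hu : SqIntegrableWrt m P u)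
    {φ : E → E'} {C : ℝ} (hC : 0 ≤ C) (h : ∀ x x', ‖φ x - φ x'‖ ≤ C * ‖x - x'‖) :
    SqIntegrableWrt m P fun ω => φ (u ω) := by
  have hφ : Continuous φ := LipschitzWith.continuous (K := ⟨C, hC⟩) <|
    LipschitzWith.of_dist_le_mul fun x x' => by
      rw [dist_eq_norm, dist_eq_norm]
      exact h x x'
  refine hu.comp_of_norm_le hm hφ.measurable (c := ‖φ 0‖) (C := C) fun x => ?_
  have h1 := h x 0
  rw [sub_zero] at h1
  have h2 := norm_le_insert' (φ x) (φ 0)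
  linarith

variable {n d : ℕ} {W : Matrix (Fin n) (Fin n) ℝ} {w : Ω → Fin n → EuclideanSpace ℝ (Fin d)}

lemma mix (hw : ∀ i, SqIntegrableWrt m P fun ω => w ω i) (i : Fin n) :
    SqIntegrableWrt m P fun ω => mix W (w ω) i :=
  sum _ fun j => (hw j).const_smul (W i j)

lemma agentAvg (hw : ∀ i, SqIntegrableWrt m P fun ω => w ω i) :
    SqIntegrableWrt m P fun ω => agentAvg (w ω) :=
  (sum _ hw).const_smul _

lemma deviation (hw : ∀ i, SqIntegrableWrt m P fun ω => w ω i) (i : Fin n) :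
    SqIntegrableWrt m P fun ω => deviation (w ω) i :=
  (hw i).sub (agentAvg hw)

lemma integrable_meanSq {E : Fin n → Type*} [∀ i, NormedAddCommGroup (E i)]
    [∀ i, MeasurableSpace (E i)] {w : Ω → ∀ i, E i}
    (hw : ∀ i, SqIntegrableWrt m P fun ω => w ω i) : Integrable (fun ω => meanSq (w ω)) P :=
  (integrable_finsetSum _ fun i _ => (hw i).memLp.integrable_norm_sq).const_mul _

end SqIntegrableWrt

/-! ### Second moments of orthogonal sums. -/

section Variance

variable {Ω E ι : Type*} [NormedAddCommGroup E] [InnerProductSpace ℝ E] [MeasurableSpace Ω]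
  {P : Measure Ω}

/-- The second moment of a sum of pairwise orthogonal random vectors. -/
lemma integral_norm_sum_sq_le [Fintype ι] {u : ι → Ω → E} {s : ℝ} (hu : ∀ k, MemLp (u k) 2 P)
    (horth : ∀ k l, k ≠ l → ∫ ω, inner ℝ (u k ω) (u l ω) ∂P = 0)
    (hs : ∀ k, ∫ ω, ‖u k ω‖ ^ 2 ∂P ≤ s) :
    ∫ ω, ‖∑ k, u k ω‖ ^ 2 ∂P ≤ Fintype.card ι * s := by
  classical
  have e : ∀ ω, ‖∑ k, u k ω‖ ^ 2 = ∑ k, ∑ l, inner ℝ (u k ω) (u l ω) := fun ω => by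
    rw [← real_inner_self_eq_norm_sq]
    simp only [sum_inner, inner_sum]
    exact Finset.sum_comm
  simp_rw [e]
  rw [integral_finsetSum _ fun k _ => integrable_finsetSum _ fun l _ =>
    (hu k).integrable_real_inner (hu l)]
  calc ∑ k, ∫ ω, ∑ l, inner ℝ (u k ω) (u l ω) ∂P ≤ ∑ k : ι, s := by
        refine Finset.sum_le_sum fun k _ => ?_
        rw [integral_finsetSum _ fun l _ => (hu k).integrable_real_inner (hu l),
          Finset.sum_eq_single k (fun l _ hl => horth k l hl.symm) (by simp)]
        simp_rw [real_inner_self_eq_norm_sq]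
        exact hs k
    _ = Fintype.card ι * s := by simp

end Variance

/-! ### The σ-algebras generated by the samples. -/

section Samples

variable {n b : ℕ} {Ω : Type*} {Ξ : Fin n → Type*} [∀ i, MeasurableSpace (Ξ i)]

/-- The σ-algebra of the samples drawn before iteration `t`. -/
abbrev pastSigma (ξ : ℕ → ∀ i : Fin n, Fin b → Ω → Ξ i) (t : ℕ) : MeasurableSpace Ω :=
  ⨆ k ∈ {k : ℕ × Fin n × Fin b | k.1 < t},
    MeasurableSpace.comap (fun ω => ξ k.1 k.2.1 k.2.2 ω) inferInstance

/-- The σ-algebra of all samples drawn up to iteration `t`, except for the sample `j` of agent `i`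
at iteration `t`. -/
abbrev othersSigma (ξ : ℕ → ∀ i : Fin n, Fin b → Ω → Ξ i) (t : ℕ) (i : Fin n) (j : Fin b) :
    MeasurableSpace Ω :=
  ⨆ k ∈ {k : ℕ × Fin n × Fin b | k.1 ≤ t ∧ k ≠ (t, i, j)},
    MeasurableSpace.comap (fun ω => ξ k.1 k.2.1 k.2.2 ω) inferInstance

variable {ξ : ℕ → ∀ i : Fin n, Fin b → Ω → Ξ i}

lemma pastSigma_mono {s t : ℕ} (h : s ≤ t) : pastSigma ξ s ≤ pastSigma ξ t :=
  biSup_mono fun _ hk => lt_of_lt_of_le hk h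

lemma pastSigma_le_othersSigma (t : ℕ) (i : Fin n) (j : Fin b) :
    pastSigma ξ t ≤ othersSigma ξ t i j :=
  biSup_mono fun k (hk : k.1 < t) => ⟨hk.le, fun h => by rw [h] at hk; exact lt_irrefl t hk⟩

lemma measurable_sample_pastSigma (t : ℕ) (i : Fin n) (j : Fin b) :
    Measurable[pastSigma ξ (t + 1)] (ξ t i j) := by
  refine measurable_iff_comap_le.2 ?_
  exact le_biSup (fun k : ℕ × Fin n × Fin b =>
    MeasurableSpace.comap (fun ω => ξ k.1 k.2.1 k.2.2 ω) inferInstance)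
    (show (t, i, j) ∈ {k : ℕ × Fin n × Fin b | k.1 < t + 1} from Nat.lt_succ_self t)

lemma measurable_sample_othersSigma (t : ℕ) {i i' : Fin n} {j j' : Fin b}
    (h : (i, j) ≠ (i', j')) : Measurable[othersSigma ξ t i' j'] (ξ t i j) := by
  refine measurable_iff_comap_le.2 ?_
  exact le_biSup (fun k : ℕ × Fin n × Fin b =>
    MeasurableSpace.comap (fun ω => ξ k.1 k.2.1 k.2.2 ω) inferInstance)
    (show (t, i, j) ∈ {k : ℕ × Fin n × Fin b | k.1 ≤ t ∧ k ≠ (t, i', j')} from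
      ⟨le_rfl, fun he => h (Prod.mk.inj he).2⟩)

variable [mΩ : MeasurableSpace Ω]

lemma pastSigma_le (hξ : ∀ t i j, Measurable (ξ t i j)) (t : ℕ) : pastSigma ξ t ≤ mΩ :=
  iSup₂_le fun _ _ => (hξ _ _ _).comap_le

lemma othersSigma_le (hξ : ∀ t i j, Measurable (ξ t i j)) (t : ℕ) (i : Fin n) (j : Fin b) :
    othersSigma ξ t i j ≤ mΩ :=
  iSup₂_le fun _ _ => (hξ _ _ _).comap_le

/-- Conditioning on everything but one sample serves two purposes at once: that sample's noise is
orthogonal to the past, and also to the other samples of the same iteration. -/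
lemma indep_othersSigma {P : Measure Ω} (hξ : ∀ t i j, Measurable (ξ t i j))
    (hind : iIndepFun (fun (k : ℕ × Fin n × Fin b) ω => ξ k.1 k.2.1 k.2.2 ω) P)
    (t : ℕ) (i : Fin n) (j : Fin b) :
    Indep (othersSigma ξ t i j) (MeasurableSpace.comap (ξ t i j) inferInstance) P := by
  have h := indep_iSup_of_disjoint (m := fun k : ℕ × Fin n × Fin b =>
    MeasurableSpace.comap (fun ω => ξ k.1 k.2.1 k.2.2 ω) inferInstance)
    (fun k => (hξ _ _ _).comap_le) hind.iIndep
    (S := {k | k.1 ≤ t ∧ k ≠ (t, i, j)}) (T := {(t, i, j)})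
    (Set.disjoint_singleton_right.2 fun h => h.2 rfl)
  rw [iSup_singleton] at h
  exact h

end Samples

/-! ### Measurability of the gradient field. -/

section Oracle

variable {d m : ℕ} {L μ D : ℝ} {Y : Set (EuclideanSpace ℝ (Fin m))}
  {f : JointSpace d m → ℝ} {f' : JointSpace d m → JointSpace d m}

open Classical in
/-- The gradient, extended by zero outside `ℝ^d × Y`. -/
noncomputable def extendedGrad (Y : Set (EuclideanSpace ℝ (Fin m)))
    (f' : JointSpace d m → JointSpace d m) : JointSpace d m → JointSpace d m :=
  fun q => if q.snd ∈ Y then f' q else 0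

lemma extendedGrad_of_mem {q : JointSpace d m} (hq : q.snd ∈ Y) : extendedGrad Y f' q = f' q :=
  if_pos hq

lemma extendedGrad_of_notMem {q : JointSpace d m} (hq : q.snd ∉ Y) : extendedGrad Y f' q = 0 :=
  if_neg hq

lemma continuous_snd_jointSpace : Continuous fun q : JointSpace d m => q.snd :=
  WithLp.prod_continuous_ofLp 2 _ _ |>.snd

lemma measurableSet_snd_mem (hY : ConstraintAssumption D Y) :
    MeasurableSet {q : JointSpace d m | q.snd ∈ Y} :=
  (hY.compact.isClosed.preimage continuous_snd_jointSpace).measurableSet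

lemma SmoothStronglyConcave.norm_grad_sub_le (hf : SmoothStronglyConcave L μ Y f f') (hL : 0 ≤ L)
    {p q : JointSpace d m} (hp : p.snd ∈ Y) (hq : q.snd ∈ Y) :
    ‖f' p - f' q‖ ≤ 2 * L * ‖p - q‖ := by
  have h1 := hf.smooth p q hp hq
  have h2 : ‖p.fst - q.fst‖ ≤ ‖p - q‖ := norm_fst_le_norm (p - q)
  have h3 : ‖p.snd - q.snd‖ ≤ ‖p - q‖ := norm_snd_le_norm (p - q)
  nlinarith

/-- Outside $\mathbb R^d\times Y$ the field `f'` is arbitrary and may fail to be measurable. The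
extension by zero is piecewise continuous over a closed set. -/
lemma SmoothStronglyConcave.measurable_extendedGrad (hf : SmoothStronglyConcave L μ Y f f')
    (hL : 0 ≤ L) (hY : ConstraintAssumption D Y) : Measurable (extendedGrad Y f') := by
  classical
  have hc : ContinuousOn f' {q | q.snd ∈ Y} :=
    LipschitzOnWith.continuousOn (K := ⟨2 * L, by positivity⟩) <|
      LipschitzOnWith.of_dist_le_mul fun p hp q hq => by
        rw [dist_eq_norm, dist_eq_norm]
        exact hf.norm_grad_sub_le hL hp hq
  exact hc.measurable_piecewise continuousOn_const (measurableSet_snd_mem hY)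

lemma SmoothStronglyConcave.norm_extendedGrad_le (hf : SmoothStronglyConcave L μ Y f f')
    (hL : 0 ≤ L) {p : JointSpace d m} (hp : p.snd ∈ Y) (q : JointSpace d m) :
    ‖extendedGrad Y f' q‖ ≤ (‖f' p‖ + 2 * L * ‖p‖) + 2 * L * ‖q‖ := by
  by_cases hq : q.snd ∈ Y
  · rw [extendedGrad_of_mem hq]
    have h1 := hf.norm_grad_sub_le hL hq hp
    have h2 := norm_le_insert' (f' q) (f' p)
    have h3 : 2 * L * ‖q - p‖ ≤ 2 * L * (‖q‖ + ‖p‖) := by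
      gcongr
      exact norm_sub_le q p
    linarith
  · rw [extendedGrad_of_notMem hq, norm_zero]
    positivity

end Oracle

/-! ### The algorithm in terms of exact gradients and noise. -/

section Dynamics

variable {n d b : ℕ} {m : Fin n → ℕ} {Ω : Type*} {Ξ : Fin n → Type*}
  [∀ i, MeasurableSpace (Ξ i)]

/-- The DSGTA iterates as random variables. -/
noncomputable def dsgtaPath (W : Matrix (Fin n) (Fin n) ℝ) (ηx ηy : ℝ)
    (Y : ∀ i, Set (EuclideanSpace ℝ (Fin (m i))))
    (h : ∀ i, JointSpace d (m i) → Ξ i → JointSpace d (m i))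
    (x0 : Fin n → EuclideanSpace ℝ (Fin d)) (y0 : ∀ i, EuclideanSpace ℝ (Fin (m i)))
    (ξ : ℕ → ∀ i : Fin n, Fin b → Ω → Ξ i) (t : ℕ) (ω : Ω) : AgentState n d m :=
  dsgta W ηx ηy Y h x0 y0 (fun t i j => ξ t i j ω) t

/-- The error of a single stochastic gradient. -/
noncomputable def sampleNoise (W : Matrix (Fin n) (Fin n) ℝ) (ηx ηy : ℝ)
    (Y : ∀ i, Set (EuclideanSpace ℝ (Fin (m i))))
    (f' : ∀ i, JointSpace d (m i) → JointSpace d (m i))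
    (h : ∀ i, JointSpace d (m i) → Ξ i → JointSpace d (m i))
    (x0 : Fin n → EuclideanSpace ℝ (Fin d)) (y0 : ∀ i, EuclideanSpace ℝ (Fin (m i)))
    (ξ : ℕ → ∀ i : Fin n, Fin b → Ω → Ξ i) (t : ℕ) (i : Fin n) (j : Fin b) (ω : Ω) :
    JointSpace d (m i) :=
  h i ((dsgtaPath W ηx ηy Y h x0 y0 ξ t ω).point i) (ξ t i j ω) -
    extendedGrad (Y i) (f' i) ((dsgtaPath W ηx ηy Y h x0 y0 ξ t ω).point i)

/-- The errors of the mini-batch gradients. -/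
noncomputable def batchNoise (W : Matrix (Fin n) (Fin n) ℝ) (ηx ηy : ℝ)
    (Y : ∀ i, Set (EuclideanSpace ℝ (Fin (m i))))
    (f' : ∀ i, JointSpace d (m i) → JointSpace d (m i))
    (h : ∀ i, JointSpace d (m i) → Ξ i → JointSpace d (m i))
    (x0 : Fin n → EuclideanSpace ℝ (Fin d)) (y0 : ∀ i, EuclideanSpace ℝ (Fin (m i)))
    (ξ : ℕ → ∀ i : Fin n, Fin b → Ω → Ξ i) (t : ℕ) (ω : Ω) (i : Fin n) : JointSpace d (m i) :=
  (1 / (b : ℝ)) • ∑ j, sampleNoise W ηx ηy Y f' h x0 y0 ξ t i j ω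

variable {W : Matrix (Fin n) (Fin n) ℝ} {G : SimpleGraph (Fin n)} {L μ D σ ηx ηy : ℝ}
  {Y : ∀ i, Set (EuclideanSpace ℝ (Fin (m i)))}
  {f : ∀ i, JointSpace d (m i) → ℝ} {f' : ∀ i, JointSpace d (m i) → JointSpace d (m i)}
  {h : ∀ i, JointSpace d (m i) → Ξ i → JointSpace d (m i)}
  {x0 : Fin n → EuclideanSpace ℝ (Fin d)} {y0 : ∀ i, EuclideanSpace ℝ (Fin (m i))}
  {ξ : ℕ → ∀ i : Fin n, Fin b → Ω → Ξ i}

lemma dsgtaPath_y_mem (hY : ∀ i, ConstraintAssumption D (Y i)) (hy0 : ∀ i, y0 i ∈ Y i)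
    (t : ℕ) (ω : Ω) (i : Fin n) : (dsgtaPath W ηx ηy Y h x0 y0 ξ t ω).y i ∈ Y i := by
  cases t with
  | zero => exact hy0 i
  | succ t => exact (proj_spec (hY i).nonempty (hY i).compact _).1

/-- The iterates $y_i$ never leave $\mathcal Y_i$, so the extended gradient in the definition of the
noise is the true one. -/
lemma miniBatch_eq (hb : 1 ≤ b) (hY : ∀ i, ConstraintAssumption D (Y i))
    (hy0 : ∀ i, y0 i ∈ Y i) (t : ℕ) (ω : Ω) (i : Fin n) :
    miniBatch (h i) ((dsgtaPath W ηx ηy Y h x0 y0 ξ t ω).point i) (fun j => ξ t i j ω) =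
      f' i ((dsgtaPath W ηx ηy Y h x0 y0 ξ t ω).point i) +
        batchNoise W ηx ηy Y f' h x0 y0 ξ t ω i := by
  have hb' : (b : ℝ) ≠ 0 := by positivity
  have hmem : ((dsgtaPath W ηx ηy Y h x0 y0 ξ t ω).point i).snd ∈ Y i :=
    dsgtaPath_y_mem hY hy0 t ω i
  simp only [batchNoise, sampleNoise, miniBatch, extendedGrad_of_mem hmem, Finset.sum_sub_distrib,
    smul_sub, Finset.sum_const, Finset.card_univ, Fintype.card_fin]
  rw [← Nat.cast_smul_eq_nsmul ℝ, smul_smul, one_div, inv_mul_cancel₀ hb', one_smul]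
  abel

lemma dsgtaPath_g_succ (hb : 1 ≤ b) (hY : ∀ i, ConstraintAssumption D (Y i))
    (hy0 : ∀ i, y0 i ∈ Y i) (t : ℕ) (ω : Ω) :
    (dsgtaPath W ηx ηy Y h x0 y0 ξ (t + 1) ω).g =
      mix W ((dsgtaPath W ηx ηy Y h x0 y0 ξ t ω).g +
        (gradX f' (dsgtaPath W ηx ηy Y h x0 y0 ξ (t + 1) ω).x
          (dsgtaPath W ηx ηy Y h x0 y0 ξ (t + 1) ω).y +
          fstPart (batchNoise W ηx ηy Y f' h x0 y0 ξ (t + 1) ω)) -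
        (gradX f' (dsgtaPath W ηx ηy Y h x0 y0 ξ t ω).x
          (dsgtaPath W ηx ηy Y h x0 y0 ξ t ω).y +
          fstPart (batchNoise W ηx ηy Y f' h x0 y0 ξ t ω))) := by
  ext1 i
  have e : (dsgtaPath W ηx ηy Y h x0 y0 ξ (t + 1) ω).g i =
      ∑ j, W i j • ((dsgtaPath W ηx ηy Y h x0 y0 ξ t ω).g j +
        (miniBatch (h j) ((dsgtaPath W ηx ηy Y h x0 y0 ξ (t + 1) ω).point j)
          (fun k => ξ (t + 1) j k ω)).fst -
        (miniBatch (h j) ((dsgtaPath W ηx ηy Y h x0 y0 ξ t ω).point j)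
          (fun k => ξ t j k ω)).fst) := rfl
  rw [e]
  refine Finset.sum_congr rfl fun j _ => ?_
  rw [miniBatch_eq (f' := f') hb hY hy0 (t + 1) ω j, miniBatch_eq (f' := f') hb hY hy0 t ω j]
  rfl

/-- The tracking property: the average tracker is the average stochastic gradient. -/
lemma agentAvg_dsgtaPath_g (hb : 1 ≤ b) (hW : NetworkAssumption G W)
    (hY : ∀ i, ConstraintAssumption D (Y i)) (hy0 : ∀ i, y0 i ∈ Y i) (t : ℕ) (ω : Ω) :
    agentAvg (dsgtaPath W ηx ηy Y h x0 y0 ξ t ω).g =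
      agentAvg (gradX f' (dsgtaPath W ηx ηy Y h x0 y0 ξ t ω).x
        (dsgtaPath W ηx ηy Y h x0 y0 ξ t ω).y +
        fstPart (batchNoise W ηx ηy Y f' h x0 y0 ξ t ω)) := by
  induction t with
  | zero =>
    congr 1
    ext1 i
    exact congrArg WithLp.fst (miniBatch_eq hb hY hy0 0 ω i)
  | succ t ih =>
    rw [dsgtaPath_g_succ (f' := f') hb hY hy0, agentAvg_mix hW, agentAvg_sub, agentAvg_add, ih]
    abel

lemma dsgtaTransition (hb : 1 ≤ b) (hW : NetworkAssumption G W)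
    (hY : ∀ i, ConstraintAssumption D (Y i)) (hy0 : ∀ i, y0 i ∈ Y i) (t : ℕ) (ω : Ω) :
    DsgtaTransition W ηx ηy Y f' (dsgtaPath W ηx ηy Y h x0 y0 ξ t ω).x
      (dsgtaPath W ηx ηy Y h x0 y0 ξ t ω).y (dsgtaPath W ηx ηy Y h x0 y0 ξ t ω).g
      (batchNoise W ηx ηy Y f' h x0 y0 ξ t ω) (dsgtaPath W ηx ηy Y h x0 y0 ξ (t + 1) ω).x
      (dsgtaPath W ηx ηy Y h x0 y0 ξ (t + 1) ω).y (dsgtaPath W ηx ηy Y h x0 y0 ξ (t + 1) ω).g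
      (batchNoise W ηx ηy Y f' h x0 y0 ξ (t + 1) ω) where
  x_eq := by
    funext i
    rfl
  y_eq i := by
    have e := miniBatch_eq (W := W) (ηx := ηx) (ηy := ηy) (f' := f') (h := h) (x0 := x0) (ξ := ξ)
      hb hY hy0 t ω i
    have e2 : (dsgtaPath W ηx ηy Y h x0 y0 ξ (t + 1) ω).y i =
        proj (Y i) ((dsgtaPath W ηx ηy Y h x0 y0 ξ t ω).y i + ηy •
          (miniBatch (h i) ((dsgtaPath W ηx ηy Y h x0 y0 ξ t ω).point i)
            (fun j => ξ t i j ω)).snd) := rfl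
    rw [e2, e]
    rfl
  g_eq := dsgtaPath_g_succ hb hY hy0 t ω
  avg_eq := agentAvg_dsgtaPath_g hb hW hY hy0 t ω

end Dynamics

/-! ### Square integrability of components and pairs. -/

namespace SqIntegrableWrt

variable {Ω : Type*} {d k : ℕ} {m : MeasurableSpace Ω} [mΩ : MeasurableSpace Ω] {P : Measure Ω}
  [IsFiniteMeasure P]

lemma fst (hm : m ≤ mΩ) {u : Ω → JointSpace d k} (hu : SqIntegrableWrt m P u) :
    SqIntegrableWrt m P fun ω => (u ω).fst :=
  hu.comp_of_lipschitz hm (φ := fun q : JointSpace d k => q.fst) zero_le_one fun p q => by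
    rw [one_mul]
    exact norm_fst_le_norm (p - q)

lemma snd (hm : m ≤ mΩ) {u : Ω → JointSpace d k} (hu : SqIntegrableWrt m P u) :
    SqIntegrableWrt m P fun ω => (u ω).snd :=
  hu.comp_of_lipschitz hm (φ := fun q : JointSpace d k => q.snd) zero_le_one fun p q => by
    rw [one_mul]
    exact norm_snd_le_norm (p - q)

lemma joint_zero_right (hm : m ≤ mΩ) {u : Ω → EuclideanSpace ℝ (Fin d)}
    (hu : SqIntegrableWrt m P u) :
    SqIntegrableWrt m P fun ω => (joint (u ω) 0 : JointSpace d k) :=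
  hu.comp_of_lipschitz hm (φ := fun x => (joint x 0 : JointSpace d k)) zero_le_one fun p q => by
    rw [joint_sub, sub_zero, norm_joint_zero_right, one_mul]

lemma joint_zero_left (hm : m ≤ mΩ) {u : Ω → EuclideanSpace ℝ (Fin k)}
    (hu : SqIntegrableWrt m P u) :
    SqIntegrableWrt m P fun ω => (joint 0 (u ω) : JointSpace d k) :=
  hu.comp_of_lipschitz hm (φ := fun y => (joint 0 y : JointSpace d k)) zero_le_one fun p q => by
    rw [joint_sub, sub_zero, norm_joint_zero_left, one_mul]

lemma joint (hm : m ≤ mΩ) {u : Ω → EuclideanSpace ℝ (Fin d)} {v : Ω → EuclideanSpace ℝ (Fin k)}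
    (hu : SqIntegrableWrt m P u) (hv : SqIntegrableWrt m P v) :
    SqIntegrableWrt m P fun ω => joint (u ω) (v ω) := by
  have e : (fun ω => _root_.joint (u ω) (v ω)) =
      fun ω => (_root_.joint (u ω) 0 : JointSpace d k) + _root_.joint 0 (v ω) := by
    funext ω
    refine WithLp.ofLp_injective 2 (Prod.ext ?_ ?_) <;> simp [_root_.joint]
  rw [e]
  exact (hu.joint_zero_right hm).add (hv.joint_zero_left hm)

end SqIntegrableWrt

/-! ### Moments of the noise and integrability of the iterates. -/

section Noise

variable {n d b : ℕ} {m : Fin n → ℕ} {Ω : Type*} {Ξ : Fin n → Type*}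
  [∀ i, MeasurableSpace (Ξ i)] {M : MeasurableSpace Ω} [mΩ : MeasurableSpace Ω] {P : Measure Ω} [IsProbabilityMeasure P]
  {W : Matrix (Fin n) (Fin n) ℝ} {L μ D σ ηx ηy : ℝ}
  {Y : ∀ i, Set (EuclideanSpace ℝ (Fin (m i)))}
  {f : ∀ i, JointSpace d (m i) → ℝ} {f' : ∀ i, JointSpace d (m i) → JointSpace d (m i)}
  {h : ∀ i, JointSpace d (m i) → Ξ i → JointSpace d (m i)}
  {x0 : Fin n → EuclideanSpace ℝ (Fin d)} {y0 : ∀ i, EuclideanSpace ℝ (Fin (m i))}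
  {ξ : ℕ → ∀ i : Fin n, Fin b → Ω → Ξ i}

lemma OracleAssumption.measurable_error (hh : OracleAssumption P σ Y f' h ξ)
    (hf : ∀ i, SmoothStronglyConcave L μ (Y i) (f i) (f' i)) (hL : 0 ≤ L)
    (hY : ∀ i, ConstraintAssumption D (Y i)) (i : Fin n) :
    Measurable fun q : JointSpace d (m i) × Ξ i => h i q.1 q.2 - extendedGrad (Y i) (f' i) q.1 :=
  (hh.measurable_oracle i).sub (((hf i).measurable_extendedGrad hL (hY i)).comp measurable_fst)

lemma sampleNoise_memLp (hh : OracleAssumption P σ Y f' h ξ)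
    (hf : ∀ i, SmoothStronglyConcave L μ (Y i) (f i) (f' i)) (hL : 0 ≤ L)
    (hY : ∀ i, ConstraintAssumption D (Y i)) (hy0 : ∀ i, y0 i ∈ Y i) {t : ℕ} {i : Fin n}
    (hp : SqIntegrableWrt (pastSigma ξ t) P
      fun ω => (dsgtaPath W ηx ηy Y h x0 y0 ξ t ω).point i) (j : Fin b) :
    MemLp (sampleNoise W ηx ηy Y f' h x0 y0 ξ t i j) 2 P ∧
      ∫ ω, ‖sampleNoise W ηx ηy Y f' h x0 y0 ξ t i j ω‖ ^ 2 ∂P ≤ σ ^ 2 :=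
  memLp_two_of_indep (S := {q | q.snd ∈ Y i})
    (F := fun q => h i q.1 q.2 - extendedGrad (Y i) (f' i) q.1)
    (othersSigma_le hh.measurable_sample t i j) (hh.measurable_sample t i j)
    (indep_othersSigma hh.measurable_sample hh.indep t i j) (hh.measurable_error hf hL hY i)
    (hp.measurable.mono (pastSigma_le_othersSigma t i j) le_rfl)
    (fun ω => dsgtaPath_y_mem hY hy0 t ω i)
    (fun q hq => by
      simp only [extendedGrad_of_mem (show q.snd ∈ Y i from hq)]
      exact hh.integrable_sq t i j q hq)
    (fun q hq => by
      simp only [extendedGrad_of_mem (show q.snd ∈ Y i from hq)]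
      exact hh.variance_le t i j q hq)

lemma integral_inner_sampleNoise (hh : OracleAssumption P σ Y f' h ξ)
    (hf : ∀ i, SmoothStronglyConcave L μ (Y i) (f i) (f' i)) (hL : 0 ≤ L)
    (hY : ∀ i, ConstraintAssumption D (Y i)) (hy0 : ∀ i, y0 i ∈ Y i) {t : ℕ} {i : Fin n}
    (hp : SqIntegrableWrt (pastSigma ξ t) P
      fun ω => (dsgtaPath W ηx ηy Y h x0 y0 ξ t ω).point i) (j : Fin b)
    {A : Ω → JointSpace d (m i)} (hA : SqIntegrableWrt (othersSigma ξ t i j) P A) :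
    ∫ ω, inner ℝ (A ω) (sampleNoise W ηx ηy Y f' h x0 y0 ξ t i j ω) ∂P = 0 :=
  integral_inner_eq_zero_of_indep (S := {q | q.snd ∈ Y i})
    (F := fun q => h i q.1 q.2 - extendedGrad (Y i) (f' i) q.1)
    (othersSigma_le hh.measurable_sample t i j) (hh.measurable_sample t i j)
    (indep_othersSigma hh.measurable_sample hh.indep t i j) (hh.measurable_error hf hL hY i)
    (hp.measurable.mono (pastSigma_le_othersSigma t i j) le_rfl)
    (fun ω => dsgtaPath_y_mem hY hy0 t ω i)
    (fun q hq => (hh.integrable t i j q hq).sub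
      (integrable_const (extendedGrad (Y i) (f' i) q)))
    (fun q hq => by
      simp only [extendedGrad_of_mem (show q.snd ∈ Y i from hq)]
      rw [integral_sub (hh.integrable t i j q hq) (integrable_const _),
        hh.unbiased t i j q hq]
      simp)
    (sampleNoise_memLp hh hf hL hY hy0 hp j).1 hA.measurable hA.memLp

lemma measurable_sampleNoise (hh : OracleAssumption P σ Y f' h ξ)
    (hf : ∀ i, SmoothStronglyConcave L μ (Y i) (f i) (f' i)) (hL : 0 ≤ L)
    (hY : ∀ i, ConstraintAssumption D (Y i)) {t : ℕ} {i : Fin n} {j : Fin b}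
    (hp : Measurable[M] fun ω => (dsgtaPath W ηx ηy Y h x0 y0 ξ t ω).point i)
    (hξ : Measurable[M] (ξ t i j)) :
    Measurable[M] (sampleNoise W ηx ηy Y f' h x0 y0 ξ t i j) :=
  (hh.measurable_error hf hL hY i).comp (hp.prodMk hξ)

lemma sqIntegrable_sampleNoise (hh : OracleAssumption P σ Y f' h ξ)
    (hf : ∀ i, SmoothStronglyConcave L μ (Y i) (f i) (f' i)) (hL : 0 ≤ L)
    (hY : ∀ i, ConstraintAssumption D (Y i)) (hy0 : ∀ i, y0 i ∈ Y i) {t : ℕ} {i : Fin n}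
    (hp : SqIntegrableWrt (pastSigma ξ t) P
      fun ω => (dsgtaPath W ηx ηy Y h x0 y0 ξ t ω).point i) (j : Fin b) :
    SqIntegrableWrt (pastSigma ξ (t + 1)) P (sampleNoise W ηx ηy Y f' h x0 y0 ξ t i j) :=
  ⟨measurable_sampleNoise hh hf hL hY
    (hp.measurable.mono (pastSigma_mono (Nat.le_succ t)) le_rfl) (measurable_sample_pastSigma t i j),
    (sampleNoise_memLp hh hf hL hY hy0 hp j).1⟩

lemma sqIntegrable_batchNoise (hh : OracleAssumption P σ Y f' h ξ)
    (hf : ∀ i, SmoothStronglyConcave L μ (Y i) (f i) (f' i)) (hL : 0 ≤ L)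
    (hY : ∀ i, ConstraintAssumption D (Y i)) (hy0 : ∀ i, y0 i ∈ Y i) {t : ℕ} {i : Fin n}
    (hp : SqIntegrableWrt (pastSigma ξ t) P
      fun ω => (dsgtaPath W ηx ηy Y h x0 y0 ξ t ω).point i) :
    SqIntegrableWrt (pastSigma ξ (t + 1)) P
      fun ω => batchNoise W ηx ηy Y f' h x0 y0 ξ t ω i :=
  (SqIntegrableWrt.sum _ fun j => sqIntegrable_sampleNoise hh hf hL hY hy0 hp j).const_smul _

lemma sqIntegrable_gradient (hh : OracleAssumption P σ Y f' h ξ)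
    (hf : ∀ i, SmoothStronglyConcave L μ (Y i) (f i) (f' i)) (hL : 0 ≤ L)
    (hY : ∀ i, ConstraintAssumption D (Y i)) (hy0 : ∀ i, y0 i ∈ Y i) {t : ℕ} {i : Fin n}
    (hp : SqIntegrableWrt (pastSigma ξ t) P
      fun ω => (dsgtaPath W ηx ηy Y h x0 y0 ξ t ω).point i) :
    SqIntegrableWrt (pastSigma ξ t) P
      fun ω => f' i ((dsgtaPath W ηx ηy Y h x0 y0 ξ t ω).point i) := by
  have e : (fun ω => f' i ((dsgtaPath W ηx ηy Y h x0 y0 ξ t ω).point i)) =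
      fun ω => extendedGrad (Y i) (f' i) ((dsgtaPath W ηx ηy Y h x0 y0 ξ t ω).point i) :=
    funext fun ω => (extendedGrad_of_mem (dsgtaPath_y_mem hY hy0 t ω i)).symm
  rw [e]
  exact hp.comp_of_norm_le (pastSigma_le hh.measurable_sample t)
    ((hf i).measurable_extendedGrad hL (hY i))
    ((hf i).norm_extendedGrad_le hL (p := joint (x0 i) (y0 i)) (hy0 i))

/-- The iterates are square integrable and depend on the samples drawn before only. -/
theorem sqIntegrable_dsgtaPath (hb : 1 ≤ b) (hh : OracleAssumption P σ Y f' h ξ)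
    (hf : ∀ i, SmoothStronglyConcave L μ (Y i) (f i) (f' i)) (hL : 0 ≤ L)
    (hY : ∀ i, ConstraintAssumption D (Y i)) (hy0 : ∀ i, y0 i ∈ Y i) (t : ℕ) :
    (∀ i, SqIntegrableWrt (pastSigma ξ t) P fun ω => (dsgtaPath W ηx ηy Y h x0 y0 ξ t ω).x i) ∧
    (∀ i, SqIntegrableWrt (pastSigma ξ t) P fun ω => (dsgtaPath W ηx ηy Y h x0 y0 ξ t ω).y i) ∧
    (∀ i, SqIntegrableWrt (pastSigma ξ t) P
      fun ω => (dsgtaPath W ηx ηy Y h x0 y0 ξ t ω).point i) ∧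
    ∀ i, SqIntegrableWrt (pastSigma ξ (t + 1)) P
      fun ω => (dsgtaPath W ηx ηy Y h x0 y0 ξ t ω).g i := by
  have hle := pastSigma_le hh.measurable_sample
  induction t with
  | zero =>
    have hp : ∀ i, SqIntegrableWrt (pastSigma ξ 0) P
        fun ω => (dsgtaPath W ηx ηy Y h x0 y0 ξ 0 ω).point i := fun i =>
      SqIntegrableWrt.const (joint (x0 i) (y0 i))
    refine ⟨fun i => SqIntegrableWrt.const (x0 i), fun i => SqIntegrableWrt.const (y0 i), hp,
      fun i => ?_⟩
    have e : (fun ω => (dsgtaPath W ηx ηy Y h x0 y0 ξ 0 ω).g i) = fun ω =>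
        (f' i ((dsgtaPath W ηx ηy Y h x0 y0 ξ 0 ω).point i) +
          batchNoise W ηx ηy Y f' h x0 y0 ξ 0 ω i).fst :=
      funext fun ω => congrArg WithLp.fst (miniBatch_eq hb hY hy0 0 ω i)
    rw [e]
    exact (((sqIntegrable_gradient hh hf hL hY hy0 (hp i)).mono (pastSigma_mono zero_le_one)).add
      (sqIntegrable_batchNoise hh hf hL hY hy0 (hp i))).fst (hle 1)
  | succ t ih =>
    obtain ⟨hx, hy, hp, hg⟩ := ih
    have hmono : pastSigma ξ t ≤ pastSigma ξ (t + 1) := pastSigma_mono (Nat.le_succ t)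
    have hmono' : pastSigma ξ (t + 1) ≤ pastSigma ξ (t + 1 + 1) := pastSigma_mono (Nat.le_succ _)
    have hG := fun i => ((sqIntegrable_gradient hh hf hL hY hy0 (hp i)).mono hmono).add
      (sqIntegrable_batchNoise hh hf hL hY hy0 (hp i))
    -- Time shift: $g^t$ already contains the batch of iteration $t$, so it is measurable one
    -- σ-algebra later than $x^t,y^t$; the update brings $x^{t+1}$ to that level.
    have hx' : ∀ i, SqIntegrableWrt (pastSigma ξ (t + 1)) P
        fun ω => (dsgtaPath W ηx ηy Y h x0 y0 ξ (t + 1) ω).x i := fun i =>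
      SqIntegrableWrt.mix (fun j => ((hx j).mono hmono).sub ((hg j).const_smul ηx)) i
    have hy' : ∀ i, SqIntegrableWrt (pastSigma ξ (t + 1)) P
        fun ω => (dsgtaPath W ηx ηy Y h x0 y0 ξ (t + 1) ω).y i := fun i => by
      have e : (fun ω => (dsgtaPath W ηx ηy Y h x0 y0 ξ (t + 1) ω).y i) = fun ω =>
          proj (Y i) ((dsgtaPath W ηx ηy Y h x0 y0 ξ t ω).y i + ηy •
            (f' i ((dsgtaPath W ηx ηy Y h x0 y0 ξ t ω).point i) +
              batchNoise W ηx ηy Y f' h x0 y0 ξ t ω i).snd) := by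
        funext ω
        rw [← miniBatch_eq hb hY hy0 t ω i]
        rfl
      rw [e]
      refine (((hy i).mono hmono).add (((hG i).snd (hle _)).const_smul ηy)).comp_of_lipschitz
        (hle _) zero_le_one fun u v => ?_
      rw [one_mul]
      exact norm_proj_sub_proj_le (hY i).nonempty (hY i).compact (hY i).convex u v
    have hp' : ∀ i, SqIntegrableWrt (pastSigma ξ (t + 1)) P
        fun ω => (dsgtaPath W ηx ηy Y h x0 y0 ξ (t + 1) ω).point i := fun i =>
      (hx' i).joint (hle _) (hy' i)
    have hG' := fun i => ((sqIntegrable_gradient hh hf hL hY hy0 (hp' i)).mono hmono').add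
      (sqIntegrable_batchNoise hh hf hL hY hy0 (hp' i))
    refine ⟨hx', hy', hp', fun i => ?_⟩
    have e : (fun ω => (dsgtaPath W ηx ηy Y h x0 y0 ξ (t + 1) ω).g i) = fun ω =>
        mix W ((dsgtaPath W ηx ηy Y h x0 y0 ξ t ω).g +
        (gradX f' (dsgtaPath W ηx ηy Y h x0 y0 ξ (t + 1) ω).x
          (dsgtaPath W ηx ηy Y h x0 y0 ξ (t + 1) ω).y +
          fstPart (batchNoise W ηx ηy Y f' h x0 y0 ξ (t + 1) ω)) -
        (gradX f' (dsgtaPath W ηx ηy Y h x0 y0 ξ t ω).x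
          (dsgtaPath W ηx ηy Y h x0 y0 ξ t ω).y +
          fstPart (batchNoise W ηx ηy Y f' h x0 y0 ξ t ω))) i :=
      funext fun ω => congrFun (dsgtaPath_g_succ hb hY hy0 t ω) i
    rw [e]
    exact SqIntegrableWrt.mix (fun j => (((hg j).mono hmono').add ((hG' j).fst (hle _))).sub
      (((hG j).fst (hle _)).mono hmono')) i

lemma integral_inner_batchNoise (hb : 1 ≤ b) (hh : OracleAssumption P σ Y f' h ξ)
    (hf : ∀ i, SmoothStronglyConcave L μ (Y i) (f i) (f' i)) (hL : 0 ≤ L)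
    (hY : ∀ i, ConstraintAssumption D (Y i)) (hy0 : ∀ i, y0 i ∈ Y i) (t : ℕ) (i : Fin n)
    {A : Ω → JointSpace d (m i)} (hA : SqIntegrableWrt (pastSigma ξ t) P A) :
    ∫ ω, inner ℝ (A ω) (batchNoise W ηx ηy Y f' h x0 y0 ξ t ω i) ∂P = 0 := by
  have hp := (sqIntegrable_dsgtaPath (W := W) (ηx := ηx) (ηy := ηy) (x0 := x0)
    hb hh hf hL hY hy0 t).2.2.1 i
  simp only [batchNoise, inner_smul_right, inner_sum]
  rw [integral_const_mul, integral_finsetSum _ fun j _ => hA.memLp.integrable_real_inner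
    (sampleNoise_memLp hh hf hL hY hy0 hp j).1]
  rw [Finset.sum_eq_zero fun j _ => integral_inner_sampleNoise hh hf hL hY hy0 hp j
    (hA.mono (pastSigma_le_othersSigma t i j)), mul_zero]

/-- The $b$ sample errors of one agent are pairwise orthogonal: error `j` is measurable with respect
to all samples other than `j'`. -/
lemma integral_norm_batchNoise_sq_le (hb : 1 ≤ b) (hh : OracleAssumption P σ Y f' h ξ)
    (hf : ∀ i, SmoothStronglyConcave L μ (Y i) (f i) (f' i)) (hL : 0 ≤ L)
    (hY : ∀ i, ConstraintAssumption D (Y i)) (hy0 : ∀ i, y0 i ∈ Y i) (t : ℕ) (i : Fin n) :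
    ∫ ω, ‖batchNoise W ηx ηy Y f' h x0 y0 ξ t ω i‖ ^ 2 ∂P ≤ σ ^ 2 / b := by
  have hb' : (0 : ℝ) < b := by exact_mod_cast hb
  have hp := (sqIntegrable_dsgtaPath (W := W) (ηx := ηx) (ηy := ηy) (x0 := x0)
    hb hh hf hL hY hy0 t).2.2.1 i
  have hmem := fun j => sampleNoise_memLp hh hf hL hY hy0 hp j
  have hs := integral_norm_sum_sq_le (fun j => (hmem j).1) (fun j j' hjj' =>
    integral_inner_sampleNoise hh hf hL hY hy0 hp j' (A := sampleNoise W ηx ηy Y f' h x0 y0 ξ t i j)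
      ⟨measurable_sampleNoise hh hf hL hY
        (hp.measurable.mono (pastSigma_le_othersSigma t i j') le_rfl)
        (measurable_sample_othersSigma t fun he => hjj' (Prod.mk.inj he).2), (hmem j).1⟩)
    (fun j => (hmem j).2)
  simp only [batchNoise, norm_smul, mul_pow, Real.norm_eq_abs, sq_abs]
  rw [integral_const_mul]
  rw [Fintype.card_fin] at hs
  calc (1 / (b : ℝ)) ^ 2 * _ ≤ (1 / (b : ℝ)) ^ 2 * (b * σ ^ 2) := by gcongr
    _ = σ ^ 2 / b := by field_simp

lemma agentAvg_fstPart_batchNoise (t : ℕ) (ω : Ω) :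
    agentAvg (fstPart (batchNoise W ηx ηy Y f' h x0 y0 ξ t ω)) =
      (1 / (n * b : ℝ)) • ∑ k : Fin n × Fin b,
        (sampleNoise W ηx ηy Y f' h x0 y0 ξ t k.1 k.2 ω).fst := by
  have e : ∀ i, fstPart (batchNoise W ηx ηy Y f' h x0 y0 ξ t ω) i =
      (1 / (b : ℝ)) • ∑ j, (sampleNoise W ηx ηy Y f' h x0 y0 ξ t i j ω).fst := by
    intro i
    simp only [fstPart, batchNoise, WithLp.smul_fst]
    congr 1
    exact map_sum (WithLp.fstₗ 2 ℝ _ _) _ _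
  rw [agentAvg, Fintype.sum_prod_type]
  simp_rw [e, ← Finset.smul_sum, smul_smul]
  congr 1
  rw [one_div_mul_one_div]

/-- Orthogonality across agents as well as within batches: all $nb$ sample errors count, which
yields the extra factor $1/n$. -/
lemma integral_norm_agentAvg_batchNoise_sq_le (hb : 1 ≤ b) (hn : 0 < n)
    (hh : OracleAssumption P σ Y f' h ξ)
    (hf : ∀ i, SmoothStronglyConcave L μ (Y i) (f i) (f' i)) (hL : 0 ≤ L)
    (hY : ∀ i, ConstraintAssumption D (Y i)) (hy0 : ∀ i, y0 i ∈ Y i) (t : ℕ) :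
    ∫ ω, ‖agentAvg (fstPart (batchNoise W ηx ηy Y f' h x0 y0 ξ t ω))‖ ^ 2 ∂P ≤
      σ ^ 2 / (n * b) := by
  have hb' : (0 : ℝ) < b := by exact_mod_cast hb
  have hn' : (0 : ℝ) < n := by exact_mod_cast hn
  have hp := (sqIntegrable_dsgtaPath (W := W) (ηx := ηx) (ηy := ηy) (x0 := x0)
    hb hh hf hL hY hy0 t).2.2.1
  have hmem := fun i j => sampleNoise_memLp hh hf hL hY hy0 (hp i) j
  have hfst := fun i j =>
    (sqIntegrable_sampleNoise hh hf hL hY hy0 (hp i) j).fst (pastSigma_le hh.measurable_sample _)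
  have hs := integral_norm_sum_sq_le (P := P) (s := σ ^ 2)
    (u := fun (k : Fin n × Fin b) ω => (sampleNoise W ηx ηy Y f' h x0 y0 ξ t k.1 k.2 ω).fst)
    (fun k => (hfst k.1 k.2).memLp)
    (fun k l hkl => by
      have hle := othersSigma_le hh.measurable_sample t l.1 l.2
      have hS : SqIntegrableWrt (othersSigma ξ t l.1 l.2) P
          (sampleNoise W ηx ηy Y f' h x0 y0 ξ t k.1 k.2) :=
        ⟨measurable_sampleNoise hh hf hL hY
          ((hp k.1).measurable.mono (pastSigma_le_othersSigma t l.1 l.2) le_rfl)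
          (measurable_sample_othersSigma t hkl), (hmem k.1 k.2).1⟩
      -- Agents have $y$-spaces of different dimensions, so the $x$-part of error `k` is padded by
      -- zero to become a test vector for error `l`.
      have h0 := integral_inner_sampleNoise hh hf hL hY hy0 (hp l.1) l.2
        ((hS.fst hle).joint_zero_right hle)
      refine Eq.trans (integral_congr_ae (Filter.Eventually.of_forall fun ω => ?_)) h0
      simp only
      rw [real_inner_comm _ (joint _ _), inner_joint, inner_zero_right, add_zero, real_inner_comm])
    (fun k => by
      refine le_trans (integral_mono (hfst k.1 k.2).memLp.integrable_norm_sq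
        (hmem k.1 k.2).1.integrable_norm_sq fun ω => ?_) (hmem k.1 k.2).2
      exact pow_le_pow_left₀ (norm_nonneg _) (norm_fst_le_norm _) 2)
  simp_rw [agentAvg_fstPart_batchNoise, norm_smul, mul_pow, Real.norm_eq_abs, sq_abs]
  rw [integral_const_mul]
  rw [Fintype.card_prod, Fintype.card_fin, Fintype.card_fin, Nat.cast_mul] at hs
  calc (1 / (n * b : ℝ)) ^ 2 * _ ≤ (1 / (n * b : ℝ)) ^ 2 * (n * b * σ ^ 2) := by gcongr
    _ = σ ^ 2 / (n * b) := by field_simp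

end Noise

/-! ### Arithmetic of the step size conditions. -/

lemma stepSizes_of_le {L μ κ lam ηx ηy : ℝ} (hμ : 0 < μ) (hμL : μ ≤ L) (hκ : κ = L / μ)
    (hηy_pos : 0 < ηy) (hηy : ηy ≤ √(1 - lam ^ 2) / (9 * (L + μ)))
    (hηx_pos : 0 < ηx) (hηx₁ : ηx ≤ (1 - lam ^ 2) ^ 2 / (120 * √3 * κ * L))
    (hηx₂ : ηx ≤ ηy / (8 * √6 * κ ^ 2)) : StepSizes L μ κ (1 - lam ^ 2) ηx ηy := by
  have hL : 0 < L := hμ.trans_le hμL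
  have hκ1 : 1 ≤ κ := by rw [hκ, one_le_div hμ]; exact hμL
  have hκ0 : 0 < κ := by linarith
  have hsq : 9 * (ηy * (L + μ)) ≤ √(1 - lam ^ 2) := by
    rw [le_div_iff₀ (by positivity)] at hηy
    linarith
  -- The root of a nonpositive number is zero by convention, so a positive $\eta_y$ below the bound
  -- forces $\lambda^2<1$.
  have hρ : 0 < 1 - lam ^ 2 := by
    refine Real.sqrt_pos.1 (lt_of_lt_of_le ?_ hsq)
    positivity
  have hρ1 : 1 - lam ^ 2 ≤ 1 := by nlinarith
  have h3 : √3 ^ 2 = 3 := Real.sq_sqrt (by norm_num)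
  have h6 : √6 ^ 2 = 6 := Real.sq_sqrt (by norm_num)
  -- Rational bounds behind the linear constants: $120\cdot\frac53=200$ and $8\cdot\frac{19}8=19$.
  -- The squared forms $43200=3\cdot120^2$ and $384=6\cdot8^2$ are exact.
  have h3' : 5 / 3 ≤ √3 := Real.le_sqrt_of_sq_le (by norm_num)
  have h6' : 19 / 8 ≤ √6 := Real.le_sqrt_of_sq_le (by norm_num)
  rw [le_div_iff₀ (by positivity)] at hηx₁ hηx₂
  have p1 : 0 < ηx * κ * L := by positivity
  have p2 : 0 < ηx * κ ^ 2 := by positivity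
  refine ⟨hμ, hκ1, ?_, hρ, hρ1, hηx_pos, hηy_pos, ?_, ?_, ?_, ?_, ?_⟩
  · rw [hκ, div_mul_cancel₀ _ hμ.ne']
  · exact hsq.trans (Real.sqrt_le_one.2 hρ1)
  · nlinarith
  · calc 43200 * (ηx * κ * L) ^ 2 = (ηx * (120 * √3 * κ * L)) ^ 2 := by
          linear_combination (-14400) * (ηx * κ * L) ^ 2 * h3
      _ ≤ ((1 - lam ^ 2) ^ 2) ^ 2 := pow_le_pow_left₀ (by positivity) hηx₁ 2
      _ = (1 - lam ^ 2) ^ 4 := by ring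
  · nlinarith
  · calc 384 * (ηx * κ ^ 2) ^ 2 = (ηx * (8 * √6 * κ ^ 2)) ^ 2 := by
          linear_combination (-64) * (ηx * κ ^ 2) ^ 2 * h6
      _ ≤ ηy ^ 2 := pow_le_pow_left₀ (by positivity) hηx₂ 2

/-! ### The Lyapunov inequality in expectation. -/

section Expectation

variable {n d b : ℕ} {m : Fin n → ℕ} {Ω : Type*} {Ξ : Fin n → Type*}
  [∀ i, MeasurableSpace (Ξ i)] {M : MeasurableSpace Ω} [mΩ : MeasurableSpace Ω] {P : Measure Ω}
  [IsProbabilityMeasure P] {G : SimpleGraph (Fin n)}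
  {W : Matrix (Fin n) (Fin n) ℝ} {L μ κ ρ D σ ηx ηy : ℝ}
  {Y : ∀ i, Set (EuclideanSpace ℝ (Fin (m i)))}
  {f : ∀ i, JointSpace d (m i) → ℝ} {f' : ∀ i, JointSpace d (m i) → JointSpace d (m i)}
  {h : ∀ i, JointSpace d (m i) → Ξ i → JointSpace d (m i)}
  {x0 : Fin n → EuclideanSpace ℝ (Fin d)} {y0 : ∀ i, EuclideanSpace ℝ (Fin (m i))}
  {ξ : ℕ → ∀ i : Fin n, Fin b → Ω → Ξ i}

lemma meanInner_fstPart_eq (A : Fin n → EuclideanSpace ℝ (Fin d)) (e : ∀ i, JointSpace d (m i)) :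
    meanInner A (fstPart e) = (1 / (n : ℝ)) * ∑ i, inner ℝ (joint (A i) 0) (e i) := by
  have key : ∀ i, inner ℝ (A i) (fstPart e i) = inner ℝ (joint (A i) 0) (e i) := fun i => by
    rw [real_inner_comm (e i), inner_joint, inner_zero_right, add_zero, real_inner_comm]
    rfl
  simp only [meanInner, key]

lemma meanInner_sndPart_eq (A : ∀ i, EuclideanSpace ℝ (Fin (m i))) (e : ∀ i, JointSpace d (m i)) :
    meanInner (sndPart e) A = (1 / (n : ℝ)) * ∑ i, inner ℝ (joint 0 (A i)) (e i) := by
  have key : ∀ i, inner ℝ (sndPart e i) (A i) = inner ℝ (joint 0 (A i)) (e i) := fun i => by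
    rw [real_inner_comm (e i), inner_joint, inner_zero_right, zero_add]
    rfl
  simp only [meanInner, key]

lemma integrable_meanInner_batchNoise (hb : 1 ≤ b) (hh : OracleAssumption P σ Y f' h ξ)
    (hf : ∀ i, SmoothStronglyConcave L μ (Y i) (f i) (f' i)) (hL : 0 ≤ L)
    (hY : ∀ i, ConstraintAssumption D (Y i)) (hy0 : ∀ i, y0 i ∈ Y i) (t : ℕ)
    {A : Ω → ∀ i, JointSpace d (m i)}
    (hA : ∀ i, SqIntegrableWrt (pastSigma ξ t) P fun ω => A ω i) :
    Integrable (fun ω => (1 / (n : ℝ)) *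
      ∑ i, inner ℝ (A ω i) (batchNoise W ηx ηy Y f' h x0 y0 ξ t ω i)) P ∧
    ∫ ω, (1 / (n : ℝ)) *
      ∑ i, inner ℝ (A ω i) (batchNoise W ηx ηy Y f' h x0 y0 ξ t ω i) ∂P = 0 := by
  have hp := (sqIntegrable_dsgtaPath (W := W) (ηx := ηx) (ηy := ηy) (x0 := x0)
    hb hh hf hL hY hy0 t).2.2.1
  have hI := fun i => (hA i).memLp.integrable_real_inner
    (sqIntegrable_batchNoise hh hf hL hY hy0 (hp i)).memLp
  refine ⟨(integrable_finsetSum _ fun i _ => hI i).const_mul _, ?_⟩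
  rw [integral_const_mul, integral_finsetSum _ fun i _ => hI i,
    Finset.sum_eq_zero fun i _ => integral_inner_batchNoise hb hh hf hL hY hy0 t i (hA i), mul_zero]

lemma meanInner_fstPart_batchNoise (hb : 1 ≤ b) (hh : OracleAssumption P σ Y f' h ξ)
    (hf : ∀ i, SmoothStronglyConcave L μ (Y i) (f i) (f' i)) (hL : 0 ≤ L)
    (hY : ∀ i, ConstraintAssumption D (Y i)) (hy0 : ∀ i, y0 i ∈ Y i) (t : ℕ)
    {A : Ω → Fin n → EuclideanSpace ℝ (Fin d)}
    (hA : ∀ i, SqIntegrableWrt (pastSigma ξ t) P fun ω => A ω i) :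
    Integrable (fun ω => meanInner (A ω)
      (fstPart (batchNoise W ηx ηy Y f' h x0 y0 ξ t ω))) P ∧
    ∫ ω, meanInner (A ω) (fstPart (batchNoise W ηx ηy Y f' h x0 y0 ξ t ω)) ∂P = 0 := by
  simp only [meanInner_fstPart_eq]
  exact integrable_meanInner_batchNoise (A := fun ω i => joint (A ω i) 0) hb hh hf hL hY hy0 t
    fun i => (hA i).joint_zero_right (pastSigma_le hh.measurable_sample t)

lemma meanInner_sndPart_batchNoise (hb : 1 ≤ b) (hh : OracleAssumption P σ Y f' h ξ)
    (hf : ∀ i, SmoothStronglyConcave L μ (Y i) (f i) (f' i)) (hL : 0 ≤ L)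
    (hY : ∀ i, ConstraintAssumption D (Y i)) (hy0 : ∀ i, y0 i ∈ Y i) (t : ℕ)
    {A : Ω → ∀ i, EuclideanSpace ℝ (Fin (m i))}
    (hA : ∀ i, SqIntegrableWrt (pastSigma ξ t) P fun ω => A ω i) :
    Integrable (fun ω => meanInner
      (sndPart (batchNoise W ηx ηy Y f' h x0 y0 ξ t ω)) (A ω)) P ∧
    ∫ ω, meanInner (sndPart (batchNoise W ηx ηy Y f' h x0 y0 ξ t ω)) (A ω) ∂P = 0 := by
  simp only [meanInner_sndPart_eq]
  exact integrable_meanInner_batchNoise (A := fun ω i => joint 0 (A ω i)) hb hh hf hL hY hy0 t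
    fun i => (hA i).joint_zero_left (pastSigma_le hh.measurable_sample t)

lemma integral_meanSq_batchNoise_le (hb : 1 ≤ b) (hn : 0 < n)
    (hh : OracleAssumption P σ Y f' h ξ)
    (hf : ∀ i, SmoothStronglyConcave L μ (Y i) (f i) (f' i)) (hL : 0 ≤ L)
    (hY : ∀ i, ConstraintAssumption D (Y i)) (hy0 : ∀ i, y0 i ∈ Y i) (t : ℕ) :
    Integrable (fun ω => meanSq (batchNoise W ηx ηy Y f' h x0 y0 ξ t ω)) P ∧
    ∫ ω, meanSq (batchNoise W ηx ηy Y f' h x0 y0 ξ t ω) ∂P ≤ σ ^ 2 / b := by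
  have hn' : (n : ℝ) ≠ 0 := by positivity
  have hp := (sqIntegrable_dsgtaPath (W := W) (ηx := ηx) (ηy := ηy) (x0 := x0)
    hb hh hf hL hY hy0 t).2.2.1
  have he := fun i => sqIntegrable_batchNoise hh hf hL hY hy0 (hp i)
  refine ⟨SqIntegrableWrt.integrable_meanSq he, ?_⟩
  simp only [meanSq]
  rw [integral_const_mul, integral_finsetSum _ fun i _ => (he i).memLp.integrable_norm_sq]
  calc (1 / (n : ℝ)) * _ ≤ (1 / (n : ℝ)) * ∑ i : Fin n, σ ^ 2 / b := by
        gcongr with i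
        exact integral_norm_batchNoise_sq_le hb hh hf hL hY hy0 t i
    _ = σ ^ 2 / b := by
      rw [Finset.sum_const, Finset.card_univ, Fintype.card_fin, nsmul_eq_mul]
      field_simp

lemma SqIntegrableWrt.primalGrad (hM : M ≤ mΩ) (hn : 0 < n)
    (hf : ∀ i, SmoothStronglyConcave L μ (Y i) (f i) (f' i))
    (hY : ∀ i, ConstraintAssumption D (Y i)) (hμ : 0 < μ) (hL : 0 ≤ L)
    {u : Ω → EuclideanSpace ℝ (Fin d)} (hu : SqIntegrableWrt M P u) :
    SqIntegrableWrt M P fun ω => primalGrad Y f f' (u ω) :=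
  hu.comp_of_lipschitz hM (by positivity) (norm_primalGrad_sub_le hn hf hY hμ hL)

lemma SqIntegrableWrt.responseGap (hM : M ≤ mΩ)
    (hf : ∀ i, SmoothStronglyConcave L μ (Y i) (f i) (f' i))
    (hY : ∀ i, ConstraintAssumption D (Y i)) (hμ : 0 < μ) (hL : 0 ≤ L)
    {u : Ω → EuclideanSpace ℝ (Fin d)} (hu : SqIntegrableWrt M P u)
    {v : Ω → ∀ i, EuclideanSpace ℝ (Fin (m i))} (hv : ∀ i, SqIntegrableWrt M P fun ω => v ω i)
    (i : Fin n) : SqIntegrableWrt M P fun ω => responseGap Y f (u ω) (v ω) i :=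
  (hv i).sub (hu.comp_of_lipschitz hM (by positivity)
    ((hf i).norm_bestResponse_sub_le (hY i) hμ hL))

/-- The quadratic Taylor remainder at zero gives $\Phi$ at most quadratic growth. -/
lemma integrable_primal (hn : 0 < n)
    (hf : ∀ i, SmoothStronglyConcave L μ (Y i) (f i) (f' i))
    (hY : ∀ i, ConstraintAssumption D (Y i)) (hμ : 0 < μ) (hL : 0 ≤ L)
    {u : Ω → EuclideanSpace ℝ (Fin d)} (hu : MemLp u 2 P) :
    Integrable (fun ω => primal Y f (u ω)) P := by
  have hcont : Continuous (primal Y f) := continuous_iff_continuousAt.2 fun x =>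
    (hasGradientAt_primal hn hf hY hμ hL x).differentiableAt.continuousAt
  set g := primalGrad Y f f' 0
  set K := L + L * (L / μ)
  refine ((integrable_const (|primal Y f 0| + ‖g‖ ^ 2)).add
    (hu.integrable_norm_sq.const_mul (1 + K))).mono'
    (hcont.comp_aestronglyMeasurable hu.1) (Filter.Eventually.of_forall fun ω => ?_)
  have h1 := abs_primal_sub_le hn hf hY hμ hL 0 (u ω)
  rw [sub_zero] at h1
  have h2 := abs_real_inner_le_norm g (u ω)
  have h3 : |primal Y f (u ω)| ≤ |primal Y f (u ω) - primal Y f 0 - inner ℝ g (u ω)| +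
      |primal Y f 0| + |inner ℝ g (u ω)| := by
    calc |primal Y f (u ω)| = |(primal Y f (u ω) - primal Y f 0 - inner ℝ g (u ω)) +
          primal Y f 0 + inner ℝ g (u ω)| := by congr 1; ring
      _ ≤ _ := abs_add_three _ _ _
  simp only [Real.norm_eq_abs, Pi.add_apply]
  nlinarith [sq_nonneg (‖g‖ - ‖u ω‖), sq_nonneg ‖g‖, sq_nonneg ‖u ω‖]

/-- The expected decrease of the Lyapunov function in one iteration. -/
theorem integral_lyapunov_step (hb : 1 ≤ b) (hs : StepSizes L μ κ ρ ηx ηy)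
    (hW : NetworkAssumption G W) (hρ : ρ = 1 - mixingNorm W ^ 2)
    (hf : ∀ i, SmoothStronglyConcave L μ (Y i) (f i) (f' i))
    (hY : ∀ i, ConstraintAssumption D (Y i)) (hh : OracleAssumption P σ Y f' h ξ)
    (hy0 : ∀ i, y0 i ∈ Y i) {Ψ : ℕ → Ω → ℝ} {N : ℕ → Ω → ℝ}
    (hΨ : ∀ t ω, Ψ t ω = lyapunov Y f L μ κ ρ ηx ηy (dsgtaPath W ηx ηy Y h x0 y0 ξ t ω).x
      (dsgtaPath W ηx ηy Y h x0 y0 ξ t ω).y ((dsgtaPath W ηx ηy Y h x0 y0 ξ t ω).g -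
        fstPart (batchNoise W ηx ηy Y f' h x0 y0 ξ t ω)))
    (hN : ∀ t ω, N t ω =
      ‖primalGrad Y f f' (agentAvg (dsgtaPath W ηx ηy Y h x0 y0 ξ t ω).x)‖ ^ 2) (t : ℕ) :
    Integrable (N t) P ∧ Integrable (Ψ t) P ∧
    ∫ ω, N t ω ∂P ≤ ∫ ω, Ψ t ω ∂P - ∫ ω, Ψ (t + 1) ω ∂P +
      ((162 * (κ ^ 2 * L ^ 2 * ηx ^ 2 / ρ ^ 3) + 6 * (ηy * κ * L)) * (σ ^ 2 / b) +
      1600 * (κ ^ 2 * L ^ 2 * ηx ^ 2 / ρ ^ 3) * (σ ^ 2 / b) +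
      (2 * (ηx * L * κ) + 24 * (L ^ 2 * κ ^ 2 * ηx ^ 2 / (ηy * μ) ^ 2) + ηy * κ * L) *
        (σ ^ 2 / (n * b))) := by
  have hn := hW.pos
  have hμ := hs.mu_pos
  have hL := hs.L_pos
  have hρ0 := hs.rho_pos
  have hηx := hs.etax_pos
  have hηy := hs.etay_pos
  have hκ : 0 < κ := by linarith [hs.one_le_kappa]
  have hle := pastSigma_le hh.measurable_sample
  have hS := sqIntegrable_dsgtaPath (W := W) (ηx := ηx) (ηy := ηy) (x0 := x0)
    hb hh hf hL.le hY hy0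
  have hmono : ∀ t, pastSigma ξ t ≤ pastSigma ξ (t + 1) := fun t => pastSigma_mono (Nat.le_succ t)
  have hx := fun t => (hS t).1
  have hy := fun t => (hS t).2.1
  have hp := fun t => (hS t).2.2.1
  have hg := fun t => (hS t).2.2.2
  have he := fun t i => (sqIntegrable_batchNoise hh hf hL.le hY hy0 (hp t i)).fst (hle (t + 1))
  have hr : ∀ t i, SqIntegrableWrt (pastSigma ξ (t + 1)) P fun ω =>
      ((dsgtaPath W ηx ηy Y h x0 y0 ξ t ω).g -
        fstPart (batchNoise W ηx ηy Y f' h x0 y0 ξ t ω)) i := fun t i => (hg t i).sub (he t i)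
  have hX := fun t => SqIntegrableWrt.agentAvg (hx t)
  have hG := fun t => (hX t).primalGrad (hle t) hn hf hY hμ hL.le
  have hgap := fun t i => (hX t).responseGap (hle t) hf hY hμ hL.le (hy t) i
  have hNI : ∀ t, Integrable (N t) P := fun t => by
    rw [show N t = _ from funext (hN t)]
    exact (hG t).memLp.integrable_norm_sq
  have hΨI : ∀ t, Integrable (Ψ t) P := fun t => by
    rw [show Ψ t = _ from funext (hΨ t)]
    exact ((((integrable_primal hn hf hY hμ hL.le (hX t).memLp).const_mul _).add
      ((SqIntegrableWrt.integrable_meanSq (SqIntegrableWrt.deviation (hx t))).const_mul _)).add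
      ((SqIntegrableWrt.integrable_meanSq (SqIntegrableWrt.deviation (hr t))).const_mul _)).add
      ((SqIntegrableWrt.integrable_meanSq (hgap t)).const_mul _)
  refine ⟨hNI t, hΨI t, ?_⟩
  obtain ⟨i1, z1⟩ := meanInner_fstPart_batchNoise (W := W) (ηx := ηx) (ηy := ηy) (x0 := x0)
    hb hh hf hL.le hY hy0 t
    (A := fun ω _ => primalGrad Y f f' (agentAvg (dsgtaPath W ηx ηy Y h x0 y0 ξ t ω).x))
    fun _ => hG t
  obtain ⟨i2, z2⟩ := meanInner_sndPart_batchNoise (W := W) (ηx := ηx) (ηy := ηy) (x0 := x0)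
    hb hh hf hL.le hY hy0 t (hgap t)
  have hgrad := fun t i => (sqIntegrable_gradient hh hf hL.le hY hy0 (hp t i)).fst (hle t)
  have hmix := SqIntegrableWrt.mix (W := W) (m := pastSigma ξ (t + 1)) (P := P)
    (w := fun ω => (dsgtaPath W ηx ηy Y h x0 y0 ξ t ω).g -
        fstPart (batchNoise W ηx ηy Y f' h x0 y0 ξ t ω) +
      (gradX f' (dsgtaPath W ηx ηy Y h x0 y0 ξ (t + 1) ω).x
        (dsgtaPath W ηx ηy Y h x0 y0 ξ (t + 1) ω).y -
      gradX f' (dsgtaPath W ηx ηy Y h x0 y0 ξ t ω).x (dsgtaPath W ηx ηy Y h x0 y0 ξ t ω).y))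
    fun i => (hr t i).add ((hgrad (t + 1) i).sub ((hgrad t i).mono (hmono t)))
  have hdev := SqIntegrableWrt.deviation hmix
  -- The tracker's cross term pairs the noise of iteration $t+1$ with a vector built from the
  -- noiseless tracker at $t$ and the exact gradients at $t$ and $t+1$, all fixed before that batch
  -- is drawn.
  obtain ⟨i3, z3⟩ := meanInner_fstPart_batchNoise (W := W) (ηx := ηx) (ηy := ηy) (x0 := x0)
    hb hh hf hL.le hY hy0 (t + 1)
    fun i => (SqIntegrableWrt.mix (W := W) hdev i).sub (hdev i)
  obtain ⟨i4, z4⟩ := integral_meanSq_batchNoise_le (W := W) (ηx := ηx) (ηy := ηy) (x0 := x0)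
    hb hn hh hf hL.le hY hy0 t
  obtain ⟨i5, z5⟩ := integral_meanSq_batchNoise_le (W := W) (ηx := ηx) (ηy := ηy) (x0 := x0)
    hb hn hh hf hL.le hY hy0 (t + 1)
  have i6 := (SqIntegrableWrt.agentAvg
    (w := fun ω => fstPart (batchNoise W ηx ηy Y f' h x0 y0 ξ t ω)) (he t)).memLp.integrable_norm_sq
  have z6 := integral_norm_agentAvg_batchNoise_sq_le (W := W) (ηx := ηx) (ηy := ηy) (x0 := x0)
    hb hn hh hf hL.le hY hy0 t
  have hstep := fun ω => lyapunov_step hs hW hρ hf hY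
    (fun i => dsgtaPath_y_mem (W := W) (ηx := ηx) (ηy := ηy) (h := h) (x0 := x0) (ξ := ξ)
      hY hy0 t ω i) (dsgtaTransition (f' := f') hb hW hY hy0 t ω)
  simp only [← hΨ, ← hN] at hstep
  have j1 := (hΨI t).sub (hNI t)
  have j2 := j1.add (i4.const_mul
    (162 * (κ ^ 2 * L ^ 2 * ηx ^ 2 / ρ ^ 3) + 6 * (ηy * κ * L)))
  have j3 := j2.add (i5.const_mul (1600 * (κ ^ 2 * L ^ 2 * ηx ^ 2 / ρ ^ 3)))
  have j4 := j3.add (i6.const_mul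
    (2 * (ηx * L * κ) + 24 * (L ^ 2 * κ ^ 2 * ηx ^ 2 / (ηy * μ) ^ 2) + ηy * κ * L))
  have j5 := j4.sub (i1.const_mul 2)
  have j6 := j5.add (i2.const_mul
    (8 * L ^ 2 / μ + 4 * ηy * (4 * L ^ 2 / ρ * trackingWeight L κ ρ ηx)))
  have j7 := j6.add (i3.const_mul (2 * trackingWeight L κ ρ ηx))
  have hfin := integral_mono (hΨI (t + 1)) j7 hstep
  rw [integral_add' j6 (i3.const_mul _), integral_add' j5 (i2.const_mul _),
    integral_sub' j4 (i1.const_mul _), integral_add' j3 (i6.const_mul _),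
    integral_add' j2 (i5.const_mul _), integral_add' j1 (i4.const_mul _),
    integral_sub' (hΨI t) (hNI t)] at hfin
  simp only [integral_const_mul] at hfin
  rw [z1, z2, z3] at hfin
  have c4 := mul_le_mul_of_nonneg_left z4
    (by positivity : 0 ≤ 162 * (κ ^ 2 * L ^ 2 * ηx ^ 2 / ρ ^ 3) + 6 * (ηy * κ * L))
  have c5 := mul_le_mul_of_nonneg_left z5
    (by positivity : 0 ≤ 1600 * (κ ^ 2 * L ^ 2 * ηx ^ 2 / ρ ^ 3))
  have c6 := mul_le_mul_of_nonneg_left z6 (by positivity : 0 ≤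
    2 * (ηx * L * κ) + 24 * (L ^ 2 * κ ^ 2 * ηx ^ 2 / (ηy * μ) ^ 2) + ηy * κ * L)
  linarith

end Expectation

/-! ### Final constants, initial value and conclusion. -/

/-- The coefficients obtained are 40, 400, 4, $1762=162+1600$, $6+1/N$ and 24, against 600, 4800,
16, $14400=225\cdot64$, 48 and 64. The remaining noise terms of the target are nonnegative surplus.
-/
lemma average_bound_le {L μ κ ρ ηx ηy : ℝ} (hs : StepSizes L μ κ ρ ηx ηy)
    {N B T σ D Sx Sg Φ₀ Φstar I : ℝ} (hN : 1 ≤ N) (hB : 1 ≤ B) (hT : 1 ≤ T) (hSx : 0 ≤ Sx)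
    (hSg : 0 ≤ Sg)
    (hI : I ≤ 2 / ηx * Φ₀ + consensusWeight L κ ρ * (1 / N * Sx) +
      trackingWeight L κ ρ ηx * (1 / N * Sg) + responseWeight L μ ηy * D ^ 2 - 2 / ηx * Φstar +
      T * ((162 * (κ ^ 2 * L ^ 2 * ηx ^ 2 / ρ ^ 3) + 6 * (ηy * κ * L)) * (σ ^ 2 / B) +
      1600 * (κ ^ 2 * L ^ 2 * ηx ^ 2 / ρ ^ 3) * (σ ^ 2 / B) +
      (2 * (ηx * L * κ) + 24 * (L ^ 2 * κ ^ 2 * ηx ^ 2 / (ηy * μ) ^ 2) + ηy * κ * L) *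
        (σ ^ 2 / (N * B)))) :
    1 / T * I ≤ 2 * (Φ₀ - Φstar) / (ηx * T)
        + 600 * κ ^ 2 * L ^ 2 * Sx / (N * ρ * T)
        + 16 * D ^ 2 * L ^ 2 / (ηy * μ * T)
        + 4800 * ηx ^ 2 * κ ^ 2 * L ^ 2 * σ ^ 2 / (B * ρ ^ 3 * T)
        + 2 * ηx * L * κ * σ ^ 2 / (N * B)
        + 4800 * ηx ^ 2 * κ ^ 2 * L ^ 2 * Sg / (N * ρ ^ 3 * T)
        + 48 * ηy * κ * L * σ ^ 2 / B
        + (1 / (N * ηy ^ 2 * μ ^ 2) + 225 / ρ ^ 3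
            + 54 * ηx ^ 2 * κ ^ 2 * L ^ 2 / (N * ρ * (ηy * μ)))
          * (64 * ηx ^ 2 * κ ^ 2 * L ^ 2 * σ ^ 2 / B) := by
  have hL := hs.L_pos
  have hμ := hs.mu_pos
  have hκ : 0 < κ := by linarith [hs.one_le_kappa]
  have hρ := hs.rho_pos
  have hηx := hs.etax_pos
  have hηy := hs.etay_pos
  have hN0 : 0 < N := by linarith
  have hB0 : 0 < B := by linarith
  have hT0 : 0 < T := by linarith
  have h1 := mul_le_mul_of_nonneg_left hI (by positivity : 0 ≤ 1 / T)
  set a := κ ^ 2 * L ^ 2 * Sx / (N * ρ * T) with ha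
  set g := ηx ^ 2 * κ ^ 2 * L ^ 2 * Sg / (N * ρ ^ 3 * T) with hg
  set c := D ^ 2 * L ^ 2 / (ηy * μ * T) with hc
  set u := κ ^ 2 * L ^ 2 * ηx ^ 2 * σ ^ 2 / (ρ ^ 3 * B) with hu
  set v := ηy * κ * L * σ ^ 2 / B with hv
  set w := ηx ^ 2 * κ ^ 2 * L ^ 2 * σ ^ 2 / (N * ηy ^ 2 * μ ^ 2 * B) with hw
  have ha0 : 0 ≤ a := by positivity
  have hg0 : 0 ≤ g := by positivity
  have hc0 : 0 ≤ c := by positivity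
  have hu0 : 0 ≤ u := by positivity
  have hv0 : 0 ≤ v := by positivity
  have hw0 : 0 ≤ w := by positivity
  have r0 : 0 ≤ 4800 * ηx ^ 2 * κ ^ 2 * L ^ 2 * σ ^ 2 / (B * ρ ^ 3 * T) := by positivity
  have r1 : 0 ≤ 54 * ηx ^ 2 * κ ^ 2 * L ^ 2 / (N * ρ * (ηy * μ)) *
      (64 * ηx ^ 2 * κ ^ 2 * L ^ 2 * σ ^ 2 / B) := by positivity
  have hvN : v / N ≤ v := div_le_self hv0 hN
  have e1 : 1 / T * (2 / ηx * Φ₀ + consensusWeight L κ ρ * (1 / N * Sx) +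
      trackingWeight L κ ρ ηx * (1 / N * Sg) + responseWeight L μ ηy * D ^ 2 - 2 / ηx * Φstar +
      T * ((162 * (κ ^ 2 * L ^ 2 * ηx ^ 2 / ρ ^ 3) + 6 * (ηy * κ * L)) * (σ ^ 2 / B) +
      1600 * (κ ^ 2 * L ^ 2 * ηx ^ 2 / ρ ^ 3) * (σ ^ 2 / B) +
      (2 * (ηx * L * κ) + 24 * (L ^ 2 * κ ^ 2 * ηx ^ 2 / (ηy * μ) ^ 2) + ηy * κ * L) *
        (σ ^ 2 / (N * B)))) = 2 * (Φ₀ - Φstar) / (ηx * T) + 40 * a + 400 * g + 4 * c + 1762 * u +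
        6 * v + 2 * ηx * L * κ * σ ^ 2 / (N * B) + 24 * w + v / N := by
    have t1 : 1 / T * (consensusWeight L κ ρ * (1 / N * Sx)) = 40 * a := by
      rw [ha, consensusWeight]; field_simp
    have t2 : 1 / T * (trackingWeight L κ ρ ηx * (1 / N * Sg)) = 400 * g := by
      rw [hg, trackingWeight]; field_simp
    have t3 : 1 / T * (responseWeight L μ ηy * D ^ 2) = 4 * c := by
      rw [hc, responseWeight]; field_simp
    have t4 : 1 / T * (2 / ηx * Φ₀ - 2 / ηx * Φstar) = 2 * (Φ₀ - Φstar) / (ηx * T) := by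
      field_simp
    have t5 : ∀ z, 1 / T * (T * z) = z := fun z => by field_simp
    have t6 : κ ^ 2 * L ^ 2 * ηx ^ 2 / ρ ^ 3 * (σ ^ 2 / B) = u := by rw [hu]; field_simp
    have t7 : ηy * κ * L * (σ ^ 2 / B) = v := by rw [hv]; ring
    have t8 : L ^ 2 * κ ^ 2 * ηx ^ 2 / (ηy * μ) ^ 2 * (σ ^ 2 / (N * B)) = w := by
      rw [hw]; field_simp
    have t9 : ηy * κ * L * (σ ^ 2 / (N * B)) = v / N := by rw [hv]; field_simp
    have t10 : 2 * (ηx * L * κ) * (σ ^ 2 / (N * B)) = 2 * ηx * L * κ * σ ^ 2 / (N * B) := by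
      ring
    rw [mul_add, t5, ← t1, ← t2, ← t3, ← t4, ← t6, ← t8, ← t9, ← t10, ← t7]
    ring
  have e2 : 600 * κ ^ 2 * L ^ 2 * Sx / (N * ρ * T) = 600 * a := by rw [ha]; ring
  have e3 : 16 * D ^ 2 * L ^ 2 / (ηy * μ * T) = 16 * c := by rw [hc]; ring
  have e4 : 4800 * ηx ^ 2 * κ ^ 2 * L ^ 2 * Sg / (N * ρ ^ 3 * T) = 4800 * g := by rw [hg]; ring
  have e5 : 48 * ηy * κ * L * σ ^ 2 / B = 48 * v := by rw [hv]; ring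
  have e6 : 1 / (N * ηy ^ 2 * μ ^ 2) * (64 * ηx ^ 2 * κ ^ 2 * L ^ 2 * σ ^ 2 / B) = 64 * w := by
    rw [hw]; field_simp
  have e7 : 225 / ρ ^ 3 * (64 * ηx ^ 2 * κ ^ 2 * L ^ 2 * σ ^ 2 / B) = 14400 * u := by
    rw [hu]; field_simp; ring
  rw [e1] at h1
  rw [e2, e3, e4, e5, add_mul, add_mul, e6, e7]
  linarith

/-- The diameter is used here: the initial response error is bounded by $D^2$ since $y_i^0$ and the
best response both lie in $\mathcal Y_i$. -/
lemma lyapunov_zero_le {n d : ℕ} {m : Fin n → ℕ} {L μ κ ρ D ηx ηy : ℝ} (hn : 0 < n)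
    (hs : StepSizes L μ κ ρ ηx ηy) {Y : ∀ i, Set (EuclideanSpace ℝ (Fin (m i)))}
    {f : ∀ i, JointSpace d (m i) → ℝ} {f' : ∀ i, JointSpace d (m i) → JointSpace d (m i)}
    (hf : ∀ i, SmoothStronglyConcave L μ (Y i) (f i) (f' i))
    (hY : ∀ i, ConstraintAssumption D (Y i))
    (x0 : Fin n → EuclideanSpace ℝ (Fin d)) {y0 : ∀ i, EuclideanSpace ℝ (Fin (m i))}
    (hy0 : ∀ i, y0 i ∈ Y i) (r : Fin n → EuclideanSpace ℝ (Fin d)) :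
    lyapunov Y f L μ κ ρ ηx ηy x0 y0 r ≤ 2 / ηx * primal Y f (agentAvg x0) +
      consensusWeight L κ ρ * (1 / n * ∑ i, ‖x0 i - agentAvg x0‖ ^ 2) +
      trackingWeight L κ ρ ηx * (1 / n * ∑ i, ‖r i‖ ^ 2) + responseWeight L μ ηy * D ^ 2 := by
  have hn' : (n : ℝ) ≠ 0 := by positivity
  have hL := hs.L_pos
  have hμ := hs.mu_pos
  have hρ := hs.rho_pos
  have hηy := hs.etay_pos
  have h1 : 0 ≤ trackingWeight L κ ρ ηx := by unfold trackingWeight; positivity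
  have h2 : 0 ≤ responseWeight L μ ηy := by unfold responseWeight; positivity
  have h3 := meanSq_deviation_le hn r
  have h4 : meanSq (responseGap Y f (agentAvg x0) y0) ≤ D ^ 2 := by
    have : ∀ i, ‖responseGap Y f (agentAvg x0) y0 i‖ ^ 2 ≤ D ^ 2 := fun i => by
      refine pow_le_pow_left₀ (norm_nonneg _) ?_ 2
      rw [responseGap, ← dist_eq_norm]
      exact (Metric.dist_le_diam_of_mem (hY i).compact.isBounded (hy0 i)
        ((hf i).bestResponse_mem (hY i) _)).trans (hY i).diam_le
    calc (1 / (n : ℝ)) * ∑ i, ‖responseGap Y f (agentAvg x0) y0 i‖ ^ 2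
        ≤ (1 / (n : ℝ)) * ∑ i : Fin n, D ^ 2 := by
          exact mul_le_mul_of_nonneg_left (Finset.sum_le_sum fun i _ => this i) (by positivity)
      _ = D ^ 2 := by
        rw [Finset.sum_const, Finset.card_univ, Fintype.card_fin, nsmul_eq_mul]
        field_simp
  exact add_le_add (add_le_add le_rfl (mul_le_mul_of_nonneg_left h3 h1))
    (mul_le_mul_of_nonneg_left h4 h2)

lemma le_lyapunov {n d : ℕ} {m : Fin n → ℕ} {L μ κ ρ ηx ηy Φstar : ℝ}
    (hs : StepSizes L μ κ ρ ηx ηy) {Y : ∀ i, Set (EuclideanSpace ℝ (Fin (m i)))}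
    {f : ∀ i, JointSpace d (m i) → ℝ} (hΦ : ∀ x, Φstar ≤ primal Y f x)
    (x : Fin n → EuclideanSpace ℝ (Fin d)) (y : ∀ i, EuclideanSpace ℝ (Fin (m i)))
    (r : Fin n → EuclideanSpace ℝ (Fin d)) :
    2 / ηx * Φstar ≤ lyapunov Y f L μ κ ρ ηx ηy x y r := by
  have hL := hs.L_pos
  have hμ := hs.mu_pos
  have hρ := hs.rho_pos
  have hηx := hs.etax_pos
  have hηy := hs.etay_pos
  have h0 : 2 / ηx * Φstar ≤ 2 / ηx * primal Y f (agentAvg x) :=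
    mul_le_mul_of_nonneg_left (hΦ _) (by positivity)
  have h1 : 0 ≤ consensusWeight L κ ρ * meanSq (deviation x) :=
    mul_nonneg (by unfold consensusWeight; positivity) (meanSq_nonneg _)
  have h2 : 0 ≤ trackingWeight L κ ρ ηx * meanSq (deviation r) :=
    mul_nonneg (by unfold trackingWeight; positivity) (meanSq_nonneg _)
  have h3 : 0 ≤ responseWeight L μ ηy * meanSq (responseGap Y f (agentAvg x) y) :=
    mul_nonneg (by unfold responseWeight; positivity) (meanSq_nonneg _)
  unfold lyapunov
  linarith

theorem theorem1 {n d b : ℕ} {m : Fin n → ℕ} {Ω : Type*} [MeasurableSpace Ω]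
    {Ξ : Fin n → Type*} [∀ i, MeasurableSpace (Ξ i)] (P : Measure Ω) [IsProbabilityMeasure P]
    (G : SimpleGraph (Fin n)) (W : Matrix (Fin n) (Fin n) ℝ)
    (Y : ∀ i, Set (EuclideanSpace ℝ (Fin (m i))))
    (f : ∀ i, JointSpace d (m i) → ℝ) (f' : ∀ i, JointSpace d (m i) → JointSpace d (m i))
    (h : ∀ i, JointSpace d (m i) → Ξ i → JointSpace d (m i))
    (ξ : ℕ → ∀ i : Fin n, Fin b → Ω → Ξ i)
    (L μ κ D Φstar σ lam ηx ηy : ℝ)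
    (x0 : Fin n → EuclideanSpace ℝ (Fin d)) (y0 : ∀ i, EuclideanSpace ℝ (Fin (m i)))
    (hb : 1 ≤ b) (hμ : 0 < μ) (hκ : κ = L / μ)
    (hW : NetworkAssumption G W) (hlam : lam = mixingNorm W)
    (hf : ∀ i, SmoothStronglyConcave L μ (Y i) (f i) (f' i))
    (hY : ∀ i, ConstraintAssumption D (Y i)) (hY' : ∃ i, (Y i).Nontrivial)
    (hΦ : ∀ x, Φstar ≤ primal Y f x)
    (hh : OracleAssumption P σ Y f' h ξ)
    (hy0 : ∀ i, y0 i ∈ Y i)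
    (hηy_pos : 0 < ηy) (hηy : ηy ≤ √(1 - lam ^ 2) / (9 * (L + μ)))
    (hηx_pos : 0 < ηx)
    (hηx₁ : ηx ≤ (1 - lam ^ 2) ^ 2 / (120 * √3 * κ * L))
    (hηx₂ : ηx ≤ ηy / (8 * √6 * κ ^ 2))
    (hηx₃ : ηx ≤ (ηy * μ) ^ ((1 : ℝ) / 4) * (1 - lam ^ 2) / (50 * κ * L))
    (xbar : ℕ → Ω → EuclideanSpace ℝ (Fin d))
    (hxbar : ∀ t ω,
      xbar t ω = agentAvg (dsgta W ηx ηy Y h x0 y0 (fun t i j => ξ t i j ω) t).x) :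
    Differentiable ℝ (primal Y f) ∧
    (∀ t, Integrable (fun ω => ‖gradient (primal Y f) (xbar t ω)‖ ^ 2) P) ∧
    ∀ T : ℕ, 1 ≤ T →
      (1 / (T : ℝ)) * ∑ t ∈ Finset.range T, ∫ ω, ‖gradient (primal Y f) (xbar t ω)‖ ^ 2 ∂P ≤
        2 * (primal Y f (agentAvg x0) - Φstar) / (ηx * T)
        + 600 * κ ^ 2 * L ^ 2 * (∑ i, ‖x0 i - agentAvg x0‖ ^ 2) / (n * (1 - lam ^ 2) * T)
        + 16 * D ^ 2 * L ^ 2 / (ηy * μ * T)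
        + 4800 * ηx ^ 2 * κ ^ 2 * L ^ 2 * σ ^ 2 / (b * (1 - lam ^ 2) ^ 3 * T)
        + 2 * ηx * L * κ * σ ^ 2 / (n * b)
        + 4800 * ηx ^ 2 * κ ^ 2 * L ^ 2 * (∑ i, ‖(f' i (joint (x0 i) (y0 i))).fst‖ ^ 2)
            / (n * (1 - lam ^ 2) ^ 3 * T)
        + 48 * ηy * κ * L * σ ^ 2 / b
        + (1 / (n * ηy ^ 2 * μ ^ 2) + 225 / (1 - lam ^ 2) ^ 3
            + 54 * ηx ^ 2 * κ ^ 2 * L ^ 2 / (n * (1 - lam ^ 2) * (ηy * μ)))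
          * (64 * ηx ^ 2 * κ ^ 2 * L ^ 2 * σ ^ 2 / b) := by
  have hn := hW.pos
  have hn1 : (1 : ℝ) ≤ n := by exact_mod_cast hn
  have hb1 : (1 : ℝ) ≤ b := by exact_mod_cast hb
  obtain ⟨i₀, hi₀⟩ := hY'
  have hμL := (hf i₀).le_of_nontrivial hi₀
  have hL : 0 < L := hμ.trans_le hμL
  have hs := stepSizes_of_le hμ hμL hκ hηy_pos hηy hηx_pos hηx₁ hηx₂
  have hgrad : gradient (primal Y f) = primalGrad Y f f' :=
    funext fun x => (hasGradientAt_primal hn hf hY hμ hL.le x).gradient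
  have hstep := integral_lyapunov_step (W := W) (ηx := ηx) (ηy := ηy) (x0 := x0) (P := P)
    hb hs hW (by rw [hlam]) hf hY hh hy0 (fun _ _ => rfl) (fun _ _ => rfl)
  have hNeq : ∀ t ω, ‖gradient (primal Y f) (xbar t ω)‖ ^ 2 =
      ‖primalGrad Y f f' (agentAvg (dsgtaPath W ηx ηy Y h x0 y0 ξ t ω).x)‖ ^ 2 := fun t ω => by
    rw [hgrad, hxbar]
    rfl
  refine ⟨fun x => (hasGradientAt_primal hn hf hY hμ hL.le x).differentiableAt, fun t => ?_,
    fun T hT => ?_⟩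
  · simp only [hNeq]
    exact (hstep t).1
  · simp only [hNeq]
    have hT1 : (1 : ℝ) ≤ T := by exact_mod_cast hT
    refine average_bound_le hs (N := n) (B := b) hn1 hb1 hT1
      (Finset.sum_nonneg fun i _ => by positivity) (Finset.sum_nonneg fun i _ => by positivity) ?_
    -- The Lyapunov differences telescope; it remains to bound the initial value from above and the
    -- final one from below.
    have hsum := Finset.sum_le_sum fun t (_ : t ∈ Finset.range T) => (hstep t).2.2
    rw [Finset.sum_add_distrib, Finset.sum_range_sub', Finset.sum_const, Finset.card_range,
      nsmul_eq_mul] at hsum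
    -- Without its noise the initial tracker is the exact gradient, so the initial Lyapunov value is
    -- deterministic and contributes no $\sigma^2$.
    have h0 : ∀ ω, (dsgtaPath W ηx ηy Y h x0 y0 ξ 0 ω).g -
        fstPart (batchNoise W ηx ηy Y f' h x0 y0 ξ 0 ω) = gradX f' x0 y0 := fun ω => by
      funext i
      have e : (dsgtaPath W ηx ηy Y h x0 y0 ξ 0 ω).g i =
          (f' i (joint (x0 i) (y0 i)) + batchNoise W ηx ηy Y f' h x0 y0 ξ 0 ω i).fst :=
        congrArg WithLp.fst (miniBatch_eq hb hY hy0 0 ω i)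
      rw [Pi.sub_apply, e, WithLp.add_fst]
      exact add_sub_cancel_right _ _
    have hinit := integral_mono (hstep 0).2.1 (integrable_const
        (2 / ηx * primal Y f (agentAvg x0) +
          consensusWeight L κ (1 - lam ^ 2) * (1 / n * ∑ i, ‖x0 i - agentAvg x0‖ ^ 2) +
          trackingWeight L κ (1 - lam ^ 2) ηx * (1 / n * ∑ i, ‖gradX f' x0 y0 i‖ ^ 2) +
          responseWeight L μ ηy * D ^ 2)) fun ω =>
      (congrArg (lyapunov Y f L μ κ (1 - lam ^ 2) ηx ηy x0 y0) (h0 ω)).trans_le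
        (lyapunov_zero_le hn hs hf hY x0 hy0 (gradX f' x0 y0))
    have hlast := integral_mono (integrable_const (2 / ηx * Φstar)) (hstep T).2.1 fun ω =>
      le_lyapunov hs hΦ _ _ _
    simp only [integral_const, probReal_univ, one_smul] at hinit hlast
    refine hsum.trans ?_
    simp only [gradX] at hinit
    linarith
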